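/- **Setting.** Let $(R,\mu)$ and $(S,\nu)$ be nonatomic probability spaces (every measurable set of positive measure has a measurable subset of strictly smaller positive measure), and let $p\in(0,\infty)$. $\mathcal M(R,\mu)$ denotes the complex-valued measurable functions on $R$ (identified a.e.), $f^*(t)=\inf\{\lambda>0:\mu(|f|>\lambda)\le t\}$, $t\in(0,1)$, is the nonincreasing rearrangement, and $(0,1)$ carries Lebesgue measure. $P\lesssim Q$ means $P\le cQ$ with a finite constant $c$ independent of the function and of the parameter $t$; $\approx$ is the two-sided version. *Function norms.* A rearrangement-invariant (r.i.) quasi-Banach function norm $\|\cdot\|_{X(0,1)}$ is a $[0,\infty]$-valued functional on nonnegative measurable functions on $(0,1)$ such that: $\|f\|=0$ iff $f=0$ a.e.; $\|\lambda f\|=\lambda\|f\|$ for $\lambda\ge0$; $\|f+g\|\le C(\|f\|+\|g\|)$ for some $C\ge1$; $f\le g$ a.e. implies $\|f\|\le\|g\|$; $f_k\nearrow f$ a.e. implies $\|f_k\|\nearrow\|f\|$; $\|1\|<\infty$; and $f^*=g^*$ implies $\|f\|=\|g\|$. It is an r.i. Banach function norm if moreover one can take $C=1$ and $\int_0^1 f\lesssim\|f\|$.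 For $f\in\mathcal M(R,\mu)$ put $\|f\|_{X(R,\mu)}=\|f^*\|_{X(0,1)}$, and $X(R,\mu)=\{f:\|f\|_{X(R,\mu)}<\infty\}$. The norm is $p$-convex if $\|f\|_{X^{1/p}(0,1)}=\|f^{1/p}\|_{X(0,1)}^p$ is an r.i. Banach function norm. The associate norm is $\|f\|_{X'(0,1)}=\sup\{\int_0^1 fg:\ g\ge0,\ \|g\|_{X(0,1)}\le1\}$. *Slowly varying functions.* A measurable $b:(0,1)\to(0,\infty)$ is slowly varying if for every $\varepsilon>0$ the function $t^\varepsilon b(t)$ is equivalent ($\approx$) on $(0,1)$ to a nondecreasing function and $t^{-\varepsilon}b(t)$ to a nonincreasing one. A pair $(b_1,b_2)$ of slowly varying functions belongs to $\mathcal B_p$ if (a) $b_1,b_2$ are continuous, (b) $b_1$ is nonincreasing and $b_2$ is nondecreasing, (c) $b_1(t)\approx b_1\big(t\,b_1(t)^pb_2(t)^{-p}\big)$ near $0^+$, (d) $\sup_{0<t<1}b_2(t)^p\int_t^1\frac{ds}{s\,b_1(s)^p}<\infty$. Let $\sigma:[0,1]\to[0,1]$ be the increasing bijection with $$t^p=\frac{1}{C}\int_0^{\sigma(t)^p}\big[b_1(s)b_2(s)^{-1}\big]^p\,ds,\quad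 t\in[0,1],\qquad C=\int_0^1\big[b_1(s)b_2(s)^{-1}\big]^p\,ds .$$ *Operators.* For $f\in\mathcal M(0,1)$ and $t\in(0,1)$ put $$U_{b_1,b_2,p}f(t)=\frac{f^*\big(\sigma^{-1}(t^{1/p})^p\big)}{b_2(t)},\quad T_{b_1,b_2,p}f(t)=\sup_{t\le s<1}\frac{f^*(\sigma(s^{1/p})^p)}{b_1(\sigma(s^{1/p})^p)^p},\quad S_{b_1,p}f(t)=\Big(\int_t^1\frac{|f(s)|^p}{s\,b_1(s)^p}\,ds\Big)^{1/p}.$$ A (not necessarily linear) operator $T:L^p(R,\mu)\to\mathcal M(S,\nu)$ is $(p,b_1,b_2)$-gaussible if $$\int_0^t\big[(Tf)^*(s)b_1(s)\big]^p\,ds\lesssim\int_0^t\big[f^*\big(\sigma^{-1}(s^{1/p})^p\big)b_1(s)b_2(s)^{-1}\big]^p\,ds\quad\text{for all } f\in L^p(R,\mu),\ t\in(0,1).$$ An operator $A$ is bounded from $X$ to $Y$ if it is defined on all of $X$ and $\|Af\|_Y\lesssim\|f\|_X$ for all $f\in X$. Let $\|g\|_{L^{q,b}}=\|b\,g^*\|_{L^q(0,1)}$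 for $q\in(0,\infty]$, and for spaces $X_0,X_1$ let $K(f,t;X_0,X_1)=\inf\{\|g\|_{X_0}+t\|h\|_{X_1}: f=g+h,\ g\in X_0,\ h\in X_1\}$ (with $\inf\emptyset=\infty$). **Theorem.** Let $p\in(0,\infty)$, $(b_1,b_2)\in\mathcal B_p$, and let $\|\cdot\|_{X(0,1)}$ and $\|\cdot\|_{Y(0,1)}$ be $p$-convex r.i. quasi-Banach function norms. The following four statements are equivalent. 1. Every $(p,b_1,b_2)$-gaussible operator $T$ is bounded from $X(R,\mu)$ to $Y(S,\nu)$. 2. Every operator $T:L^p(R,\mu)\to\mathcal M(S,\nu)$ that satisfies $$K(Tf,t;L^{p,b_1},L^{\infty,b_2})\lesssim K(f,t;L^p,L^\infty)\quad\text{for all } f\in L^p(R,\mu),\ t\in(0,1)$$ is bounded from $X(R,\mu)$ to $Y(S,\nu)$. 3. The operators $U_{b_1,b_2,p}$ and $S_{b_1,p}$ are bounded from $X(0,1)$ to $Y(0,1)$. 4. The operator $T_{b_1,b_2,p}$ is bounded from $(Y^{1/p})'(0,1)$ to $(X^{1/p})'(0,1)$. -/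

import Mathlib

open MeasureTheory Set Filter Topology
open scoped ENNReal NNReal

noncomputable section

namespace Gaussible

/-! ### Measure spaces and rearrangements -/

/-- A measure is nonatomic if every measurable set of positive measure has a measurable subset of
strictly smaller positive measure. -/
def Nonatomic {α : Type*} [MeasurableSpace α] (μ : Measure α) : Prop :=
  ∀ A, MeasurableSet A → 0 < μ A → ∃ B, B ⊆ A ∧ MeasurableSet B ∧ 0 < μ B ∧ μ B < μ A

/-- Lebesgue measure on the interval `(0,1)`, as a measure on `ℝ`. -/
abbrev leb01 : Measure ℝ := volume.restrict (Ioo (0 : ℝ) 1)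

/-- The nonincreasing rearrangement of a `[0,∞]`-valued function (only used for `t ∈ (0,1)`).
Allowing `l = 0` and `l = ∞` does not change the infimum. -/
def rearr {α : Type*} [MeasurableSpace α] (μ : Measure α) (f : α → ℝ≥0∞) (t : ℝ) : ℝ≥0∞ :=
  sInf {l : ℝ≥0∞ | μ {x | l < f x} ≤ ENNReal.ofReal t}

/-- The nonincreasing rearrangement `f*` of (the modulus of) `f ∈ M(R,μ)`.
The space `M(R,μ)` of complex measurable functions, identified almost everywhere, is
`R →ₘ[μ] ℂ`. -/
def star {α : Type*} [MeasurableSpace α] {μ : Measure α} (f : α →ₘ[μ] ℂ) (t : ℝ) : ℝ≥0∞ :=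
  rearr μ (fun x => ‖f x‖ₑ) t

/-! ### Rearrangement-invariant (quasi-)Banach function norms

Functionals on nonnegative (`[0,∞]`-valued) measurable functions on `(0,1)`. Functions are given on
`ℝ`, but only their values almost everywhere in `(0,1)` matter. -/

/-- Rearrangement-invariant quasi-Banach function norms on `(0,1)`. -/
structure IsRIQuasiNorm (ρ : (ℝ → ℝ≥0∞) → ℝ≥0∞) : Prop where
  eq_zero_iff : ∀ f, AEMeasurable f leb01 → (ρ f = 0 ↔ f =ᵐ[leb01] 0)
  smul : ∀ f, AEMeasurable f leb01 → ∀ a : ℝ≥0, ρ (fun t => (a : ℝ≥0∞) * f t) = a * ρ f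
  add_le : ∃ C : ℝ≥0, 1 ≤ C ∧ ∀ f g, AEMeasurable f leb01 → AEMeasurable g leb01 →
    ρ (fun t => f t + g t) ≤ C * (ρ f + ρ g)
  mono : ∀ f g, AEMeasurable f leb01 → AEMeasurable g leb01 → f ≤ᵐ[leb01] g → ρ f ≤ ρ g
  fatou : ∀ (f : ℕ → ℝ → ℝ≥0∞) (g : ℝ → ℝ≥0∞), (∀ k, AEMeasurable (f k) leb01) →
    AEMeasurable g leb01 → (∀ᵐ t ∂leb01, Monotone fun k => f k t) →
    (∀ᵐ t ∂leb01, Tendsto (fun k => f k t) atTop (𝓝 (g t))) →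
    Tendsto (fun k => ρ (f k)) atTop (𝓝 (ρ g))
  one_lt_top : ρ (fun _ => 1) < ∞
  rearr_inv : ∀ f g, AEMeasurable f leb01 → AEMeasurable g leb01 →
    (∀ t ∈ Ioo (0 : ℝ) 1, rearr leb01 f t = rearr leb01 g t) → ρ f = ρ g

/-- Rearrangement-invariant Banach function norms on `(0,1)`: in addition the triangle inequality
holds with constant one, and the norm dominates the `L¹` norm. -/
structure IsRIBanachNorm (ρ : (ℝ → ℝ≥0∞) → ℝ≥0∞) : Prop extends IsRIQuasiNorm ρ where
  triangle : ∀ f g, AEMeasurable f leb01 → AEMeasurable g leb01 →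
    ρ (fun t => f t + g t) ≤ ρ f + ρ g
  lintegral_le : ∃ C : ℝ≥0, ∀ f, AEMeasurable f leb01 → ∫⁻ t, f t ∂leb01 ≤ C * ρ f

/-- The functional `f ↦ ‖f^(1/p)‖_X ^ p`, denoted `‖·‖_{X^{1/p}(0,1)}`. -/
def powNorm (p : ℝ) (ρ : (ℝ → ℝ≥0∞) → ℝ≥0∞) (f : ℝ → ℝ≥0∞) : ℝ≥0∞ :=
  ρ (fun t => f t ^ (1 / p)) ^ p

/-- `p`-convexity of the functional `ρ`. -/
def PConvex (p : ℝ) (ρ : (ℝ → ℝ≥0∞) → ℝ≥0∞) : Prop := IsRIBanachNorm (powNorm p ρ)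

/-- The associate functional `‖f‖_{X'(0,1)} = sup {∫ f g : g ≥ 0, ‖g‖_X ≤ 1}`. -/
def assoc (ρ : (ℝ → ℝ≥0∞) → ℝ≥0∞) (f : ℝ → ℝ≥0∞) : ℝ≥0∞ :=
  ⨆ (g : ℝ → ℝ≥0∞) (_ : AEMeasurable g leb01) (_ : ρ g ≤ 1), ∫⁻ t, f t * g t ∂leb01

/-- `‖f‖_{X(R,μ)} = ‖f*‖_{X(0,1)}`; the space `X(R,μ)` consists of those `f ∈ M(R,μ)` for which
this is finite. -/
def spaceNorm (ρ : (ℝ → ℝ≥0∞) → ℝ≥0∞) {α : Type*} [MeasurableSpace α] {μ : Measure α}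
    (f : α →ₘ[μ] ℂ) : ℝ≥0∞ := ρ (star f)

/-! ### Slowly varying functions and the class `𝓑_p` -/

/-- Two real functions are equivalent on `(0,1)`, up to positive multiplicative constants. -/
def Equiv01 (f g : ℝ → ℝ) : Prop :=
  ∃ c > 0, ∃ C > 0, ∀ t ∈ Ioo (0 : ℝ) 1, c * g t ≤ f t ∧ f t ≤ C * g t

/-- Slowly varying functions `b : (0,1) → (0,∞)` (values outside `(0,1)` are irrelevant). -/
structure SlowlyVarying (b : ℝ → ℝ) : Prop where
  measurable : Measurable ((Ioo (0 : ℝ) 1).domRestrict b)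
  pos : ∀ t ∈ Ioo (0 : ℝ) 1, 0 < b t
  exists_mono : ∀ ε : ℝ, 0 < ε → ∃ g : ℝ → ℝ, MonotoneOn g (Ioo 0 1) ∧
    Equiv01 (fun t => t ^ ε * b t) g
  exists_anti : ∀ ε : ℝ, 0 < ε → ∃ g : ℝ → ℝ, AntitoneOn g (Ioo 0 1) ∧
    Equiv01 (fun t => t ^ (-ε) * b t) g

/-- The class `𝓑_p` of pairs of slowly varying functions. -/
structure ClassB (p : ℝ) (b₁ b₂ : ℝ → ℝ) : Prop where
  slow₁ : SlowlyVarying b₁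
  slow₂ : SlowlyVarying b₂
  cont₁ : ContinuousOn b₁ (Ioo 0 1)
  cont₂ : ContinuousOn b₂ (Ioo 0 1)
  anti₁ : AntitoneOn b₁ (Ioo 0 1)
  mono₂ : MonotoneOn b₂ (Ioo 0 1)
  equiv_near_zero : ∃ c > 0, ∃ C > 0, ∀ᶠ t in 𝓝[>] (0 : ℝ),
    c * b₁ (t * b₁ t ^ p * b₂ t ^ (-p)) ≤ b₁ t ∧ b₁ t ≤ C * b₁ (t * b₁ t ^ p * b₂ t ^ (-p))
  bounded : ∃ C : ℝ≥0, ∀ t ∈ Ioo (0 : ℝ) 1,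
    ENNReal.ofReal (b₂ t ^ p) * ∫⁻ s in Ioo t 1, ENNReal.ofReal (1 / (s * b₁ s ^ p)) ≤ C

/-! ### The function `σ` -/

/-- `σ : [0,1] → [0,1]` is an increasing bijection with
`t^p = C⁻¹ ∫_0^{σ(t)^p} (b₁/b₂)^p` on `[0,1]`, where `C = ∫_0^1 (b₁/b₂)^p`. -/
structure IsSigma (p : ℝ) (b₁ b₂ : ℝ → ℝ) (σ : ℝ → ℝ) : Prop where
  strictMonoOn : StrictMonoOn σ (Icc 0 1)
  bijOn : BijOn σ (Icc 0 1) (Icc 0 1)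
  identity : ∀ t ∈ Icc (0 : ℝ) 1, t ^ p =
    1 / (∫ s in (0 : ℝ)..1, (b₁ s * (b₂ s)⁻¹) ^ p) *
      ∫ s in (0 : ℝ)..(σ t ^ p), (b₁ s * (b₂ s)⁻¹) ^ p

theorem SlowlyVarying.exists_upper {b : ℝ → ℝ} (hb : SlowlyVarying b) {ε : ℝ} (hε : 0 < ε) :
    ∃ K > 0, ∀ t ∈ Ioo (0 : ℝ) 1, b t ≤ K * t ^ (-ε) := by
  have hh : (1 / 2 : ℝ) ∈ Ioo (0 : ℝ) 1 := by constructor <;> norm_num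
  obtain ⟨g, hg, c, hc, C, hC, h⟩ := hb.exists_mono ε hε
  obtain ⟨g', hg', c', hc', C', hC', h'⟩ := hb.exists_anti ε hε
  refine ⟨max 1 (max (C * g (1 / 2)) (C' * g' (1 / 2))), by positivity, fun t ht => ?_⟩
  have hpos := hb.pos t ht
  have e1 : t ^ ε * t ^ (-ε) = 1 := by
    rw [← Real.rpow_add ht.1]; simp
  have p1 : 0 < t ^ ε := Real.rpow_pos_of_pos ht.1 _
  have p2 : 0 < t ^ (-ε) := Real.rpow_pos_of_pos ht.1 _
  have p3 : t ^ ε ≤ 1 := Real.rpow_le_one ht.1.le ht.2.le hε.le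
  rcases le_total t (1 / 2) with h2 | h2
  · have a1 : t ^ ε * b t ≤ C * g (1 / 2) :=
      (h t ht).2.trans (mul_le_mul_of_nonneg_left (hg ht hh h2) hC.le)
    calc b t = (t ^ ε * b t) * t ^ (-ε) := by
          rw [mul_right_comm, e1, one_mul]
      _ ≤ _ := by
          gcongr
          exact a1.trans ((le_max_left _ _).trans (le_max_right _ _))
  · have a1 : t ^ (-ε) * b t ≤ C' * g' (1 / 2) :=
      (h' t ht).2.trans (mul_le_mul_of_nonneg_left (hg' hh ht h2) hC'.le)
    have p4 : 1 ≤ t ^ (-ε) := by nlinarith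
    have a2 : b t ≤ C' * g' (1 / 2) := le_trans (by nlinarith) a1
    have a3 := a2.trans ((le_max_right _ _).trans
      (le_max_right (1 : ℝ) (max (C * g (1 / 2)) (C' * g' (1 / 2)))))
    nlinarith

theorem SlowlyVarying.exists_lower {b : ℝ → ℝ} (hb : SlowlyVarying b) {ε : ℝ} (hε : 0 < ε) :
    ∃ K > 0, ∀ t ∈ Ioo (0 : ℝ) 1, K * t ^ ε ≤ b t := by
  have hh : (1 / 2 : ℝ) ∈ Ioo (0 : ℝ) 1 := by constructor <;> norm_num
  obtain ⟨g, hg, c, hc, C, hC, h⟩ := hb.exists_mono ε hε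
  obtain ⟨g', hg', c', hc', C', hC', h'⟩ := hb.exists_anti ε hε
  have bpos := hb.pos _ hh
  have gpos : 0 < g (1 / 2) := by
    have h1 := (h _ hh).2
    have h2 : 0 < (1 / 2 : ℝ) ^ ε * b (1 / 2) := by positivity
    exact pos_of_mul_pos_right (h2.trans_le h1) hC.le
  have gpos' : 0 < g' (1 / 2) := by
    have h1 := (h' _ hh).2
    have h2 : 0 < (1 / 2 : ℝ) ^ (-ε) * b (1 / 2) := by positivity
    exact pos_of_mul_pos_right (h2.trans_le h1) hC'.le
  refine ⟨min (c * g (1 / 2)) (c' * g' (1 / 2)), by positivity, fun t ht => ?_⟩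
  have hpos := hb.pos t ht
  have e1 : t ^ ε * t ^ (-ε) = 1 := by
    rw [← Real.rpow_add ht.1]; simp
  have p1 : 0 < t ^ ε := Real.rpow_pos_of_pos ht.1 _
  have p2 : 0 < t ^ (-ε) := Real.rpow_pos_of_pos ht.1 _
  have p3 : t ^ ε ≤ 1 := Real.rpow_le_one ht.1.le ht.2.le hε.le
  rcases le_total t (1 / 2) with h2 | h2
  · have a1 : c' * g' (1 / 2) ≤ t ^ (-ε) * b t :=
      (mul_le_mul_of_nonneg_left (hg' ht hh h2) hc'.le).trans (h' t ht).1
    calc _ ≤ (t ^ (-ε) * b t) * t ^ ε := by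
          gcongr
          exact (min_le_right _ _).trans a1
      _ = b t := by rw [mul_right_comm, mul_comm (t ^ (-ε)), e1, one_mul]
  · have a1 : c * g (1 / 2) ≤ t ^ ε * b t :=
      (mul_le_mul_of_nonneg_left (hg hh ht h2) hc.le).trans (h t ht).1
    have a2 := (min_le_left (c * g (1 / 2)) (c' * g' (1 / 2))).trans a1
    have a3 : 0 < min (c * g (1 / 2)) (c' * g' (1 / 2)) := by positivity
    nlinarith

theorem intervalIntegrable_weight {p : ℝ} (hp : 0 < p) {b₁ b₂ : ℝ → ℝ} (h₁ : SlowlyVarying b₁)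
    (h₂ : SlowlyVarying b₂) :
    IntervalIntegrable (fun s => (b₁ s * (b₂ s)⁻¹) ^ p) volume 0 1 := by
  have hε : 0 < 1 / (4 * p) := by positivity
  obtain ⟨K, hK, hK'⟩ := h₁.exists_upper hε
  obtain ⟨k, hk, hk'⟩ := h₂.exists_lower hε
  rw [intervalIntegrable_iff_integrableOn_Ioo_of_le zero_le_one]
  have hI : IntegrableOn (fun s : ℝ => (K * k⁻¹) ^ p * s ^ (-(1 / 2) : ℝ)) (Ioo 0 1) := by
    rw [← intervalIntegrable_iff_integrableOn_Ioo_of_le zero_le_one]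
    exact (intervalIntegral.intervalIntegrable_rpow' (by norm_num)).const_mul _
  have m₁ : AEMeasurable b₁ (volume.restrict (Ioo (0 : ℝ) 1)) :=
    (aemeasurable_restrict_iff_comap_subtype measurableSet_Ioo).2 h₁.measurable.aemeasurable
  have m₂ : AEMeasurable b₂ (volume.restrict (Ioo (0 : ℝ) 1)) :=
    (aemeasurable_restrict_iff_comap_subtype measurableSet_Ioo).2 h₂.measurable.aemeasurable
  refine Integrable.mono' hI ((m₁.mul m₂.inv).pow_const p).aestronglyMeasurable ?_
  refine (ae_restrict_mem measurableSet_Ioo).mono fun t ht => ?_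
  have q₁ := h₁.pos t ht
  have q₂ := h₂.pos t ht
  have pt : 0 < t ^ (1 / (4 * p)) := Real.rpow_pos_of_pos ht.1 _
  have pt' : 0 < t ^ (-(1 / (4 * p))) := Real.rpow_pos_of_pos ht.1 _
  have hw : 0 ≤ b₁ t * (b₂ t)⁻¹ := by positivity
  rw [Real.norm_of_nonneg (Real.rpow_nonneg hw _)]
  have hle : b₁ t * (b₂ t)⁻¹ ≤ (K * k⁻¹) * t ^ (-(1 / (2 * p))) := by
    calc b₁ t * (b₂ t)⁻¹ ≤ (K * t ^ (-(1 / (4 * p)))) * (k * t ^ (1 / (4 * p)))⁻¹ := by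
          gcongr
          · exact hK' t ht
          · exact hk' t ht
      _ = (K * k⁻¹) * (t ^ (-(1 / (4 * p))) * t ^ (-(1 / (4 * p)))) := by
          rw [mul_inv, ← Real.rpow_neg ht.1.le]; ring
      _ = _ := by
          rw [← Real.rpow_add ht.1]
          congr 2
          field_simp
          norm_num
  calc (b₁ t * (b₂ t)⁻¹) ^ p ≤ ((K * k⁻¹) * t ^ (-(1 / (2 * p)))) ^ p :=
        Real.rpow_le_rpow hw hle hp.le
    _ = _ := by
        rw [Real.mul_rpow (by positivity) (Real.rpow_nonneg ht.1.le _), ← Real.rpow_mul ht.1.le]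
        congr 2
        field_simp

/-- The function `σ` exists. -/
theorem exists_isSigma {p : ℝ} (hp : 0 < p) {b₁ b₂ : ℝ → ℝ} (h₁ : SlowlyVarying b₁)
    (h₂ : SlowlyVarying b₂) : ∃ σ, IsSigma p b₁ b₂ σ := by
  set w : ℝ → ℝ := fun s => (b₁ s * (b₂ s)⁻¹) ^ p with hw
  have hI : IntervalIntegrable w volume 0 1 := intervalIntegrable_weight hp h₁ h₂
  have hII : ∀ a ∈ Icc (0 : ℝ) 1, ∀ b ∈ Icc (0 : ℝ) 1, IntervalIntegrable w volume a b := by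
    intro a ha b hb
    apply hI.mono_set
    rw [uIcc_of_le zero_le_one]
    exact uIcc_subset_Icc ha hb
  have h0 : (0 : ℝ) ∈ Icc (0 : ℝ) 1 := by simp
  have h1 : (1 : ℝ) ∈ Icc (0 : ℝ) 1 := by simp
  set F : ℝ → ℝ := fun u => ∫ s in (0 : ℝ)..u, w s with hF
  have hmono : StrictMonoOn F (Icc 0 1) := by
    intro a ha b hb hab
    have : 0 < ∫ s in a..b, w s := by
      apply intervalIntegral.intervalIntegral_pos_of_pos_on (hII a ha b hb) _ hab
      intro x hx
      have hx' : x ∈ Ioo (0 : ℝ) 1 := ⟨ha.1.trans_lt hx.1, hx.2.trans_le hb.2⟩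
      have := h₁.pos x hx'
      have := h₂.pos x hx'
      simp only [hw]
      positivity
    have e := intervalIntegral.integral_add_adjacent_intervals (hII 0 h0 a ha) (hII a ha b hb)
    simp only [hF]
    linarith
  have hF0 : F 0 = 0 := by simp [hF]
  have hFpos : 0 < F 1 := hF0 ▸ hmono h0 h1 zero_lt_one
  have hcont : ContinuousOn F (Icc 0 1) := by
    have := intervalIntegral.continuousOn_primitive_interval (μ := volume) (f := w) (a := 0)
      (b := 1) (by
        rw [uIcc_of_le zero_le_one]
        exact (intervalIntegrable_iff_integrableOn_Icc_of_le zero_le_one).1 hI)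
    rwa [uIcc_of_le zero_le_one] at this
  have hpow : MapsTo (fun u : ℝ => u ^ p) (Icc 0 1) (Icc 0 1) := fun u hu =>
    ⟨Real.rpow_nonneg hu.1 _, Real.rpow_le_one hu.1 hu.2 hp.le⟩
  have hFn : ∀ u ∈ Icc (0 : ℝ) 1, 0 ≤ F (u ^ p) / F 1 := fun u hu =>
    div_nonneg (hF0 ▸ hmono.monotoneOn h0 (hpow hu) (hpow hu).1) hFpos.le
  set G : ℝ → ℝ := fun u => (F (u ^ p) / F 1) ^ (1 / p) with hG
  have hp' : 0 < 1 / p := by positivity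
  have hGmono : StrictMonoOn G (Icc 0 1) := by
    intro a ha b hb hab
    apply Real.rpow_lt_rpow (hFn a ha) _ hp'
    gcongr
    exact hmono (hpow ha) (hpow hb) (Real.rpow_lt_rpow ha.1 hab hp)
  have hG0 : G 0 = 0 := by simp [hG, Real.zero_rpow hp.ne', hF0, Real.zero_rpow (inv_pos.2 hp).ne']
  have hG1 : G 1 = 1 := by simp [hG, div_self hFpos.ne']
  have hGcont : ContinuousOn G (Icc 0 1) := by
    have : ContinuousOn (fun u : ℝ => F (u ^ p)) (Icc 0 1) :=
      hcont.comp (Real.continuous_rpow_const hp.le).continuousOn hpow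
    exact (this.div_const _).rpow_const fun _ _ => Or.inr hp'.le
  have hmaps : MapsTo G (Icc 0 1) (Icc 0 1) := fun u hu =>
    ⟨hG0 ▸ hGmono.monotoneOn h0 hu hu.1, hG1 ▸ hGmono.monotoneOn hu h1 hu.2⟩
  have hbij : BijOn G (Icc 0 1) (Icc 0 1) := by
    refine ⟨hmaps, hGmono.injOn, ?_⟩
    have := intermediate_value_Icc zero_le_one hGcont
    rwa [hG0, hG1] at this
  have hinv := hbij.invOn_invFunOn
  have hbij' : BijOn (Function.invFunOn G (Icc 0 1)) (Icc 0 1) (Icc 0 1) :=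
    (hbij.symm hinv.symm)
  refine ⟨Function.invFunOn G (Icc 0 1), ?_, hbij', ?_⟩
  · intro a ha b hb hab
    by_contra hcon
    have := hGmono.monotoneOn (hbij'.mapsTo hb) (hbij'.mapsTo ha) (not_lt.1 hcon)
    rw [hinv.2 ha, hinv.2 hb] at this
    linarith
  · intro t ht
    have e : G (Function.invFunOn G (Icc 0 1) t) = t := hinv.2 ht
    have hm := hbij'.mapsTo ht
    generalize Function.invFunOn G (Icc 0 1) t = u at e hm
    rw [← e]
    change ((F (u ^ p) / F 1) ^ (1 / p)) ^ p = 1 / F 1 * F (u ^ p)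
    rw [← Real.rpow_mul (hFn u hm), one_div_mul_cancel hp.ne', Real.rpow_one]
    ring

/-- The function `σ = σ(b₁, b₂, p)`; see `isSigma_sigma`. -/
def sigma (p : ℝ) (b₁ b₂ : ℝ → ℝ) : ℝ → ℝ := Classical.epsilon (IsSigma p b₁ b₂)

/-- `sigma p b₁ b₂` has the defining properties of `σ`. -/
theorem isSigma_sigma {p : ℝ} (hp : 0 < p) {b₁ b₂ : ℝ → ℝ} (h₁ : SlowlyVarying b₁)
    (h₂ : SlowlyVarying b₂) : IsSigma p b₁ b₂ (sigma p b₁ b₂) :=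
  Classical.epsilon_spec (exists_isSigma hp h₁ h₂)

/-- The inverse function `σ⁻¹ : [0,1] → [0,1]`. -/
def sigmaInv (p : ℝ) (b₁ b₂ : ℝ → ℝ) : ℝ → ℝ :=
  Function.invFunOn (sigma p b₁ b₂) (Icc 0 1)

/-! ### The operators `U`, `T` and `S`

They act on `M(0,1)` and take values in the `[0,∞]`-valued functions on `(0,1)`. -/

/-- `U f (t) = f*(σ⁻¹(t^{1/p})^p) / b₂(t)`. -/
def opU (p : ℝ) (b₁ b₂ : ℝ → ℝ) (f : ℝ →ₘ[leb01] ℂ) (t : ℝ) : ℝ≥0∞ :=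
  star f (sigmaInv p b₁ b₂ (t ^ (1 / p)) ^ p) / ENNReal.ofReal (b₂ t)

/-- `T f (t) = sup_{t ≤ s < 1} f*(σ(s^{1/p})^p) / b₁(σ(s^{1/p})^p)^p`. -/
def opT (p : ℝ) (b₁ b₂ : ℝ → ℝ) (f : ℝ →ₘ[leb01] ℂ) (t : ℝ) : ℝ≥0∞ :=
  ⨆ s ∈ Ico t 1, star f (sigma p b₁ b₂ (s ^ (1 / p)) ^ p) /
    ENNReal.ofReal (b₁ (sigma p b₁ b₂ (s ^ (1 / p)) ^ p) ^ p)

/-- `S f (t) = (∫_t^1 |f(s)|^p / (s b₁(s)^p) ds)^{1/p}`. -/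
def opS (p : ℝ) (b₁ : ℝ → ℝ) (f : ℝ →ₘ[leb01] ℂ) (t : ℝ) : ℝ≥0∞ :=
  (∫⁻ s in Ioo t 1, ‖f s‖ₑ ^ p / ENNReal.ofReal (s * b₁ s ^ p)) ^ (1 / p)

/-- Boundedness from `X(0,1)` to `Y(0,1)` of an operator on `M(0,1)`. -/
def Bounded01 (ρX ρY : (ℝ → ℝ≥0∞) → ℝ≥0∞) (A : (ℝ →ₘ[leb01] ℂ) → ℝ → ℝ≥0∞) : Prop :=
  ∃ C : ℝ≥0, ∀ f : ℝ →ₘ[leb01] ℂ, spaceNorm ρX f < ∞ → ρY (A f) ≤ C * spaceNorm ρX f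

/-! ### Operators from `L^p(R,μ)` to `M(S,ν)` -/

section Operators

variable {R S : Type*} [MeasurableSpace R] [MeasurableSpace S]

/-- The Orlicz–Karamata functional `‖f‖_{L^{q,b}} = ‖b f*‖_{L^q(0,1)}`, `0 < q ≤ ∞`. -/
def karamata (q : ℝ≥0∞) (b : ℝ → ℝ) {μ : Measure R} (f : R →ₘ[μ] ℂ) : ℝ≥0∞ :=
  eLpNorm (fun t => ENNReal.ofReal (b t) * star f t) q leb01

/-- The `K`-functional of the couple of spaces `{g : N₀ g < ∞}`, `{h : N₁ h < ∞}`. -/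
def Kfun {μ : Measure R} (N₀ N₁ : (R →ₘ[μ] ℂ) → ℝ≥0∞) (f : R →ₘ[μ] ℂ) (t : ℝ) : ℝ≥0∞ :=
  ⨅ (g : R →ₘ[μ] ℂ) (h : R →ₘ[μ] ℂ) (_ : N₀ g < ∞) (_ : N₁ h < ∞) (_ : f = g + h),
    N₀ g + ENNReal.ofReal t * N₁ h

variable {μ : Measure R} {ν : Measure S}

/-- The operator `T` is `(p, b₁, b₂)`-gaussible. -/
def IsGaussible (p : ℝ) (b₁ b₂ : ℝ → ℝ) (T : Lp ℂ (ENNReal.ofReal p) μ → (S →ₘ[ν] ℂ)) : Prop :=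
  ∃ C : ℝ≥0, ∀ f : Lp ℂ (ENNReal.ofReal p) μ, ∀ t ∈ Ioo (0 : ℝ) 1,
    ∫⁻ s in Ioo 0 t, (star (T f) s * ENNReal.ofReal (b₁ s)) ^ p ≤
      C * ∫⁻ s in Ioo 0 t, (star (f : R →ₘ[μ] ℂ) (sigmaInv p b₁ b₂ (s ^ (1 / p)) ^ p) *
        ENNReal.ofReal (b₁ s * (b₂ s)⁻¹)) ^ p

/-- The inequality `K(T f, t; L^{p,b₁}, L^{∞,b₂}) ≲ K(f, t; L^p, L^∞)` for all `f ∈ L^p` and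
`t ∈ (0,1)`. -/
def KInequality (p : ℝ) (b₁ b₂ : ℝ → ℝ) (T : Lp ℂ (ENNReal.ofReal p) μ → (S →ₘ[ν] ℂ)) : Prop :=
  ∃ C : ℝ≥0, ∀ f : Lp ℂ (ENNReal.ofReal p) μ, ∀ t ∈ Ioo (0 : ℝ) 1,
    Kfun (karamata (ENNReal.ofReal p) b₁) (karamata ∞ b₂) (T f) t ≤
      C * Kfun (fun g => eLpNorm g (ENNReal.ofReal p) μ) (fun g => eLpNorm g ∞ μ)
        (f : R →ₘ[μ] ℂ) t

/-- `T`, defined on `L^p(R,μ)`, is bounded from `X(R,μ)` to `Y(S,ν)`: it is defined on all of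
`X(R,μ)`, and `‖T f‖_Y ≤ C ‖f‖_X` there. -/
def BoundedOp (p : ℝ) (ρX ρY : (ℝ → ℝ≥0∞) → ℝ≥0∞)
    (T : Lp ℂ (ENNReal.ofReal p) μ → (S →ₘ[ν] ℂ)) : Prop :=
  ∃ C : ℝ≥0, ∀ f : R →ₘ[μ] ℂ, spaceNorm ρX f < ∞ →
    ∃ hf : f ∈ Lp ℂ (ENNReal.ofReal p) μ, spaceNorm ρY (T ⟨f, hf⟩) ≤ C * spaceNorm ρX f

end Operators

end Gaussible

end

open MeasureTheory Set Filter Topology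
open scoped ENNReal NNReal

noncomputable section

namespace Gaussible

/-! ### Distribution functions and the nonincreasing rearrangement. -/

section Rearrangement

variable {α β : Type*} [MeasurableSpace α] [MeasurableSpace β] {μ : Measure α} {ν : Measure β}

/-! Write w = (b₁/b₂)^p and φ(u) = σ⁻¹(u^{1/p})^p. The definition of σ says that φ(u) is ∫_0^u w
divided by the total mass of w. The substitution r = φ(s) therefore turns the right side of the
gaussible inequality into a constant times ∫_0^{φ(t)} (f*)^p (`lintegral_gaussible_rhs`). Slow
variation and monotonicity give φ(u) ≈ u w(u). Since ρ_X and ρ_Y are p-convex, the argument concerns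
p-th powers and Banach norms, where duality is available.

1 ⇔ 2. For (L^p, L^∞), the K-functional at t is equivalent to (∫_0^{t^p} (f*)^p)^{1/p}. For
(L^{p,b₁}, L^{∞,b₂}), at t = φ(u)^{1/p} it dominates (∫_0^u (f* b₁)^p)^{1/p}
(`setLIntegral_star_le_Kfun`). Truncation at height f*(u) bounds it by the same quantity plus t ·
sup_{s ≥ u} b₂(s) f*(s) (`Kfun_le`). For f replaced by Tf with T gaussible, φ(s) ≈ s w(s) absorbs
the supremum.

4 ⇒ 1. By the Lorentz–Luxemburg theorem (`IsRIBanachNorm.exists_assoc_le_one`) it suffices to pair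
((Tf)*)^p with g*, where g lies in the associate unit ball. Bound g* by b₁^p times the nonincreasing
function d(t) = sup_{s ≥ t} g*(s)/b₁(s)^p. Hardy's lemma carries the gaussible inequality over to
the weight d, and r = φ(s) turns the result into the pairing of (f*)^p with `opT` g.

1 ⇒ 3. Measure-preserving maps from R and S onto (0,1) transplant U and S to gaussible operators.
For U the gaussible estimate is an equality; for S it follows from Fubini, slow variation and
condition (d) (`ClassB.exists_opS_gaussible`).

3 ⇒ 4. Pair `opT` g with F* and substitute r = φ(s). The supremum over u ≥ s of g*(u)/b₁(u)^p is
split at u = φ(s). Up to φ(s), condition (c) makes it comparable with its value at s, and a pairing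
with U remains. Beyond φ(s), substituting back and using slow variation leaves ∫ H* F* with H =
g*/b₁^p. Resonance replaces this by integrals ∫ H F' with F' equimeasurable with F, and these are
controlled by S. -/

instance isProbabilityMeasure_leb01 : IsProbabilityMeasure leb01 := ⟨by simp [leb01]⟩

theorem antitone_rearr (μ : Measure α) (f : α → ℝ≥0∞) : Antitone (rearr μ f) := fun _ _ hst =>
  sInf_le_sInf fun _ hl => le_trans hl (ENNReal.ofReal_le_ofReal hst)

theorem measurable_rearr (μ : Measure α) (f : α → ℝ≥0∞) : Measurable (rearr μ f) :=
  (antitone_rearr μ f).measurable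

theorem measure_rearr_lt_le (μ : Measure α) (f : α → ℝ≥0∞) (t : ℝ) :
    μ {x | rearr μ f t < f x} ≤ ENNReal.ofReal t := by
  have hne : {l : ℝ≥0∞ | μ {x | l < f x} ≤ ENNReal.ofReal t}.Nonempty := ⟨∞, by simp⟩
  obtain ⟨u, hu, hlim, hmem⟩ := exists_seq_tendsto_sInf hne (OrderBot.bddBelow _)
  have hset : {x | rearr μ f t < f x} = ⋃ n, {x | u n < f x} := by
    ext x
    simp only [mem_ofPred_eq, mem_iUnion]
    refine ⟨fun hx => ?_, fun ⟨n, hn⟩ => ?_⟩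
    · exact ((tendsto_order.1 hlim).2 _ hx).exists
    · exact (sInf_le (hmem n)).trans_lt hn
  have hmono : Monotone fun n => {x | u n < f x} := fun m n hmn x hx => (hu hmn).trans_lt hx
  rw [hset, hmono.measure_iUnion]
  exact iSup_le hmem

/-- The infimum defining the rearrangement is attained, so f* and the distribution function form a
Galois connection. Later facts about f* are read off from distribution functions through this
equivalence. -/
theorem lt_rearr_iff {f : α → ℝ≥0∞} {t : ℝ} {l : ℝ≥0∞} :
    l < rearr μ f t ↔ ENNReal.ofReal t < μ {x | l < f x} := by
  refine ⟨fun h => ?_, fun h => ?_⟩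
  · by_contra hcon
    exact absurd h (not_lt.2 (sInf_le (not_lt.1 hcon)))
  · by_contra hcon
    refine absurd h (not_lt.2 (le_trans (measure_mono fun x hx => ?_)
      (measure_rearr_lt_le μ f t)))
    exact (not_lt.1 hcon).trans_lt hx

theorem rearr_le_iff {f : α → ℝ≥0∞} {t : ℝ} {l : ℝ≥0∞} :
    rearr μ f t ≤ l ↔ μ {x | l < f x} ≤ ENNReal.ofReal t := by
  rw [← not_lt, lt_rearr_iff, not_lt]

/-- Inside (0,1) the superlevel set of f* is the interval (0, m) with m = μ(f > l). Hence f and f*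
are equimeasurable. -/
theorem leb01_lt_rearr [IsProbabilityMeasure μ] (f : α → ℝ≥0∞) (l : ℝ≥0∞) :
    leb01 {t | l < rearr μ f t} = μ {x | l < f x} := by
  simp only [lt_rearr_iff]
  have hm : μ {x | l < f x} ≤ 1 := prob_le_one
  generalize μ {x | l < f x} = m at hm
  have hm' : m ≠ ∞ := ne_top_of_le_ne_top ENNReal.one_ne_top hm
  have : {t : ℝ | ENNReal.ofReal t < m} ∩ Ioo 0 1 = Ioo 0 m.toReal := by
    ext t
    simp only [mem_inter_iff, mem_ofPred_eq, mem_Ioo]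
    constructor
    · rintro ⟨h, h0, -⟩
      exact ⟨h0, (ENNReal.ofReal_lt_iff_lt_toReal h0.le hm').1 h⟩
    · rintro ⟨h0, h⟩
      refine ⟨(ENNReal.ofReal_lt_iff_lt_toReal h0.le hm').2 h, h0, h.trans_le ?_⟩
      exact ENNReal.toReal_le_of_le_ofReal zero_le_one (by simpa using hm)
  rw [Measure.restrict_apply' measurableSet_Ioo, this, Real.volume_Ioo, sub_zero,
    ENNReal.ofReal_toReal hm']

theorem rearr_congr {f : α → ℝ≥0∞} {g : β → ℝ≥0∞}
    (h : ∀ l, μ {x | l < f x} = ν {x | l < g x}) : rearr μ f = rearr ν g := by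
  funext t
  simp only [rearr, h]

theorem rearr_congr_ae {f g : α → ℝ≥0∞} (h : f =ᵐ[μ] g) : rearr μ f = rearr μ g :=
  rearr_congr fun l => measure_congr (by
    filter_upwards [h] with x hx
    exact propext (by change l < f x ↔ l < g x; rw [hx]))

theorem rearr_mono {f g : α → ℝ≥0∞} (h : ∀ x, f x ≤ g x) (t : ℝ) : rearr μ f t ≤ rearr μ g t :=
  sInf_le_sInf fun _ hl => le_trans (measure_mono fun x hx => lt_of_lt_of_le hx (h x)) hl

theorem rearr_rearr [IsProbabilityMeasure μ] (f : α → ℝ≥0∞) :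
    rearr leb01 (rearr μ f) = rearr μ f :=
  rearr_congr fun l => leb01_lt_rearr f l

theorem rearr_comp {f : β → ℝ≥0∞} (hf : AEMeasurable f ν) {τ : α → β}
    (hτ : MeasurePreserving τ μ ν) : rearr μ (fun x => f (τ x)) = rearr ν f := by
  refine rearr_congr fun l => ?_
  have : NullMeasurableSet {y | l < f y} ν := nullMeasurableSet_lt aemeasurable_const hf
  exact hτ.measure_preimage this

/-- Equimeasurable functions have the same law. -/
theorem map_eq_map_of_measure_lt [IsProbabilityMeasure μ] [IsProbabilityMeasure ν]
    {f : α → ℝ≥0∞} {g : β → ℝ≥0∞} (hf : AEMeasurable f μ) (hg : AEMeasurable g ν)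
    (h : ∀ l, μ {x | l < f x} = ν {x | l < g x}) : μ.map f = ν.map g := by
  have := Measure.isProbabilityMeasure_map hf
  have := Measure.isProbabilityMeasure_map hg
  refine Measure.ext_of_Iic _ _ fun a => ?_
  have e : (Iic a : Set ℝ≥0∞) = (Ioi a)ᶜ := by simp
  rw [e, prob_compl_eq_one_sub measurableSet_Ioi, prob_compl_eq_one_sub measurableSet_Ioi,
    Measure.map_apply_of_aemeasurable hf measurableSet_Ioi,
    Measure.map_apply_of_aemeasurable hg measurableSet_Ioi]
  congr 1
  exact h a

theorem map_rearr [IsProbabilityMeasure μ] {f : α → ℝ≥0∞} (hf : AEMeasurable f μ) :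
    leb01.map (rearr μ f) = μ.map f :=
  map_eq_map_of_measure_lt (measurable_rearr μ f).aemeasurable hf (leb01_lt_rearr f)

theorem lintegral_comp_rearr [IsProbabilityMeasure μ] {f : α → ℝ≥0∞} (hf : AEMeasurable f μ)
    {Φ : ℝ≥0∞ → ℝ≥0∞} (hΦ : Measurable Φ) :
    ∫⁻ t, Φ (rearr μ f t) ∂leb01 = ∫⁻ x, Φ (f x) ∂μ := by
  rw [← lintegral_map' hΦ.aemeasurable hf, ← map_rearr hf,
    lintegral_map' hΦ.aemeasurable (measurable_rearr μ f).aemeasurable]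

theorem rearr_rpow {q : ℝ} (hq : 0 < q) (f : α → ℝ≥0∞) (t : ℝ) :
    rearr μ (fun x => f x ^ q) t = rearr μ f t ^ q := by
  refine eq_of_forall_lt_iff fun l => ?_
  have key : ∀ y : ℝ≥0∞, l < y ^ q ↔ l ^ q⁻¹ < y := fun y => by
    rw [ENNReal.rpow_inv_lt_iff hq]
  rw [key, lt_rearr_iff, lt_rearr_iff]
  simp only [key]

/-- Only an inequality holds: rearranging a nonincreasing function makes it right-continuous, which
may lower it at jumps. -/
theorem rearr_le_of_antitoneOn {h : ℝ → ℝ≥0∞} (hh : AntitoneOn h (Ioo 0 1)) {s : ℝ}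
    (hs : s ∈ Ioo (0 : ℝ) 1) : rearr leb01 h s ≤ h s := by
  rw [rearr_le_iff, Measure.restrict_apply' measurableSet_Ioo]
  calc volume ({x | h s < h x} ∩ Ioo 0 1) ≤ volume (Ioo 0 s) := measure_mono fun x hx =>
        ⟨hx.2.1, not_le.1 fun hsx => absurd hx.1 (not_lt.2 (hh hs hx.2 hsx))⟩
    _ = ENNReal.ofReal s := by simp

theorem rearr_add_le (f g : α → ℝ≥0∞) {s t : ℝ} (hs : 0 ≤ s) (ht : 0 ≤ t) :
    rearr μ (fun x => f x + g x) (s + t) ≤ rearr μ f s + rearr μ g t := by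
  rw [rearr_le_iff]
  calc μ {x | rearr μ f s + rearr μ g t < f x + g x}
      ≤ μ ({x | rearr μ f s < f x} ∪ {x | rearr μ g t < g x}) := measure_mono fun x hx => by
        by_contra hcon
        simp only [mem_union, mem_ofPred_eq, not_or, not_lt] at hcon
        exact absurd hx (not_lt.2 (add_le_add hcon.1 hcon.2))
    _ ≤ _ := measure_union_le _ _
    _ ≤ ENNReal.ofReal s + ENNReal.ofReal t :=
        add_le_add (measure_rearr_lt_le _ _ _) (measure_rearr_lt_le _ _ _)
    _ = _ := (ENNReal.ofReal_add hs ht).symm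

end Rearrangement

/-! ### Layer-cake comparison, Hardy's lemma and the Hardy–Littlewood inequality. -/

section Hardy

variable {α β : Type*} [MeasurableSpace α] [MeasurableSpace β] {μ : Measure α} {ν : Measure β}

theorem lintegral_eq_iSup_min {f : α → ℝ≥0∞} (hf : AEMeasurable f μ) :
    ∫⁻ x, f x ∂μ = ⨆ n : ℕ, ∫⁻ x, min (f x) n ∂μ := by
  rw [← lintegral_iSup' (fun n => hf.min aemeasurable_const)
    (ae_of_all _ fun x m n hmn => min_le_min le_rfl (by exact_mod_cast hmn))]
  refine lintegral_congr fun x => ?_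
  apply le_antisymm _ (iSup_le fun n => min_le_left _ _)
  refine le_of_forall_lt fun c hc => ?_
  obtain ⟨n, hn⟩ := ENNReal.exists_nat_gt (ne_top_of_lt hc)
  exact (lt_min hc hn).trans_le (le_iSup (fun n : ℕ => min (f x) n) n)

theorem lintegral_min_eq_lintegral_measure_lt {f : α → ℝ≥0∞} (hf : AEMeasurable f μ) (n : ℕ) :
    ∫⁻ x, min (f x) n ∂μ = ∫⁻ t in Ioi (0 : ℝ), μ {x | ENNReal.ofReal t < min (f x) n} := by
  have hm : AEMeasurable (fun x => min (f x) (n : ℝ≥0∞)) μ := hf.min aemeasurable_const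
  have htop : ∀ x, min (f x) (n : ℝ≥0∞) ≠ ∞ := fun x =>
    ne_top_of_le_ne_top (ENNReal.natCast_ne_top n) (min_le_right _ _)
  have := lintegral_eq_lintegral_meas_lt μ (f := fun x => (min (f x) (n : ℝ≥0∞)).toReal)
    (ae_of_all _ fun x => ENNReal.toReal_nonneg) hm.ennreal_toReal
  simp only [ENNReal.ofReal_toReal (htop _)] at this
  rw [this]
  refine setLIntegral_congr_fun measurableSet_Ioi fun t ht => ?_
  simp only [ENNReal.ofReal_lt_iff_lt_toReal (le_of_lt ht) (htop _)]

/-- Layer cake, after truncation at height n so that the real-valued formula applies. The two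
measures may differ: Hardy's lemma integrates one function against two densities. -/
theorem lintegral_le_lintegral_of_measure_lt_le {f : α → ℝ≥0∞} {g : β → ℝ≥0∞}
    (hf : AEMeasurable f μ) (hg : AEMeasurable g ν) (h : ∀ l, μ {x | l < f x} ≤ ν {x | l < g x}) :
    ∫⁻ x, f x ∂μ ≤ ∫⁻ x, g x ∂ν := by
  rw [lintegral_eq_iSup_min hf, lintegral_eq_iSup_min hg]
  refine iSup_mono fun n => ?_
  rw [lintegral_min_eq_lintegral_measure_lt hf, lintegral_min_eq_lintegral_measure_lt hg]
  refine lintegral_mono fun t => ?_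
  simp only [lt_min_iff]
  by_cases ht : ENNReal.ofReal t < n
  · simpa [ht] using h _
  · simp [ht]

/-- Hardy's lemma. -/
theorem lintegral_mul_le_of_antitoneOn {a b D : ℝ → ℝ≥0∞} (ha : AEMeasurable a leb01)
    (hb : AEMeasurable b leb01) (hD : AntitoneOn D (Ioo 0 1)) {K : ℝ≥0}
    (hab : ∀ t ∈ Ioo (0 : ℝ) 1, ∫⁻ s in Ioo 0 t, a s ≤ K * ∫⁻ s in Ioo 0 t, b s) :
    ∫⁻ t, a t * D t ∂leb01 ≤ K * ∫⁻ t, b t * D t ∂leb01 := by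
  have hDm : AEMeasurable D leb01 := aemeasurable_restrict_of_antitoneOn measurableSet_Ioo hD
  have hDa : AEMeasurable D (leb01.withDensity a) :=
    hDm.mono_ac (withDensity_absolutelyContinuous _ _)
  have hDb : AEMeasurable D ((K : ℝ≥0∞) • leb01.withDensity b) :=
    (hDm.mono_ac (withDensity_absolutelyContinuous _ _)).smul_measure _
  -- The hypothesis covers t < 1; the endpoint c = 1 is reached by exhausting the interval from
  -- inside.
  have key : ∀ c ∈ Ioc (0 : ℝ) 1,
      leb01.withDensity a (Ioo 0 c) ≤ ((K : ℝ≥0∞) • leb01.withDensity b) (Ioo 0 c) := by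
    have h1 : ∀ c ∈ Ioo (0 : ℝ) 1,
        leb01.withDensity a (Ioo 0 c) ≤ ((K : ℝ≥0∞) • leb01.withDensity b) (Ioo 0 c) := by
      intro c hc
      rw [Measure.smul_apply, withDensity_apply _ measurableSet_Ioo,
        withDensity_apply _ measurableSet_Ioo, Measure.restrict_restrict measurableSet_Ioo,
        inter_eq_left.2 (Ioo_subset_Ioo_right hc.2.le)]
      exact hab c hc
    intro c hc
    obtain ⟨u, hu, hlt, hlim⟩ := exists_seq_strictMono_tendsto' hc.1
    have hU : Ioo 0 c = ⋃ n, Ioo 0 (u n) := by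
      ext x
      simp only [mem_Ioo, mem_iUnion]
      refine ⟨fun hx => ?_, fun ⟨n, hn⟩ => ⟨hn.1, hn.2.trans (hlt n).2⟩⟩
      obtain ⟨n, hn⟩ := ((tendsto_order.1 hlim).1 _ hx.2).exists
      exact ⟨n, hx.1, hn⟩
    have hm : Monotone fun n => Ioo 0 (u n) := fun m n hmn => Ioo_subset_Ioo_right (hu.monotone hmn)
    rw [hU, hm.measure_iUnion, hm.measure_iUnion]
    exact iSup_mono fun n => h1 _ ⟨(hlt n).1, (hlt n).2.trans_le hc.2⟩
  have e1 : ∫⁻ t, a t * D t ∂leb01 = ∫⁻ t, D t ∂(leb01.withDensity a) := by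
    rw [lintegral_withDensity_eq_lintegral_mul₀ ha hDm]; rfl
  have e2 : K * ∫⁻ t, b t * D t ∂leb01 = ∫⁻ t, D t ∂((K : ℝ≥0∞) • leb01.withDensity b) := by
    rw [lintegral_smul_measure, lintegral_withDensity_eq_lintegral_mul₀ hb hDm]; rfl
  rw [e1, e2]
  refine lintegral_le_lintegral_of_measure_lt_le hDa hDb fun l => ?_
  set s : Set ℝ := {x | l < D x} ∩ Ioo 0 1 with hs
  rcases s.eq_empty_or_nonempty with hse | hne
  · have : leb01 {x | l < D x} = 0 := by
      rw [Measure.restrict_apply' measurableSet_Ioo, ← hs, hse, measure_empty]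
    rw [withDensity_absolutelyContinuous _ _ this]
    exact zero_le
  · have hbdd : BddAbove s := ⟨1, fun x hx => hx.2.2.le⟩
    set c := sSup s
    have hc0 : 0 < c := by
      obtain ⟨x, hx⟩ := hne
      exact hx.2.1.trans_le (le_csSup hbdd hx)
    have hc1 : c ≤ 1 := csSup_le hne fun x hx => hx.2.2.le
    -- A superlevel set of a nonincreasing function is an initial interval up to its endpoint, so
    -- the two densities need comparing only on the intervals (0, c).
    have hae : {x | l < D x} =ᵐ[leb01] Ioo 0 c := by
      have hne' : ∀ᵐ x ∂leb01, x ≠ c := by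
        rw [ae_iff]
        simp
      filter_upwards [ae_restrict_mem measurableSet_Ioo, hne'] with x hx hxc
      refine propext ⟨fun h => ?_, fun h => ?_⟩
      · exact ⟨hx.1, lt_of_le_of_ne (le_csSup hbdd ⟨h, hx⟩) hxc⟩
      · obtain ⟨y, hy, hxy⟩ := exists_lt_of_lt_csSup hne h.2
        exact lt_of_lt_of_le hy.1 (hD hx hy.2 hxy.le)
    have ea := measure_congr ((withDensity_absolutelyContinuous leb01 a).ae_eq hae)
    have eb := measure_congr ((withDensity_absolutelyContinuous leb01 b).ae_eq hae)
    have := key c ⟨hc0, hc1⟩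
    rw [Measure.smul_apply] at this ⊢
    rw [ea, eb]
    exact this

/-- `∫ f κ ≤ (K + M) ∫_0^τ f*` if `κ ≤ K` and `∫ κ ≤ M τ`. -/
theorem lintegral_mul_le_rearr [IsProbabilityMeasure μ] {f κ : α → ℝ≥0∞} (hf : AEMeasurable f μ)
    (hκ : AEMeasurable κ μ) {K M : ℝ≥0} {τ : ℝ} (hτ : τ ∈ Ioo (0 : ℝ) 1) (hK : ∀ᵐ x ∂μ, κ x ≤ K)
    (hM : ∫⁻ x, κ x ∂μ ≤ M * ENNReal.ofReal τ) :
    ∫⁻ x, f x * κ x ∂μ ≤ (K + M) * ∫⁻ s in Ioo 0 τ, rearr μ f s := by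
  -- Split f ≤ (f - l)⁺ + l at l = f*(τ). The excess is paired with κ ≤ K and integrates to at most
  -- ∫_0^τ f*; the level is paired with ∫ κ ≤ M τ, and l τ ≤ ∫_0^τ f*.
  set l := rearr μ f τ
  have hsub : ∫⁻ x, (f x - l) ∂μ ≤ ∫⁻ s in Ioo 0 τ, rearr μ f s := by
    rw [← lintegral_comp_rearr hf (Φ := fun y => y - l) (measurable_id.sub_const l)]
    rw [← lintegral_indicator measurableSet_Ioo, ← lintegral_indicator measurableSet_Ioo]
    refine lintegral_mono fun s => ?_
    by_cases hs : s ∈ Ioo 0 τ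
    · have hs' : s ∈ Ioo (0 : ℝ) 1 := ⟨hs.1, hs.2.trans hτ.2⟩
      simp [indicator_of_mem hs, indicator_of_mem hs']
    · by_cases hs' : s ∈ Ioo (0 : ℝ) 1
      · have : rearr μ f s ≤ l := antitone_rearr μ f (not_lt.1 fun h => hs ⟨hs'.1, h⟩)
        rw [indicator_of_mem hs', tsub_eq_zero_of_le this]
        exact zero_le
      · simp [indicator_of_notMem hs']
  have hl : l * ENNReal.ofReal τ ≤ ∫⁻ s in Ioo 0 τ, rearr μ f s := by
    calc l * ENNReal.ofReal τ = ∫⁻ s in Ioo 0 τ, l := by simp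
      _ ≤ _ := setLIntegral_mono' measurableSet_Ioo fun s hs => antitone_rearr μ f hs.2.le
  calc ∫⁻ x, f x * κ x ∂μ ≤ ∫⁻ x, (K * (f x - l) + l * κ x) ∂μ := by
        refine lintegral_mono_ae ?_
        filter_upwards [hK] with x hx
        calc f x * κ x ≤ ((f x - l) + l) * κ x := by gcongr; exact le_tsub_add
          _ = κ x * (f x - l) + l * κ x := by ring
          _ ≤ _ := by gcongr
    _ = K * ∫⁻ x, (f x - l) ∂μ + l * ∫⁻ x, κ x ∂μ := by
        rw [lintegral_add_left' ((hf.sub_const l).const_mul _),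
          lintegral_const_mul'' _ (hf.sub_const l), lintegral_const_mul'' _ hκ]
    _ ≤ K * (∫⁻ s in Ioo 0 τ, rearr μ f s) + l * (M * ENNReal.ofReal τ) := by gcongr
    _ = K * (∫⁻ s in Ioo 0 τ, rearr μ f s) + M * (l * ENNReal.ofReal τ) := by ring
    _ ≤ K * (∫⁻ s in Ioo 0 τ, rearr μ f s) + M * (∫⁻ s in Ioo 0 τ, rearr μ f s) := by gcongr
    _ = _ := by ring

/-- With l = f*(t), the excess (f - l)⁺ has the same integral over (0,1) as (f* - l)⁺, and the
latter vanishes beyond t. -/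
theorem setLIntegral_le_rearr {f : ℝ → ℝ≥0∞} (hf : AEMeasurable f leb01) {t : ℝ}
    (ht : t ∈ Ioo (0 : ℝ) 1) : ∫⁻ s in Ioo 0 t, f s ≤ ∫⁻ s in Ioo 0 t, rearr leb01 f s := by
  set l := rearr leb01 f t
  have hr : leb01.restrict (Ioo 0 t) = volume.restrict (Ioo 0 t) := by
    rw [Measure.restrict_restrict measurableSet_Ioo,
      inter_eq_left.2 (Ioo_subset_Ioo_right ht.2.le)]
  calc ∫⁻ s in Ioo 0 t, f s ≤ ∫⁻ s in Ioo 0 t, ((f s - l) + l) :=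
        lintegral_mono fun s => le_tsub_add
    _ = (∫⁻ s in Ioo 0 t, (f s - l)) + l * ENNReal.ofReal t := by
        rw [lintegral_add_right _ measurable_const]; simp
    _ ≤ (∫⁻ s, (f s - l) ∂leb01) + l * ENNReal.ofReal t := by
        rw [← hr]
        exact add_le_add (setLIntegral_le_lintegral _ _) le_rfl
    _ = (∫⁻ s, (rearr leb01 f s - l) ∂leb01) + l * ENNReal.ofReal t := by
        rw [← lintegral_comp_rearr hf (Φ := fun y => y - l) (measurable_id.sub_const l)]
    _ = (∫⁻ s in Ioo 0 t, (rearr leb01 f s - l)) + l * ENNReal.ofReal t := by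
        congr 1
        rw [← hr, ← lintegral_indicator (μ := leb01) measurableSet_Ioo]
        refine lintegral_congr_ae ?_
        filter_upwards [ae_restrict_mem measurableSet_Ioo] with s hs
        by_cases hst : s < t
        · rw [indicator_of_mem (show s ∈ Ioo 0 t from ⟨hs.1, hst⟩)]
        · rw [indicator_of_notMem fun h => hst h.2]
          exact tsub_eq_zero_of_le (antitone_rearr _ _ (not_lt.1 hst))
    _ = ∫⁻ s in Ioo 0 t, ((rearr leb01 f s - l) + l) := by
        rw [lintegral_add_right _ measurable_const]; simp
    _ = _ := setLIntegral_congr_fun measurableSet_Ioo fun s hs =>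
        tsub_add_cancel_of_le (antitone_rearr _ _ hs.2.le)

/-- The Hardy–Littlewood inequality. -/
theorem lintegral_mul_le_rearr_mul {f D : ℝ → ℝ≥0∞} (hf : AEMeasurable f leb01)
    (hD : AntitoneOn D (Ioo 0 1)) :
    ∫⁻ t, f t * D t ∂leb01 ≤ ∫⁻ t, rearr leb01 f t * D t ∂leb01 := by
  have := lintegral_mul_le_of_antitoneOn hf (measurable_rearr leb01 f).aemeasurable hD (K := 1)
    fun t ht => by simpa using setLIntegral_le_rearr hf ht
  simpa using this

end Hardy

/-! ### Uniform distribution of a continuous distribution function. -/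

section ProbabilityIntegralTransform

open ProbabilityTheory

theorem continuous_cdf {P : Measure ℝ} [IsProbabilityMeasure P] (hP : ∀ c, P {c} = 0) :
    Continuous (cdf P) := by
  refine continuous_iff_continuousAt.2 fun c => ?_
  rw [(monotone_cdf P).continuousAt_iff_leftLim_eq_rightLim, StieltjesFunction.rightLim_eq]
  refine le_antisymm ((monotone_cdf P).leftLim_le le_rfl) ?_
  have := hP c
  rw [← measure_cdf P, StieltjesFunction.measure_singleton, ENNReal.ofReal_eq_zero] at this
  linarith

theorem eq_leb01_of_Iic {P : Measure ℝ} [IsProbabilityMeasure P]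
    (key : ∀ t ∈ Ioo (0 : ℝ) 1, P (Iic t) = ENNReal.ofReal t) : P = leb01 := by
  have hvol : ∀ t ∈ Icc (0 : ℝ) 1, leb01 (Iic t) = ENNReal.ofReal t := by
    intro t ht
    rw [Measure.restrict_apply' measurableSet_Ioo]
    apply le_antisymm
    · calc volume (Iic t ∩ Ioo 0 1) ≤ volume (Icc 0 t) :=
            measure_mono fun x hx => (show x ∈ Icc 0 t from ⟨hx.2.1.le, hx.1⟩)
        _ = _ := by simp
    · calc ENNReal.ofReal t = volume (Ioo 0 t) := by simp
        _ ≤ _ := measure_mono fun x hx =>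
          (show x ∈ Iic t ∩ Ioo 0 1 from ⟨hx.2.le, hx.1, hx.2.trans_le ht.2⟩)
  have hsmall : ∀ a : ℝ≥0∞, 0 < a → P (Iic 0) ≤ a := fun a ha => by
    obtain ⟨r, hr0, hra⟩ := ENNReal.lt_iff_exists_real_btwn.1 ha
    have hr0' : 0 < r := ENNReal.ofReal_pos.1 hra.1
    have hm : min r (1 / 2) ∈ Ioo (0 : ℝ) 1 :=
      ⟨lt_min hr0' (by norm_num), (min_le_right _ _).trans_lt (by norm_num)⟩
    calc P (Iic 0) ≤ P (Iic (min r (1 / 2))) := measure_mono (Iic_subset_Iic.2 hm.1.le)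
      _ = ENNReal.ofReal (min r (1 / 2)) := key _ hm
      _ ≤ ENNReal.ofReal r := ENNReal.ofReal_le_ofReal (min_le_left _ _)
      _ ≤ a := hra.2.le
  have hP1 : 1 ≤ P (Iic 1) := by
    refine le_of_forall_lt fun a ha => ?_
    obtain ⟨r, hr0, har, hr1⟩ := ENNReal.lt_iff_exists_real_btwn.1 ha
    have hm : max r (1 / 2) ∈ Ioo (0 : ℝ) 1 :=
      ⟨lt_max_of_lt_right (by norm_num), max_lt (by simpa using hr1) (by norm_num)⟩
    calc a < ENNReal.ofReal r := har
      _ ≤ ENNReal.ofReal (max r (1 / 2)) := ENNReal.ofReal_le_ofReal (le_max_left _ _)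
      _ = P (Iic (max r (1 / 2))) := (key _ hm).symm
      _ ≤ P (Iic 1) := measure_mono (Iic_subset_Iic.2 hm.2.le)
  refine Measure.ext_of_Iic _ _ fun t => ?_
  rcases le_or_gt t 0 with h0 | h0
  · have h1 : leb01 (Iic 0) = 0 := by simpa using hvol 0 ⟨le_rfl, zero_le_one⟩
    have h2 : P (Iic 0) = 0 :=
      le_antisymm (le_of_forall_gt_imp_ge_of_dense hsmall) zero_le
    rw [measure_mono_null (Iic_subset_Iic.2 h0) h1, measure_mono_null (Iic_subset_Iic.2 h0) h2]
  · rcases lt_or_ge t 1 with h1 | h1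
    · rw [key t ⟨h0, h1⟩, hvol t ⟨h0.le, h1.le⟩]
    · have h2 : 1 ≤ leb01 (Iic 1) := by simpa using (hvol 1 ⟨zero_le_one, le_rfl⟩).ge
      rw [le_antisymm prob_le_one (h2.trans (measure_mono (Iic_subset_Iic.2 h1))),
        le_antisymm prob_le_one (hP1.trans (measure_mono (Iic_subset_Iic.2 h1)))]

/-- The probability integral transform. -/
theorem map_cdf_eq_leb01 {P : Measure ℝ} [IsProbabilityMeasure P] (hP : ∀ c, P {c} = 0) :
    P.map (cdf P) = leb01 := by
  have hcont := continuous_cdf hP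
  have hmono := monotone_cdf P
  have := Measure.isProbabilityMeasure_map (μ := P) hcont.measurable.aemeasurable
  have key : ∀ t ∈ Ioo (0 : ℝ) 1, P {z | cdf P z ≤ t} = ENNReal.ofReal t := by
    intro t ht
    set s : Set ℝ := {z | cdf P z ≤ t} with hs
    have hne : s.Nonempty :=
      (((tendsto_order.1 (tendsto_cdf_atBot P)).2 t ht.1).mono fun z hz => hz.le).exists
    obtain ⟨M, hM⟩ := ((tendsto_order.1 (tendsto_cdf_atTop P)).1 t ht.2).exists
    have hbdd : BddAbove s := ⟨M, fun z hz => by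
      by_contra hcon
      exact absurd (hmono (not_le.1 hcon).le) (not_le.2 (lt_of_le_of_lt hz hM))⟩
    have hcl : IsClosed s := isClosed_le hcont continuous_const
    -- Continuity forces the distribution function to equal t at the largest point c of its sublevel
    -- set, so this set is (-∞, c] and has mass t.
    set c := sSup s
    have hc : cdf P c ≤ t := hcl.csSup_mem hne hbdd
    have hsc : s = Iic c := by
      ext z
      exact ⟨fun hz => le_csSup hbdd hz, fun hz => (hmono hz).trans hc⟩
    have hct : cdf P c = t := by
      refine hc.antisymm (le_of_not_gt fun hlt => ?_)
      have h1 : ∀ᶠ z in 𝓝[>] c, cdf P z < t :=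
        (hcont.continuousAt.eventually (gt_mem_nhds hlt)).filter_mono nhdsWithin_le_nhds
      obtain ⟨z, hz, hz'⟩ := (h1.and self_mem_nhdsWithin).exists
      exact absurd (le_csSup hbdd (show z ∈ s from hz.le)) (not_le.2 hz')
    rw [hsc, ← ofReal_cdf, hct]
  refine eq_leb01_of_Iic fun t ht => ?_
  rw [Measure.map_apply hcont.measurable measurableSet_Iic]
  exact key t ht

end ProbabilityIntegralTransform

/-! ### Nonatomic spaces: Sierpiński's theorem and a uniformly distributed function. -/

section Nonatomic

variable {α : Type*} [MeasurableSpace α] {μ : Measure α}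

/-- Split the set by a subset of smaller positive measure and keep the lighter piece; each round at
least halves the measure. -/
theorem Nonatomic.exists_small [IsFiniteMeasure μ] (hμ : Nonatomic μ) {A : Set α}
    (hA : MeasurableSet A) (hA0 : 0 < μ A) {ε : ℝ≥0∞} (hε : 0 < ε) :
    ∃ B ⊆ A, MeasurableSet B ∧ 0 < μ B ∧ μ B ≤ ε := by
  have key : ∀ n : ℕ, ∃ B ⊆ A, MeasurableSet B ∧ 0 < μ B ∧ μ B ≤ μ A * (2⁻¹) ^ n := by
    intro n
    induction n with
    | zero => exact ⟨A, Subset.rfl, hA, hA0, by simp⟩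
    | succ n ih =>
      obtain ⟨B, hBA, hB, hB0, hBn⟩ := ih
      obtain ⟨C, hCB, hC, hC0, hCl⟩ := hμ B hB hB0
      have hsum : μ C + μ (B \ C) = μ B := by
        rw [← measure_inter_add_sdiff B hC, inter_eq_right.2 hCB]
      have hD0 : 0 < μ (B \ C) := by
        refine pos_iff_ne_zero.2 fun h => ?_
        rw [h, add_zero] at hsum
        exact hCl.ne hsum
      have hhalf : ∀ x y : ℝ≥0∞, x + y = μ B → x ≤ y → x ≤ μ A * 2⁻¹ ^ (n + 1) := by
        intro x y hxy hle
        have : x ≤ μ B / 2 := by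
          rw [ENNReal.le_div_iff_mul_le (by simp) (by simp), mul_two, ← hxy]
          gcongr
        refine this.trans ?_
        rw [pow_succ, ← mul_assoc, div_eq_mul_inv]
        gcongr
      rcases le_total (μ C) (μ (B \ C)) with h | h
      · exact ⟨C, hCB.trans hBA, hC, hC0, hhalf _ _ hsum h⟩
      · exact ⟨B \ C, sdiff_subset.trans hBA, hB.diff hC, hD0, hhalf _ _ (by rw [add_comm, hsum]) h⟩
  have hlim : Tendsto (fun n : ℕ => μ A * (2⁻¹ : ℝ≥0∞) ^ n) atTop (𝓝 0) := by
    have := ENNReal.Tendsto.const_mul (a := μ A)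
      (ENNReal.tendsto_pow_atTop_nhds_zero_of_lt_one (r := 2⁻¹) (by simp))
      (Or.inr (measure_ne_top μ A))
    simpa using this
  obtain ⟨n, hn⟩ := ((tendsto_order.1 hlim).2 ε hε).exists
  obtain ⟨B, h1, h2, h3, h4⟩ := key n
  exact ⟨B, h1, h2, h3, h4.trans hn.le⟩

/-- Sierpiński's theorem. -/
theorem Nonatomic.exists_measure_eq [IsFiniteMeasure μ] (hμ : Nonatomic μ) {A : Set α}
    (hA : MeasurableSet A) {t : ℝ≥0∞} (ht : t ≤ μ A) : ∃ B ⊆ A, MeasurableSet B ∧ μ B = t := by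
  have htop : t ≠ ∞ := ne_top_of_le_ne_top (measure_ne_top μ A) ht
  let T := {B : Set α // B ⊆ A ∧ MeasurableSet B ∧ μ B ≤ t}
  -- Greedy enlargement: the set added has at least half the measure of any set that could be added
  -- without exceeding t.
  have step : ∀ B : T, ∃ B' : T, B.1 ⊆ B'.1 ∧ ∀ C ⊆ A \ B.1, MeasurableSet C → μ C ≤ t - μ B.1 →
      μ B.1 + μ C / 2 ≤ μ B'.1 := by
    rintro ⟨B, hBA, hB, hBt⟩
    let m : ℝ≥0∞ := ⨆ C : {C : Set α // C ⊆ A \ B ∧ MeasurableSet C ∧ μ C ≤ t - μ B}, μ C.1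
    have hmle : ∀ C ⊆ A \ B, MeasurableSet C → μ C ≤ t - μ B → μ C ≤ m := fun C h1 h2 h3 =>
      le_iSup (fun C : {C : Set α // C ⊆ A \ B ∧ MeasurableSet C ∧ μ C ≤ t - μ B} => μ C.1)
        ⟨C, h1, h2, h3⟩
    rcases eq_or_ne m 0 with hm | hm
    · refine ⟨⟨B, hBA, hB, hBt⟩, Subset.rfl, fun C h1 h2 h3 => ?_⟩
      have : μ C = 0 := le_antisymm (hm ▸ hmle C h1 h2 h3) zero_le
      simp [this]
    · have hmtop : m ≠ ∞ := by
        refine ne_top_of_le_ne_top htop (iSup_le fun C => ?_)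
        exact C.2.2.2.trans tsub_le_self
      obtain ⟨⟨C, h1, h2, h3⟩, hC⟩ := lt_iSup_iff.1 (ENNReal.half_lt_self hm hmtop)
      have hdisj : Disjoint B C := disjoint_left.2 fun x hx hx' => (h1 hx').2 hx
      have hU : μ (B ∪ C) = μ B + μ C := measure_union hdisj h2
      refine ⟨⟨B ∪ C, union_subset hBA (h1.trans sdiff_subset), hB.union h2, ?_⟩,
        subset_union_left, fun C' g1 g2 g3 => ?_⟩
      · rw [hU]
        calc μ B + μ C ≤ μ B + (t - μ B) := by gcongr
          _ = t := add_tsub_cancel_of_le hBt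
      · change μ B + μ C' / 2 ≤ μ (B ∪ C)
        rw [hU]
        gcongr
        exact (ENNReal.div_le_div_right (hmle C' g1 g2 g3) 2).trans hC.le
  choose next hnext hgain using step
  let B : ℕ → T := fun n => next^[n] ⟨∅, empty_subset _, MeasurableSet.empty, by simp⟩
  have hsucc : ∀ n, B (n + 1) = next (B n) := fun n => Function.iterate_succ_apply' _ _ _
  have hmono : Monotone fun n => (B n).1 := monotone_nat_of_le_succ fun n => by
    rw [hsucc]; exact hnext _
  refine ⟨⋃ n, (B n).1, iUnion_subset fun n => (B n).2.1,
    MeasurableSet.iUnion fun n => (B n).2.2.1, ?_⟩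
  have hle : μ (⋃ n, (B n).1) ≤ t := by
    rw [hmono.measure_iUnion]
    exact iSup_le fun n => (B n).2.2.2
  refine hle.antisymm (not_lt.1 fun hlt => ?_)
  set D := ⋃ n, (B n).1
  have hDm : MeasurableSet D := MeasurableSet.iUnion fun n => (B n).2.2.1
  have hpos : 0 < μ (A \ D) := by
    refine pos_iff_ne_zero.2 fun h0 => absurd ht (not_le.2 (lt_of_le_of_lt ?_ hlt))
    rw [← measure_inter_add_sdiff A hDm, h0, add_zero]
    exact measure_mono inter_subset_right
  obtain ⟨C, hCA, hC, hC0, hCt⟩ := hμ.exists_small (hA.diff hDm) hpos (tsub_pos_of_lt hlt)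
  -- If the union fell short of t, some C of positive measure would remain admissible at every
  -- stage. Each stage would then gain at least μ(C)/2, which is impossible below the finite bound
  -- t.
  have hgrow : ∀ n : ℕ, n * (μ C / 2) ≤ μ (B n).1 := by
    intro n
    induction n with
    | zero => simp
    | succ n ih =>
      rw [hsucc]
      refine le_trans ?_ (hgain (B n) C ?_ hC ?_)
      · rw [Nat.cast_succ, add_mul, one_mul]
        gcongr
      · exact hCA.trans (sdiff_subset_sdiff_right (subset_iUnion (fun n => (B n).1) n))
      · exact hCt.trans (tsub_le_tsub_left (measure_mono (subset_iUnion (fun n => (B n).1) n)) t)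
  have hC2 : μ C / 2 ≠ 0 := (ENNReal.half_pos hC0.ne').ne'
  obtain ⟨n, hn⟩ := ENNReal.exists_nat_mul_gt hC2 htop
  exact absurd ((hgrow n).trans (B n).2.2.2) (not_le.2 hn)

/-- Every cell {k = j} is cut into two halves of equal measure, labelled 2j and 2j + 1. -/
theorem Nonatomic.exists_refinement [IsFiniteMeasure μ] (hμ : Nonatomic μ) {k : α → ℕ}
    (hk : Measurable k) :
    ∃ k' : α → ℕ, Measurable k' ∧ ∀ m, ∃ j, μ (k' ⁻¹' {m}) ≤ μ (k ⁻¹' {j}) / 2 := by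
  have hcell : ∀ j, MeasurableSet (k ⁻¹' {j}) := fun j => hk (measurableSet_singleton j)
  have hhalf : ∀ j, ∃ B ⊆ k ⁻¹' {j}, MeasurableSet B ∧ μ B = μ (k ⁻¹' {j}) / 2 := fun j =>
    hμ.exists_measure_eq (hcell j) ENNReal.half_le_self
  choose H hHs hHm hH using hhalf
  classical
  let k' : α → ℕ := fun x => 2 * k x + if x ∈ H (k x) then 1 else 0
  have hpre : ∀ m, k' ⁻¹' {m} = H (m / 2) ∧ m % 2 = 1 ∨
      k' ⁻¹' {m} = k ⁻¹' {m / 2} \ H (m / 2) ∧ m % 2 = 0 := by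
    intro m
    rcases Nat.mod_two_eq_zero_or_one m with h | h
    · refine Or.inr ⟨?_, h⟩
      ext x
      simp only [mem_preimage, mem_singleton_iff, Set.mem_sdiff, k']
      constructor
      · intro hx
        split_ifs at hx with hxH
        · omega
        · have : k x = m / 2 := by omega
          exact ⟨this, this ▸ hxH⟩
      · rintro ⟨h1, h2⟩
        rw [h1, if_neg h2]
        omega
    · refine Or.inl ⟨?_, h⟩
      ext x
      simp only [mem_preimage, mem_singleton_iff, k']
      constructor
      · intro hx
        split_ifs at hx with hxH
        · have : k x = m / 2 := by omega
          exact this ▸ hxH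
        · omega
      · intro hx
        have h1 : k x = m / 2 := hHs _ hx
        rw [h1, if_pos hx]
        omega
  refine ⟨k', measurable_to_countable' fun m => ?_, fun m => ⟨m / 2, ?_⟩⟩
  · rcases hpre m with ⟨h, -⟩ | ⟨h, -⟩ <;> rw [h]
    exacts [hHm _, (hcell _).diff (hHm _)]
  · rcases hpre m with ⟨h, -⟩ | ⟨h, -⟩ <;> rw [h]
    · exact (hH _).le
    · rw [measure_sdiff (hHs _) (hHm _).nullMeasurableSet (measure_ne_top _ _), hH,
        ENNReal.sub_half (measure_ne_top _ _)]

/-- Refine the one-cell partition repeatedly: cells of level n have measure at most 2⁻ⁿ. The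
sequence of labels of a point is a measurable map into ℕ → ℕ, which embeds measurably in ℝ. A fibre
lies in one cell of every level, hence is null. -/
theorem Nonatomic.exists_noAtoms_real [IsFiniteMeasure μ] (hμ : Nonatomic μ) :
    ∃ Z : α → ℝ, Measurable Z ∧ ∀ c, μ (Z ⁻¹' {c}) = 0 := by
  have step : ∀ k : {k : α → ℕ // Measurable k}, ∃ k' : {k : α → ℕ // Measurable k},
      ∀ m, ∃ j, μ (k'.1 ⁻¹' {m}) ≤ μ (k.1 ⁻¹' {j}) / 2 := fun k => by
    obtain ⟨k', h1, h2⟩ := hμ.exists_refinement k.2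
    exact ⟨⟨k', h1⟩, h2⟩
  choose next hnext using step
  let k : ℕ → {k : α → ℕ // Measurable k} := fun n => next^[n] ⟨fun _ => 0, measurable_const⟩
  have hk : ∀ n m, μ ((k n).1 ⁻¹' {m}) ≤ μ univ * 2⁻¹ ^ n := by
    intro n
    induction n with
    | zero => intro m; simpa using measure_mono (subset_univ _)
    | succ n ih =>
      intro m
      obtain ⟨j, hj⟩ := hnext (k n) m
      have e : k (n + 1) = next (k n) := Function.iterate_succ_apply' _ _ _
      rw [e]
      refine hj.trans ?_
      rw [pow_succ, ← mul_assoc, div_eq_mul_inv]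
      gcongr
      exact ih j
  let h : α → ℕ → ℕ := fun x n => (k n).1 x
  have hh : Measurable h := measurable_pi_lambda _ fun n => (k n).2
  have he := measurableEmbedding_embeddingReal (ℕ → ℕ)
  refine ⟨fun x => embeddingReal (ℕ → ℕ) (h x), he.measurable.comp hh, fun c => ?_⟩
  by_cases hc : ∃ y, embeddingReal (ℕ → ℕ) y = c
  · obtain ⟨y, rfl⟩ := hc
    have hlim : Tendsto (fun n : ℕ => μ univ * (2⁻¹ : ℝ≥0∞) ^ n) atTop (𝓝 0) := by
      have := ENNReal.Tendsto.const_mul (a := μ univ)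
        (ENNReal.tendsto_pow_atTop_nhds_zero_of_lt_one (r := 2⁻¹) (by simp))
        (Or.inr (measure_ne_top μ univ))
      simpa using this
    refine le_antisymm (ge_of_tendsto' hlim fun n => ?_) zero_le
    refine (measure_mono fun x hx => ?_).trans (hk n (y n))
    have := he.injective (mem_preimage.1 hx)
    exact congrFun this n
  · have : (fun x => embeddingReal (ℕ → ℕ) (h x)) ⁻¹' {c} = ∅ :=
      eq_empty_of_forall_notMem fun x hx => hc ⟨_, hx⟩
    rw [this, measure_empty]

theorem measurePreserving_cdf_map [IsProbabilityMeasure μ] {Z : α → ℝ} (hZ : Measurable Z)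
    (hZ0 : ∀ c, μ (Z ⁻¹' {c}) = 0) :
    MeasurePreserving (fun x => ProbabilityTheory.cdf (μ.map Z) (Z x)) μ leb01 := by
  have := Measure.isProbabilityMeasure_map (μ := μ) hZ.aemeasurable
  have hP : ∀ c, μ.map Z {c} = 0 := fun c => by
    rw [Measure.map_apply hZ (measurableSet_singleton c), hZ0]
  have hm := (continuous_cdf hP).measurable
  refine ⟨hm.comp hZ, ?_⟩
  rw [← map_cdf_eq_leb01 hP, Measure.map_map hm hZ]
  rfl

/-- A nonatomic probability space carries a uniformly distributed function. -/
theorem Nonatomic.exists_measurePreserving [IsProbabilityMeasure μ] (hμ : Nonatomic μ) :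
    ∃ U : α → ℝ, MeasurePreserving U μ leb01 := by
  obtain ⟨Z, hZ, hZ0⟩ := hμ.exists_noAtoms_real
  exact ⟨_, measurePreserving_cdf_map hZ hZ0⟩

end Nonatomic

/-! ### Resonance: pairing rearrangements, and the associate functional. -/

section Resonance

/-- Take F' = F* ∘ τ, where τ preserves measure and sorts the points of (0,1) by decreasing ⌊n g⌋,
ties being broken by position. Since x lies in (0,1), the number x - ⌊n g(x)⌋ encodes this order
injectively. It therefore has an atomless law, and its distribution function supplies τ. Rounding g
to multiples of 1/n costs the error term. -/
theorem exists_rearr_eq_lintegral_le {g : ℝ → ℝ≥0} (hg : Measurable g) {F : ℝ → ℝ≥0∞}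
    {n : ℕ} (hn : 0 < n) :
    ∃ F' : ℝ → ℝ≥0∞, AEMeasurable F' leb01 ∧ rearr leb01 F' = rearr leb01 F ∧
      ∫⁻ t, rearr leb01 (fun x => (g x : ℝ≥0∞)) t * rearr leb01 F t ∂leb01 ≤
        ∫⁻ t, g t * F' t ∂leb01 + (n : ℝ≥0∞)⁻¹ * ∫⁻ t, rearr leb01 F t ∂leb01 := by
  let K : ℝ → ℕ := fun x => ⌊(n : ℝ≥0) * g x⌋₊
  have hK : Measurable K := Nat.measurable_floor.comp (hg.const_mul _)
  let Z : ℝ → ℝ := fun x => x - K x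
  have hZ : Measurable Z := measurable_id.sub (measurable_from_nat.comp hK)
  have hZ0 : ∀ c, leb01 (Z ⁻¹' {c}) = 0 := by
    intro c
    rw [Measure.restrict_apply' measurableSet_Ioo]
    refine Set.Subsingleton.measure_zero ?_ _
    rintro x ⟨hx, hx0, hx1⟩ y ⟨hy, hy0, hy1⟩
    have e : x - K x = y - K y := by
      rw [mem_preimage, mem_singleton_iff] at hx hy
      exact hx.trans hy.symm
    have e1 : K x < K y + 1 := by
      have : (K x : ℝ) < K y + 1 := by linarith
      exact_mod_cast this
    have e2 : K y < K x + 1 := by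
      have : (K y : ℝ) < K x + 1 := by linarith
      exact_mod_cast this
    have e3 : K x = K y := by omega
    rw [e3] at e
    linarith
  have hτ := measurePreserving_cdf_map hZ hZ0
  set τ : ℝ → ℝ := fun x => ProbabilityTheory.cdf (leb01.map Z) (Z x) with hτdef
  have hFm : Measurable (rearr leb01 F) := measurable_rearr _ _
  have hgm : Measurable (rearr leb01 fun x => (g x : ℝ≥0∞)) := measurable_rearr _ _
  have hFτ : Measurable fun x => rearr leb01 F (τ x) := hFm.comp hτ.measurable
  refine ⟨fun x => rearr leb01 F (τ x), hFτ.aemeasurable, ?_, ?_⟩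
  · rw [rearr_comp hFm.aemeasurable hτ, rearr_rearr]
  · have hn0 : (n : ℝ≥0) ≠ 0 := by exact_mod_cast hn.ne'
    have hpt : ∀ x ∈ Ioo (0 : ℝ) 1,
        rearr leb01 (fun x => (g x : ℝ≥0∞)) (τ x) ≤ g x + (n : ℝ≥0∞)⁻¹ := by
      intro x hx
      -- A point y where g exceeds (K x + 1)/n has K y ≥ K x + 1, so it precedes x in the order. The
      -- set of such points thus has measure at most τ x.
      have h1 : rearr leb01 (fun x => (g x : ℝ≥0∞)) (τ x) ≤
          ((((K x : ℝ≥0) + 1) / n : ℝ≥0) : ℝ≥0∞) := by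
        have := Measure.isProbabilityMeasure_map (μ := leb01) hZ.aemeasurable
        rw [rearr_le_iff, hτdef, ProbabilityTheory.ofReal_cdf,
          Measure.map_apply hZ measurableSet_Iic, Measure.restrict_apply' measurableSet_Ioo,
          Measure.restrict_apply' measurableSet_Ioo]
        refine measure_mono fun y hy => ⟨?_, hy.2⟩
        have hy1 : ((K x : ℝ≥0) + 1) / n < g y := ENNReal.coe_lt_coe.1 hy.1
        rw [div_lt_iff₀ (by positivity)] at hy1
        have hy2 : K x + 1 ≤ K y := Nat.le_floor (by push_cast; rw [mul_comm]; exact hy1.le)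
        have hy3 : (K x : ℝ) + 1 ≤ K y := by exact_mod_cast hy2
        have := hy.2.2
        have := hx.1
        change y - K y ≤ x - K x
        linarith
      refine h1.trans ?_
      have h2 : ((K x : ℝ≥0) + 1) / n ≤ g x + (n : ℝ≥0)⁻¹ := by
        rw [div_le_iff₀ (by positivity), add_mul, inv_mul_cancel₀ hn0]
        gcongr
        rw [mul_comm]
        exact Nat.floor_le zero_le
      calc ((((K x : ℝ≥0) + 1) / n : ℝ≥0) : ℝ≥0∞) ≤ ((g x + (n : ℝ≥0)⁻¹ : ℝ≥0) : ℝ≥0∞) :=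
            ENNReal.coe_le_coe.2 h2
        _ = _ := by rw [ENNReal.coe_add, ENNReal.coe_inv hn0, ENNReal.coe_natCast]
    calc ∫⁻ t, rearr leb01 (fun x => (g x : ℝ≥0∞)) t * rearr leb01 F t ∂leb01
        = ∫⁻ x, rearr leb01 (fun x => (g x : ℝ≥0∞)) (τ x) * rearr leb01 F (τ x) ∂leb01 :=
          (hτ.lintegral_comp (hgm.mul hFm)).symm
      _ ≤ ∫⁻ x, (g x * rearr leb01 F (τ x) + (n : ℝ≥0∞)⁻¹ * rearr leb01 F (τ x)) ∂leb01 := by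
          refine lintegral_mono_ae ?_
          filter_upwards [ae_restrict_mem measurableSet_Ioo] with x hx
          rw [← add_mul]
          gcongr
          exact hpt x hx
      _ = ∫⁻ x, g x * rearr leb01 F (τ x) ∂leb01 +
            (n : ℝ≥0∞)⁻¹ * ∫⁻ x, rearr leb01 F (τ x) ∂leb01 := by
          rw [lintegral_add_right _ (hFτ.const_mul _), lintegral_const_mul _ hFτ]
      _ = _ := by rw [hτ.lintegral_comp hFm]

/-- `∫ g* F*` is approximated by the integrals `∫ g F'` with `F'` equimeasurable with `F`. -/
theorem lintegral_rearr_mul_rearr_le {g : ℝ → ℝ≥0∞} (hg : AEMeasurable g leb01)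
    (hgtop : ∀ᵐ t ∂leb01, g t < ∞) {F : ℝ → ℝ≥0∞} (hF : AEMeasurable F leb01)
    (hFtop : ∫⁻ t, F t ∂leb01 < ∞) {c : ℝ≥0∞}
    (h : ∀ F' : ℝ → ℝ≥0∞, AEMeasurable F' leb01 → rearr leb01 F' = rearr leb01 F →
      ∫⁻ t, g t * F' t ∂leb01 ≤ c) :
    ∫⁻ t, rearr leb01 g t * rearr leb01 F t ∂leb01 ≤ c := by
  let g' : ℝ → ℝ≥0 := fun x => (hg.mk g x).toNNReal
  have hg' : Measurable g' := hg.measurable_mk.ennreal_toNNReal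
  have hae : g =ᵐ[leb01] fun x => (g' x : ℝ≥0∞) := by
    filter_upwards [hg.ae_eq_mk, hgtop] with x hx hx'
    rw [hx] at hx' ⊢
    exact (ENNReal.coe_toNNReal hx'.ne).symm
  -- Finiteness of this integral makes the error n⁻¹ ∫ F* disappear in the limit.
  have hI : ∫⁻ t, rearr leb01 F t ∂leb01 ≠ ∞ := by
    rw [lintegral_comp_rearr hF (Φ := fun y => y) measurable_id]
    exact hFtop.ne
  rw [rearr_congr_ae hae]
  have key : ∀ n : ℕ, ∫⁻ t, rearr leb01 (fun x => (g' x : ℝ≥0∞)) t * rearr leb01 F t ∂leb01 ≤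
      c + ((n + 1 : ℕ) : ℝ≥0∞)⁻¹ * ∫⁻ t, rearr leb01 F t ∂leb01 := by
    intro n
    obtain ⟨F', h1, h2, h3⟩ := exists_rearr_eq_lintegral_le hg' (F := F) (Nat.succ_pos n)
    refine h3.trans ?_
    gcongr
    refine le_of_eq_of_le (lintegral_congr_ae ?_) (h F' h1 h2)
    filter_upwards [hae] with x hx
    rw [hx]
  have hlim : Tendsto (fun n : ℕ => c + ((n + 1 : ℕ) : ℝ≥0∞)⁻¹ * ∫⁻ t, rearr leb01 F t ∂leb01)
      atTop (𝓝 (c + 0 * ∫⁻ t, rearr leb01 F t ∂leb01)) := by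
    refine Tendsto.add tendsto_const_nhds (ENNReal.Tendsto.mul_const ?_ (Or.inr hI))
    exact ENNReal.tendsto_inv_nat_nhds_zero.comp (tendsto_add_atTop_nat 1)
  rw [zero_mul, add_zero] at hlim
  exact ge_of_tendsto' hlim key

theorem IsRIQuasiNorm.congr_rearr {N : (ℝ → ℝ≥0∞) → ℝ≥0∞} (hN : IsRIQuasiNorm N)
    {f g : ℝ → ℝ≥0∞} (hf : AEMeasurable f leb01) (hg : AEMeasurable g leb01)
    (h : rearr leb01 f = rearr leb01 g) : N f = N g :=
  hN.rearr_inv f g hf hg fun t _ => by rw [h]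

theorem IsRIQuasiNorm.apply_rearr {N : (ℝ → ℝ≥0∞) → ℝ≥0∞} (hN : IsRIQuasiNorm N)
    {f : ℝ → ℝ≥0∞} (hf : AEMeasurable f leb01) : N (rearr leb01 f) = N f :=
  hN.congr_rearr (measurable_rearr _ _).aemeasurable hf (rearr_rearr f)

theorem lintegral_mul_le_assoc (N : (ℝ → ℝ≥0∞) → ℝ≥0∞) (f : ℝ → ℝ≥0∞) {g : ℝ → ℝ≥0∞}
    (hg : AEMeasurable g leb01) (hg1 : N g ≤ 1) : ∫⁻ t, f t * g t ∂leb01 ≤ assoc N f :=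
  le_iSup_of_le g (le_iSup_of_le hg (le_iSup_of_le hg1 le_rfl))

theorem assoc_le {N : (ℝ → ℝ≥0∞) → ℝ≥0∞} {f : ℝ → ℝ≥0∞} {c : ℝ≥0∞}
    (h : ∀ g, AEMeasurable g leb01 → N g ≤ 1 → ∫⁻ t, f t * g t ∂leb01 ≤ c) : assoc N f ≤ c :=
  iSup_le fun g => iSup_le fun h1 => iSup_le fun h2 => h g h1 h2

theorem IsRIBanachNorm.lintegral_lt_top {N : (ℝ → ℝ≥0∞) → ℝ≥0∞} (hN : IsRIBanachNorm N)
    {f : ℝ → ℝ≥0∞} (hf : AEMeasurable f leb01) (h : N f < ∞) : ∫⁻ t, f t ∂leb01 < ∞ := by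
  obtain ⟨C, hC⟩ := hN.lintegral_le
  exact (hC f hf).trans_lt (ENNReal.mul_lt_top ENNReal.coe_lt_top h)

/-- Hardy–Littlewood replaces a test function F by F*, and resonance replaces ∫ g* F* by integrals ∫
g F' with F' equimeasurable with F. Such F' stay in the unit ball. -/
theorem IsRIBanachNorm.assoc_rearr_le {N : (ℝ → ℝ≥0∞) → ℝ≥0∞} (hN : IsRIBanachNorm N)
    {g : ℝ → ℝ≥0∞} (hg : AEMeasurable g leb01) (hgtop : ∀ᵐ t ∂leb01, g t < ∞) :
    assoc N (rearr leb01 g) ≤ assoc N g := by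
  refine assoc_le fun F hF hF1 => ?_
  have hHL : ∫⁻ t, rearr leb01 g t * F t ∂leb01 ≤
      ∫⁻ t, rearr leb01 g t * rearr leb01 F t ∂leb01 := by
    simpa only [mul_comm] using
      lintegral_mul_le_rearr_mul hF ((antitone_rearr leb01 g).antitoneOn _)
  refine hHL.trans (lintegral_rearr_mul_rearr_le hg hgtop hF
    (hN.lintegral_lt_top hF (hF1.trans_lt ENNReal.one_lt_top)) fun F' hF' he => ?_)
  refine lintegral_mul_le_assoc N g hF' ?_
  rw [hN.congr_rearr hF' hF he]
  exact hF1

theorem IsRIQuasiNorm.lintegral_mul_le {N : (ℝ → ℝ≥0∞) → ℝ≥0∞} (hN : IsRIQuasiNorm N)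
    (f : ℝ → ℝ≥0∞) {g : ℝ → ℝ≥0∞} (hg : AEMeasurable g leb01) (hgtop : N g < ∞) :
    ∫⁻ t, f t * g t ∂leb01 ≤ assoc N f * N g := by
  rcases eq_or_ne (N g) 0 with h0 | h0
  · have := (hN.eq_zero_iff g hg).1 h0
    rw [h0, mul_zero, le_zero_iff]
    rw [← lintegral_zero (μ := leb01) (α := ℝ)]
    refine lintegral_congr_ae ?_
    filter_upwards [this] with t ht
    simp [ht]
  · lift N g to ℝ≥0 using hgtop.ne with c hc
    have hc0 : c ≠ 0 := by simpa using h0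
    have hs := hN.smul g hg c⁻¹
    have h1 : N (fun t => ((c⁻¹ : ℝ≥0) : ℝ≥0∞) * g t) ≤ 1 := by
      rw [hs, ← hc, ← ENNReal.coe_mul, inv_mul_cancel₀ hc0, ENNReal.coe_one]
    have h2 := lintegral_mul_le_assoc N f (hg.const_mul _) h1
    calc ∫⁻ t, f t * g t ∂leb01
        = ∫⁻ t, (f t * (((c⁻¹ : ℝ≥0) : ℝ≥0∞) * g t)) * c ∂leb01 := by
          refine lintegral_congr fun t => ?_
          have : ((c⁻¹ : ℝ≥0) : ℝ≥0∞) * c = 1 := by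
            rw [← ENNReal.coe_mul, inv_mul_cancel₀ hc0, ENNReal.coe_one]
          calc f t * g t = f t * g t * (((c⁻¹ : ℝ≥0) : ℝ≥0∞) * c) := by rw [this, mul_one]
            _ = _ := by ring
      _ = (∫⁻ t, f t * (((c⁻¹ : ℝ≥0) : ℝ≥0∞) * g t) ∂leb01) * c :=
          lintegral_mul_const' _ _ ENNReal.coe_ne_top
      _ ≤ _ := by gcongr

end Resonance

/-! ### Lorentz–Luxemburg duality by separation in L². -/

section LorentzLuxemburg

variable {N : (ℝ → ℝ≥0∞) → ℝ≥0∞}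

/-- The tail infima increase to the limit, so the monotone Fatou axiom applies to them. -/
theorem IsRIQuasiNorm.le_of_tendsto_ae (hN : IsRIQuasiNorm N) {f : ℕ → ℝ → ℝ≥0∞} {g : ℝ → ℝ≥0∞}
    (hf : ∀ k, AEMeasurable (f k) leb01) (hg : AEMeasurable g leb01) {c : ℝ≥0∞}
    (hlim : ∀ᵐ t ∂leb01, Tendsto (fun k => f k t) atTop (𝓝 (g t))) (hc : ∀ k, N (f k) ≤ c) :
    N g ≤ c := by
  have hm : ∀ n, AEMeasurable (fun t => ⨅ k, f (k + n) t) leb01 := fun n =>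
    AEMeasurable.iInf fun k => hf _
  refine le_of_tendsto' (hN.fatou (fun n t => ⨅ k, f (k + n) t) g hm hg ?_ ?_) fun n => ?_
  · refine ae_of_all _ fun t m n hmn => le_iInf fun k => ?_
    refine (iInf_le _ (k + (n - m))).trans_eq ?_
    congr 1
    omega
  · filter_upwards [hlim] with t ht
    rw [← ht.liminf_eq, liminf_eq_iSup_iInf_of_nat']
    refine tendsto_atTop_iSup fun m n hmn => le_iInf fun k => ?_
    refine (iInf_le _ (k + (n - m))).trans_eq ?_
    congr 1
    omega
  · refine (hN.mono _ _ (hm n) (hf n) (ae_of_all _ fun t => ?_)).trans (hc n)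
    exact (iInf_le _ 0).trans_eq (by rw [zero_add])

theorem IsRIBanachNorm.convex_setOf_le (hN : IsRIBanachNorm N) (c : ℝ≥0) :
    Convex ℝ {f : Lp ℝ 2 leb01 | N (fun t => ‖f t‖ₑ) ≤ c} := by
  have hm : ∀ f : Lp ℝ 2 leb01, AEMeasurable (fun t => ‖f t‖ₑ) leb01 := fun f =>
    (Lp.aestronglyMeasurable f).enorm
  intro x hx y hy a b ha hb hab
  lift a to ℝ≥0 using ha
  lift b to ℝ≥0 using hb
  have hab' : a + b = 1 := by exact_mod_cast hab
  calc N (fun t => ‖((a : ℝ) • x + (b : ℝ) • y : Lp ℝ 2 leb01) t‖ₑ)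
      ≤ N (fun t => (a : ℝ≥0∞) * ‖x t‖ₑ + b * ‖y t‖ₑ) := by
        refine hN.mono _ _ (hm _) (((hm x).const_mul _).add ((hm y).const_mul _)) ?_
        filter_upwards [Lp.coeFn_add ((a : ℝ) • x) ((b : ℝ) • y), Lp.coeFn_smul (a : ℝ) x,
          Lp.coeFn_smul (b : ℝ) y] with t h1 h2 h3
        rw [h1, Pi.add_apply, h2, h3]
        refine (enorm_add_le _ _).trans ?_
        simp only [Pi.smul_apply, enorm_smul]
        simp [enorm_eq_nnnorm]
    _ ≤ N (fun t => (a : ℝ≥0∞) * ‖x t‖ₑ) + N (fun t => (b : ℝ≥0∞) * ‖y t‖ₑ) :=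
        hN.triangle _ _ ((hm x).const_mul _) ((hm y).const_mul _)
    _ = a * N (fun t => ‖x t‖ₑ) + b * N (fun t => ‖y t‖ₑ) := by
        rw [hN.smul _ (hm x), hN.smul _ (hm y)]
    _ ≤ a * c + b * c := by gcongr <;> assumption
    _ = c := by rw [← add_mul, ← ENNReal.coe_add, hab', ENNReal.coe_one, one_mul]

/-- Convergence in L² yields an almost everywhere convergent subsequence, to which the Fatou
property applies. With convexity, this makes Hahn–Banach usable in the Hilbert space L². -/
theorem IsRIQuasiNorm.isClosed_setOf_le (hN : IsRIQuasiNorm N) (c : ℝ≥0) :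
    IsClosed {f : Lp ℝ 2 leb01 | N (fun t => ‖f t‖ₑ) ≤ c} := by
  refine IsSeqClosed.isClosed fun u f hu hlim => ?_
  obtain ⟨ns, -, hns⟩ := (tendstoInMeasure_of_tendsto_Lp hlim).exists_seq_tendsto_ae
  refine hN.le_of_tendsto_ae (f := fun k t => ‖u (ns k) t‖ₑ)
    (fun k => (Lp.aestronglyMeasurable _).enorm) (Lp.aestronglyMeasurable _).enorm ?_
    fun k => hu (ns k)
  filter_upwards [hns] with t ht
  exact (continuous_enorm.tendsto _).comp ht

theorem memLp_toReal_min {F : ℝ → ℝ≥0∞} (hF : AEMeasurable F leb01) (n : ℕ) :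
    MemLp (fun t => (min (F t) n).toReal) 2 leb01 := by
  refine MemLp.of_bound (hF.min aemeasurable_const).ennreal_toReal.aestronglyMeasurable n ?_
  refine ae_of_all _ fun t => ?_
  rw [Real.norm_of_nonneg ENNReal.toReal_nonneg]
  exact ENNReal.toReal_le_of_le_ofReal (Nat.cast_nonneg n) (by simp)

theorem enorm_toReal_min (x : ℝ≥0∞) (n : ℕ) : ‖(min x n).toReal‖ₑ = min x n := by
  rw [Real.enorm_of_nonneg ENNReal.toReal_nonneg,
    ENNReal.ofReal_toReal (ne_top_of_le_ne_top (ENNReal.natCast_ne_top n) (min_le_right _ _))]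

/-- The Lorentz–Luxemburg theorem. -/
theorem IsRIBanachNorm.exists_assoc_le_one (hN : IsRIBanachNorm N) {f₀ : ℝ → ℝ≥0∞}
    (hf₀ : AEMeasurable f₀ leb01) {c : ℝ≥0} (hc : 0 < c) (hlt : c < N f₀) :
    ∃ g : ℝ → ℝ, AEMeasurable g leb01 ∧ assoc N (fun t => ‖g t‖ₑ) ≤ 1 ∧
      c ≤ ∫⁻ t, f₀ t * ‖g t‖ₑ ∂leb01 := by
  have hmin : ∀ n : ℕ, AEMeasurable (fun t => min (f₀ t) n) leb01 := fun n =>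
    hf₀.min aemeasurable_const
  -- Truncation brings f₀ into L² while keeping its norm above c.
  obtain ⟨n, hn⟩ : ∃ n : ℕ, c < N (fun t => min (f₀ t) n) := by
    by_contra! hcon
    refine absurd hlt (not_lt.2 (hN.le_of_tendsto_ae hmin hf₀ (ae_of_all _ fun t => ?_) hcon))
    have := (tendsto_const_nhds (x := f₀ t)).min ENNReal.tendsto_nat_nhds_top
    rwa [min_top_right] at this
  set f₁ : Lp ℝ 2 leb01 := (memLp_toReal_min hf₀ n).toLp _
  have hf₁ : f₁ =ᵐ[leb01] fun t => (min (f₀ t) n).toReal := MemLp.coeFn_toLp _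
  have hf₁e : (fun t => ‖f₁ t‖ₑ) =ᵐ[leb01] fun t => min (f₀ t) n := by
    filter_upwards [hf₁] with t ht
    rw [ht, enorm_toReal_min]
  have hnot : f₁ ∉ {f : Lp ℝ 2 leb01 | N (fun t => ‖f t‖ₑ) ≤ c} := fun h =>
    absurd (hn.trans_le (hN.mono _ _ (hmin n) (Lp.aestronglyMeasurable _).enorm
      hf₁e.symm.le)) (not_lt.2 h)
  obtain ⟨ℓ, u, hA, hu⟩ := geometric_hahn_banach_closed_point (hN.convex_setOf_le c)
    (hN.isClosed_setOf_le c) hnot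
  -- Riesz representation of the separating functional: ⟨·, g⟩ is below u on the ball of radius c
  -- and above u at the truncated f₀.
  set g : Lp ℝ 2 leb01 := (InnerProductSpace.toDual ℝ _).symm ℓ
  have hgm : AEMeasurable g leb01 := (Lp.aestronglyMeasurable g).aemeasurable
  have hℓ : ∀ x : Lp ℝ 2 leb01, ℓ x = ∫ t, x t * g t ∂leb01 := fun x => by
    rw [← InnerProductSpace.toDual_symm_apply, L2.inner_def]
    rfl
  have hint : ∀ x : Lp ℝ 2 leb01, Integrable (fun t => x t * g t) leb01 := fun x =>
    L2.integrable_inner (𝕜 := ℝ) g x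
  have hu0 : 0 < u := by
    have h0 := hA 0 (by
      change N (fun t => ‖(0 : Lp ℝ 2 leb01) t‖ₑ) ≤ c
      have : N (fun t => ‖(0 : Lp ℝ 2 leb01) t‖ₑ) = 0 := by
        rw [hN.eq_zero_iff _ (Lp.aestronglyMeasurable _).enorm]
        filter_upwards [Lp.coeFn_zero ℝ 2 leb01] with t ht
        simp
      rw [this]
      exact zero_le)
    simpa using h0
  have hball : ∀ F : ℝ → ℝ≥0∞, AEMeasurable F leb01 → N F ≤ 1 →
      c * ∫⁻ t, ‖g t‖ₑ * F t ∂leb01 ≤ ENNReal.ofReal u := by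
    intro F hF hF1
    have hk : ∀ k : ℕ, c * ∫⁻ t, min (F t) k * ‖g t‖ₑ ∂leb01 ≤ ENNReal.ofReal u := by
      intro k
      have hsg : Measurable fun y : ℝ => if 0 ≤ y then (1 : ℝ) else -1 :=
        Measurable.ite measurableSet_Ici measurable_const measurable_const
      -- Testing with c · min(F, k) · sgn g, which lies in the ball, turns the bound on the signed
      -- integral into one on c ∫ min(F, k) |g|.
      have hmem : MemLp (fun t => (c : ℝ) * (min (F t) k).toReal * if 0 ≤ g t then 1 else -1) 2
          leb01 := by
        refine ((memLp_toReal_min hF k).const_mul (c : ℝ)).of_le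
          (((hF.min aemeasurable_const).ennreal_toReal.const_mul _).mul
            (hsg.comp_aemeasurable hgm)).aestronglyMeasurable (ae_of_all _ fun t => ?_)
        rw [norm_mul _ (ite _ _ _)]
        split_ifs <;> simp
      have hco := hmem.coeFn_toLp
      have hen : (fun t => ‖hmem.toLp _ t‖ₑ) =ᵐ[leb01] fun t => (c : ℝ≥0∞) * min (F t) k := by
        filter_upwards [hco] with t ht
        rw [ht, enorm_mul, enorm_mul, enorm_toReal_min]
        have : ‖if 0 ≤ g t then (1 : ℝ) else -1‖ₑ = 1 := by split_ifs <;> simp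
        rw [this, mul_one]
        simp [enorm_eq_nnnorm]
      have hin : hmem.toLp _ ∈ {f : Lp ℝ 2 leb01 | N (fun t => ‖f t‖ₑ) ≤ c} := by
        change N (fun t => ‖hmem.toLp _ t‖ₑ) ≤ c
        calc N (fun t => ‖hmem.toLp _ t‖ₑ) ≤ N (fun t => (c : ℝ≥0∞) * F t) := by
              refine hN.mono _ _ (Lp.aestronglyMeasurable _).enorm (hF.const_mul _) ?_
              filter_upwards [hen] with t ht
              rw [ht]
              gcongr
              exact min_le_left _ _
          _ = c * N F := hN.smul _ hF c
          _ ≤ c * 1 := by gcongr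
          _ = c := mul_one _
      have h1 := (hA _ hin).le
      rw [hℓ] at h1
      have hpt : ∀ᵐ t ∂leb01, hmem.toLp _ t * g t = ‖hmem.toLp _ t * g t‖ := by
        filter_upwards [hco] with t ht
        rw [Real.norm_eq_abs, eq_comm, abs_eq_self, ht]
        have h0 : 0 ≤ (c : ℝ) * (min (F t) k).toReal := by positivity
        split_ifs with hg0
        · positivity
        · rw [mul_neg_one, neg_mul, ← mul_neg]
          exact mul_nonneg h0 (by linarith)
      rw [integral_congr_ae hpt] at h1
      have h2 := ENNReal.ofReal_le_ofReal h1
      rw [ofReal_integral_norm_eq_lintegral_enorm (hint _)] at h2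
      refine le_trans (le_of_eq ?_) h2
      rw [← lintegral_const_mul' _ _ ENNReal.coe_ne_top]
      refine lintegral_congr_ae ?_
      filter_upwards [hen] with t ht
      rw [enorm_mul, ht, mul_assoc]
    have hsup : ∫⁻ t, ‖g t‖ₑ * F t ∂leb01 = ⨆ k : ℕ, ∫⁻ t, min (F t) k * ‖g t‖ₑ ∂leb01 := by
      have e1 : ∀ h : ℝ → ℝ≥0∞, AEMeasurable h leb01 → ∫⁻ t, h t * ‖g t‖ₑ ∂leb01 =
          ∫⁻ t, h t ∂(leb01.withDensity fun t => ‖g t‖ₑ) := fun h hh => by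
        rw [lintegral_withDensity_eq_lintegral_mul₀ hgm.enorm hh]
        simp only [Pi.mul_apply, mul_comm]
      simp_rw [mul_comm ‖g _‖ₑ, e1 F hF]
      rw [lintegral_eq_iSup_min (hF.mono_ac (withDensity_absolutelyContinuous _ _))]
      exact iSup_congr fun k => (e1 _ (hF.min aemeasurable_const)).symm
    rw [hsup, ENNReal.mul_iSup]
    exact iSup_le hk
  have huc : 0 < (c : ℝ) / u := by positivity
  have hcu : ENNReal.ofReal (c / u) * ENNReal.ofReal u = c := by
    rw [← ENNReal.ofReal_mul huc.le, div_mul_cancel₀ _ hu0.ne', ENNReal.ofReal_coe_nnreal]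
  have hen : ∀ t, ‖(c / u) * g t‖ₑ = ENNReal.ofReal (c / u) * ‖g t‖ₑ := fun t => by
    rw [enorm_mul, Real.enorm_of_nonneg huc.le]
  -- The factor c/u is the normalisation: c ∫ |g| F ≤ u on the unit ball becomes associate norm at
  -- most 1, and ∫ f₀ |g| ≥ u becomes a pairing of at least c.
  refine ⟨fun t => (c / u) * g t, hgm.const_mul _, assoc_le fun F hF hF1 => ?_, ?_⟩
  · have h1 : ENNReal.ofReal u * ∫⁻ t, ‖(c / u) * g t‖ₑ * F t ∂leb01 ≤ ENNReal.ofReal u * 1 := by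
      simp only [hen, mul_assoc]
      rw [lintegral_const_mul' _ _ ENNReal.ofReal_ne_top, ← mul_assoc,
        mul_comm (ENNReal.ofReal u), hcu, mul_one]
      exact hball F hF hF1
    exact (ENNReal.mul_le_mul_iff_right (ENNReal.ofReal_pos.2 hu0).ne' ENNReal.ofReal_ne_top).1 h1
  · have h1 : ENNReal.ofReal u ≤ ∫⁻ t, f₀ t * ‖g t‖ₑ ∂leb01 := by
      have h2 := hu.le
      rw [hℓ] at h2
      calc ENNReal.ofReal u ≤ ENNReal.ofReal (∫ t, ‖f₁ t * g t‖ ∂leb01) := by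
            refine ENNReal.ofReal_le_ofReal (h2.trans ?_)
            exact integral_mono (hint _) (hint _).norm fun t => Real.le_norm_self _
        _ = ∫⁻ t, ‖f₁ t * g t‖ₑ ∂leb01 := ofReal_integral_norm_eq_lintegral_enorm (hint _)
        _ ≤ _ := by
            refine lintegral_mono_ae ?_
            filter_upwards [hf₁e] with t ht
            rw [enorm_mul, ht]
            gcongr
            exact min_le_left _ _
    calc (c : ℝ≥0∞) = ENNReal.ofReal (c / u) * ENNReal.ofReal u := hcu.symm
      _ ≤ ENNReal.ofReal (c / u) * ∫⁻ t, f₀ t * ‖g t‖ₑ ∂leb01 := by gcongr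
      _ = ∫⁻ t, f₀ t * ‖(c / u) * g t‖ₑ ∂leb01 := by
          rw [← lintegral_const_mul' _ _ ENNReal.ofReal_ne_top]
          refine lintegral_congr fun t => ?_
          rw [hen]
          ring

/-- A duality criterion for `N f ≤ c`, for nonincreasing `f`. -/
theorem IsRIBanachNorm.le_of_forall_star (hN : IsRIBanachNorm N) {f : ℝ → ℝ≥0∞}
    (hf : AntitoneOn f (Ioo 0 1)) {c : ℝ≥0∞}
    (h : ∀ g : ℝ →ₘ[leb01] ℂ, assoc N (star g) ≤ 1 → ∫⁻ t, f t * star g t ∂leb01 ≤ c) :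
    N f ≤ c := by
  have hfm : AEMeasurable f leb01 := aemeasurable_restrict_of_antitoneOn measurableSet_Ioo hf
  refine le_of_forall_lt fun a ha => ?_
  obtain ⟨b, hab, hb⟩ := ENNReal.lt_iff_exists_nnreal_btwn.1 ha
  have hb0 : 0 < b := ENNReal.coe_pos.1 (zero_le.trans_lt hab)
  obtain ⟨g, hg, hg1, hgb⟩ := hN.exists_assoc_le_one hfm hb0 hb
  let G : ℝ →ₘ[leb01] ℂ := AEEqFun.mk (fun t => (g t : ℂ))
    (Complex.measurable_ofReal.comp_aemeasurable hg).aestronglyMeasurable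
  have hG : star G = rearr leb01 fun t => ‖g t‖ₑ := by
    refine rearr_congr_ae ?_
    filter_upwards [AEEqFun.coeFn_mk (fun t => (g t : ℂ))
      (Complex.measurable_ofReal.comp_aemeasurable hg).aestronglyMeasurable] with t ht
    rw [ht]
    simp [enorm_eq_nnnorm]
  -- Passing from |g| to g* does not decrease the pairing with the nonincreasing f and does not
  -- increase the associate norm.
  refine hab.trans_le (hgb.trans (le_trans ?_ (h G ?_)))
  · rw [hG]
    simpa only [mul_comm] using lintegral_mul_le_rearr_mul hg.enorm hf
  · rw [hG]
    exact (hN.assoc_rearr_le hg.enorm (ae_of_all _ fun t => enorm_lt_top)).trans hg1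

end LorentzLuxemburg

/-! ### Quantitative consequences of slow variation. -/

section SlowlyVarying

/-- A Potter-type bound: t^ε b(t) is nondecreasing up to constants. This is the form in which slow
variation is used below; the companion bound comes from t^{-ε} b(t). -/
theorem SlowlyVarying.le_rpow_mul {b : ℝ → ℝ} (hb : SlowlyVarying b) {ε : ℝ} (hε : 0 < ε) :
    ∃ K > 0, ∀ s ∈ Ioo (0 : ℝ) 1, ∀ r ∈ Ioo (0 : ℝ) 1, s ≤ r → b s ≤ K * (r / s) ^ ε * b r := by
  obtain ⟨g, hg, c, hc, C, hC, h⟩ := hb.exists_mono ε hε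
  refine ⟨C / c, by positivity, fun s hs r hr hsr => ?_⟩
  have h1 := (h s hs).2
  have h2 := mul_le_mul_of_nonneg_left (hg hs hr hsr) hC.le
  have h3 := (h r hr).1
  have ps : 0 < s ^ ε := Real.rpow_pos_of_pos hs.1 _
  rw [Real.div_rpow hr.1.le hs.1.le]
  have h4 : s ^ ε * b s ≤ C / c * (r ^ ε * b r) := by
    calc s ^ ε * b s ≤ C * g r := h1.trans h2
      _ = C / c * (c * g r) := by field_simp
      _ ≤ _ := by gcongr
  calc b s = (s ^ ε * b s) / s ^ ε := by field_simp
    _ ≤ (C / c * (r ^ ε * b r)) / s ^ ε := by gcongr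
    _ = _ := by ring

theorem SlowlyVarying.rpow_mul_ge {b : ℝ → ℝ} (hb : SlowlyVarying b) {ε : ℝ} (hε : 0 < ε) :
    ∃ K > 0, ∀ s ∈ Ioo (0 : ℝ) 1, ∀ r ∈ Ioo (0 : ℝ) 1, s ≤ r → b r ≤ K * (r / s) ^ ε * b s := by
  obtain ⟨g, hg, c, hc, C, hC, h⟩ := hb.exists_anti ε hε
  refine ⟨C / c, by positivity, fun s hs r hr hsr => ?_⟩
  have h1 := (h r hr).2
  have h2 := mul_le_mul_of_nonneg_left (hg hs hr hsr) hC.le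
  have h3 := (h s hs).1
  have ps : 0 < s ^ ε := Real.rpow_pos_of_pos hs.1 _
  have pr : 0 < r ^ ε := Real.rpow_pos_of_pos hr.1 _
  rw [Real.div_rpow hr.1.le hs.1.le]
  simp only [Real.rpow_neg hr.1.le, Real.rpow_neg hs.1.le] at h1 h3
  have h4 : (r ^ ε)⁻¹ * b r ≤ C / c * ((s ^ ε)⁻¹ * b s) := by
    calc (r ^ ε)⁻¹ * b r ≤ C * g s := h1.trans h2
      _ = C / c * (c * g s) := by field_simp
      _ ≤ _ := by gcongr
  calc b r = r ^ ε * ((r ^ ε)⁻¹ * b r) := by field_simp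
    _ ≤ r ^ ε * (C / c * ((s ^ ε)⁻¹ * b s)) := by gcongr
    _ = _ := by ring

/-- Monotonicity handles (0, 1/2]; near 1 the polynomial lower bound K t is at least K/2. -/
theorem SlowlyVarying.exists_lower_const {b : ℝ → ℝ} (hb : SlowlyVarying b)
    (hanti : AntitoneOn b (Ioo 0 1)) : ∃ c > 0, ∀ t ∈ Ioo (0 : ℝ) 1, c ≤ b t := by
  have hh : (1 / 2 : ℝ) ∈ Ioo (0 : ℝ) 1 := by constructor <;> norm_num
  obtain ⟨K, hK, h⟩ := hb.exists_lower one_pos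
  refine ⟨min (b (1 / 2)) (K / 2), lt_min (hb.pos _ hh) (by positivity), fun t ht => ?_⟩
  rcases le_total t (1 / 2) with h2 | h2
  · exact (min_le_left _ _).trans (hanti ht hh h2)
  · refine (min_le_right _ _).trans (le_trans ?_ (h t ht))
    rw [Real.rpow_one]
    nlinarith

theorem SlowlyVarying.exists_upper_const {b : ℝ → ℝ} (hb : SlowlyVarying b)
    (hmono : MonotoneOn b (Ioo 0 1)) : ∃ M > 0, ∀ t ∈ Ioo (0 : ℝ) 1, b t ≤ M := by
  have hh : (1 / 2 : ℝ) ∈ Ioo (0 : ℝ) 1 := by constructor <;> norm_num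
  obtain ⟨K, hK, h⟩ := hb.exists_upper one_pos
  refine ⟨max (b (1 / 2)) (K * 2), lt_max_of_lt_right (by positivity), fun t ht => ?_⟩
  rcases le_total t (1 / 2) with h2 | h2
  · exact (hmono ht hh h2).trans (le_max_left _ _)
  · refine le_trans ((h t ht).trans ?_) (le_max_right _ _)
    rw [Real.rpow_neg_one]
    gcongr
    exact inv_le_of_inv_le₀ (by norm_num) (by linarith)

theorem lintegral_div_rpow_half_le {r : ℝ} (hr : 0 < r) :
    ∫⁻ s in Ioo 0 r, ENNReal.ofReal ((r / s) ^ (1 / 2 : ℝ)) ≤ ENNReal.ofReal (2 * r) := by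
  have hI : IntervalIntegrable (fun s : ℝ => s ^ (-(1 / 2) : ℝ)) volume 0 r :=
    intervalIntegral.intervalIntegrable_rpow' (by norm_num)
  have hI' : IntegrableOn (fun s : ℝ => r ^ (1 / 2 : ℝ) * s ^ (-(1 / 2) : ℝ)) (Ioo 0 r) := by
    rw [← intervalIntegrable_iff_integrableOn_Ioo_of_le hr.le]
    exact hI.const_mul _
  have e : ∀ s ∈ Ioo 0 r, (r / s) ^ (1 / 2 : ℝ) = r ^ (1 / 2 : ℝ) * s ^ (-(1 / 2) : ℝ) := by
    intro s hs
    rw [Real.div_rpow hr.le hs.1.le, Real.rpow_neg hs.1.le, div_eq_mul_inv]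
  rw [setLIntegral_congr_fun measurableSet_Ioo fun s hs => by rw [e s hs],
    ← ofReal_integral_eq_lintegral_ofReal hI']
  · refine ENNReal.ofReal_le_ofReal (le_of_eq ?_)
    rw [← integral_Ioc_eq_integral_Ioo, ← intervalIntegral.integral_of_le hr.le,
      intervalIntegral.integral_const_mul, integral_rpow (Or.inl (by norm_num))]
    norm_num
    rw [← mul_div_assoc, ← Real.rpow_add hr]
    norm_num
    ring
  · exact (ae_restrict_mem measurableSet_Ioo).mono fun s hs => by
      have := hs.1
      simp only [Pi.zero_apply]
      positivity

/-- A Karamata-type estimate ∫_0^r f ≲ r f(r); the exponent 1/2 matters only in being less than 1,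
so that (r/s)^{1/2} is integrable at 0. -/
theorem lintegral_le_of_le_rpow_half {f : ℝ → ℝ} {K r : ℝ} (hr : 0 < r) (hK : 0 ≤ K)
    (hf : 0 ≤ f r) (h : ∀ s ∈ Ioo 0 r, f s ≤ K * (r / s) ^ (1 / 2 : ℝ) * f r) :
    ∫⁻ s in Ioo 0 r, ENNReal.ofReal (f s) ≤ ENNReal.ofReal (2 * K * (r * f r)) := by
  calc ∫⁻ s in Ioo 0 r, ENNReal.ofReal (f s)
      ≤ ∫⁻ s in Ioo 0 r, ENNReal.ofReal (K * f r) * ENNReal.ofReal ((r / s) ^ (1 / 2 : ℝ)) := by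
        refine setLIntegral_mono' measurableSet_Ioo fun s hs => ?_
        rw [← ENNReal.ofReal_mul (by positivity)]
        refine ENNReal.ofReal_le_ofReal ((h s hs).trans (le_of_eq (by ring)))
    _ = ENNReal.ofReal (K * f r) * ∫⁻ s in Ioo 0 r, ENNReal.ofReal ((r / s) ^ (1 / 2 : ℝ)) :=
        lintegral_const_mul' _ _ ENNReal.ofReal_ne_top
    _ ≤ ENNReal.ofReal (K * f r) * ENNReal.ofReal (2 * r) := by
        gcongr
        exact lintegral_div_rpow_half_le hr
    _ = _ := by
        rw [← ENNReal.ofReal_mul (by positivity)]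
        congr 1
        ring

end SlowlyVarying

/-! ### The weight (b₁/b₂)^p and the change of variable φ. -/

section Weights

/-- The weight `(b₁ / b₂) ^ p`. -/
def weight (p : ℝ) (b₁ b₂ : ℝ → ℝ) (s : ℝ) : ℝ := (b₁ s * (b₂ s)⁻¹) ^ p

/-- The function `u ↦ σ⁻¹(u^{1/p})^p`. -/
def phi (p : ℝ) (b₁ b₂ : ℝ → ℝ) (u : ℝ) : ℝ := sigmaInv p b₁ b₂ (u ^ (1 / p)) ^ p

/-- The function `s ↦ σ(s^{1/p})^p`, inverse to `phi`. -/
def psi (p : ℝ) (b₁ b₂ : ℝ → ℝ) (s : ℝ) : ℝ := sigma p b₁ b₂ (s ^ (1 / p)) ^ p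

/-- The constant `∫_0^1 (b₁ / b₂) ^ p`. -/
def mass (p : ℝ) (b₁ b₂ : ℝ → ℝ) : ℝ := ∫ s in (0 : ℝ)..1, weight p b₁ b₂ s

variable {p : ℝ} {b₁ b₂ : ℝ → ℝ}

theorem ClassB.aemeasurable₁ (hb : ClassB p b₁ b₂) : AEMeasurable b₁ leb01 :=
  (aemeasurable_restrict_iff_comap_subtype measurableSet_Ioo).2 hb.slow₁.measurable.aemeasurable

theorem ClassB.aemeasurable₂ (hb : ClassB p b₁ b₂) : AEMeasurable b₂ leb01 :=
  (aemeasurable_restrict_iff_comap_subtype measurableSet_Ioo).2 hb.slow₂.measurable.aemeasurable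

theorem ClassB.weight_pos (hb : ClassB p b₁ b₂) {s : ℝ} (hs : s ∈ Ioo (0 : ℝ) 1) :
    0 < weight p b₁ b₂ s := by
  have := hb.slow₁.pos s hs
  have := hb.slow₂.pos s hs
  unfold weight
  positivity

theorem ClassB.weight_eq (hb : ClassB p b₁ b₂) {s : ℝ} (hs : s ∈ Ioo (0 : ℝ) 1) :
    weight p b₁ b₂ s = b₁ s ^ p / b₂ s ^ p := by
  have h1 := hb.slow₁.pos s hs
  have h2 := hb.slow₂.pos s hs
  rw [weight, ← div_eq_mul_inv, Real.div_rpow h1.le h2.le]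

theorem ClassB.antitoneOn_weight (hp : 0 < p) (hb : ClassB p b₁ b₂) :
    AntitoneOn (weight p b₁ b₂) (Ioo 0 1) := by
  intro s hs t ht hst
  have h1 := hb.slow₁.pos t ht
  have h1' := hb.slow₁.pos s hs
  have h2 := hb.slow₂.pos s hs
  have h2' := hb.slow₂.pos t ht
  unfold weight
  have := hb.anti₁ hs ht hst
  have := hb.mono₂ hs ht hst
  gcongr

theorem ClassB.aemeasurable_weight (hp : 0 < p) (hb : ClassB p b₁ b₂) :
    AEMeasurable (weight p b₁ b₂) leb01 :=
  aemeasurable_restrict_of_antitoneOn measurableSet_Ioo (hb.antitoneOn_weight hp)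

theorem ClassB.rpow_le_rpow_half (hp : 0 < p) (hb : ClassB p b₁ b₂) :
    ∃ K > 0, ∀ s ∈ Ioo (0 : ℝ) 1, ∀ r ∈ Ioo (0 : ℝ) 1, s ≤ r →
      b₁ s ^ p ≤ K * (r / s) ^ (1 / 2 : ℝ) * b₁ r ^ p := by
  -- This ε makes the exponent exactly 1/2 after raising to the power p.
  obtain ⟨K, hK, h⟩ := hb.slow₁.le_rpow_mul (ε := 1 / (2 * p)) (by positivity)
  refine ⟨K ^ p, by positivity, fun s hs r hr hsr => ?_⟩
  have h1 := hb.slow₁.pos s hs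
  have h2 := hb.slow₁.pos r hr
  have hrs : 0 < r / s := div_pos hr.1 hs.1
  calc b₁ s ^ p ≤ (K * (r / s) ^ (1 / (2 * p)) * b₁ r) ^ p :=
        Real.rpow_le_rpow h1.le (h s hs r hr hsr) hp.le
    _ = _ := by
        rw [Real.mul_rpow (by positivity) h2.le, Real.mul_rpow hK.le (by positivity),
          ← Real.rpow_mul hrs.le]
        congr 3
        field_simp

theorem ClassB.weight_le_rpow_half (hp : 0 < p) (hb : ClassB p b₁ b₂) :
    ∃ K > 0, ∀ s ∈ Ioo (0 : ℝ) 1, ∀ r ∈ Ioo (0 : ℝ) 1, s ≤ r →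
      weight p b₁ b₂ s ≤ K * (r / s) ^ (1 / 2 : ℝ) * weight p b₁ b₂ r := by
  -- The exponent is shared by b₁ and 1/b₂: twice 1/(4p), times p, is 1/2.
  obtain ⟨K, hK, h⟩ := hb.slow₁.le_rpow_mul (ε := 1 / (4 * p)) (by positivity)
  obtain ⟨L, hL, h'⟩ := hb.slow₂.rpow_mul_ge (ε := 1 / (4 * p)) (by positivity)
  refine ⟨(K * L) ^ p, by positivity, fun s hs r hr hsr => ?_⟩
  have h1 := hb.slow₁.pos s hs
  have h2 := hb.slow₁.pos r hr
  have h3 := hb.slow₂.pos s hs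
  have h4 := hb.slow₂.pos r hr
  have hrs : 0 < r / s := div_pos hr.1 hs.1
  have hq : 0 < (r / s) ^ (1 / (4 * p)) := by positivity
  have e : (b₂ s)⁻¹ ≤ L * (r / s) ^ (1 / (4 * p)) * (b₂ r)⁻¹ := by
    rw [inv_le_iff_one_le_mul₀ h3, ← div_eq_mul_inv, div_mul_eq_mul_div, one_le_div h4]
    exact h' s hs r hr hsr
  have e2 : b₁ s * (b₂ s)⁻¹ ≤ K * L * (r / s) ^ (1 / (2 * p)) * (b₁ r * (b₂ r)⁻¹) := by
    calc b₁ s * (b₂ s)⁻¹ ≤ (K * (r / s) ^ (1 / (4 * p)) * b₁ r) *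
          (L * (r / s) ^ (1 / (4 * p)) * (b₂ r)⁻¹) := by
          gcongr
          exact h s hs r hr hsr
      _ = K * L * ((r / s) ^ (1 / (4 * p)) * (r / s) ^ (1 / (4 * p))) * (b₁ r * (b₂ r)⁻¹) := by
          ring
      _ = _ := by
          rw [← Real.rpow_add hrs]
          congr 3
          field_simp
          norm_num
  calc weight p b₁ b₂ s ≤ (K * L * (r / s) ^ (1 / (2 * p)) * (b₁ r * (b₂ r)⁻¹)) ^ p :=
        Real.rpow_le_rpow (by positivity) e2 hp.le
    _ = _ := by
        rw [Real.mul_rpow (by positivity) (by positivity),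
          Real.mul_rpow (by positivity) (by positivity), ← Real.rpow_mul hrs.le, weight]
        congr 3
        field_simp

theorem ClassB.intervalIntegrable_weight' (hp : 0 < p) (hb : ClassB p b₁ b₂) :
    IntervalIntegrable (weight p b₁ b₂) volume 0 1 :=
  intervalIntegrable_weight hp hb.slow₁ hb.slow₂

theorem ClassB.ofReal_integral_weight (hp : 0 < p) (hb : ClassB p b₁ b₂) {u : ℝ}
    (hu : u ∈ Icc (0 : ℝ) 1) : ENNReal.ofReal (∫ s in (0 : ℝ)..u, weight p b₁ b₂ s) =
      ∫⁻ s in Ioo 0 u, ENNReal.ofReal (weight p b₁ b₂ s) := by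
  have hI := (intervalIntegrable_iff_integrableOn_Ioo_of_le zero_le_one).1
    (hb.intervalIntegrable_weight' hp)
  rw [intervalIntegral.integral_of_le hu.1, integral_Ioc_eq_integral_Ioo,
    ofReal_integral_eq_lintegral_ofReal (hI.mono_set (Ioo_subset_Ioo_right hu.2))]
  exact (ae_restrict_mem measurableSet_Ioo).mono fun s hs =>
    (hb.weight_pos ⟨hs.1, hs.2.trans_le hu.2⟩).le

theorem ClassB.mass_pos (hp : 0 < p) (hb : ClassB p b₁ b₂) : 0 < mass p b₁ b₂ :=
  intervalIntegral.intervalIntegral_pos_of_pos_on (hb.intervalIntegrable_weight' hp)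
    (fun _ hx => hb.weight_pos hx) zero_lt_one

theorem rpow_mem_Icc {q u : ℝ} (hq : 0 < q) (hu : u ∈ Icc (0 : ℝ) 1) : u ^ q ∈ Icc (0 : ℝ) 1 :=
  ⟨Real.rpow_nonneg hu.1 _, Real.rpow_le_one hu.1 hu.2 hq.le⟩

theorem rpow_one_div_rpow {u : ℝ} (hp : 0 < p) (hu : 0 ≤ u) : (u ^ (1 / p)) ^ p = u := by
  rw [← Real.rpow_mul hu, one_div_mul_cancel hp.ne', Real.rpow_one]

theorem rpow_rpow_one_div {u : ℝ} (hp : 0 < p) (hu : 0 ≤ u) : (u ^ p) ^ (1 / p) = u := by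
  rw [← Real.rpow_mul hu, mul_one_div_cancel hp.ne', Real.rpow_one]

theorem ClassB.isSigma (hp : 0 < p) (hb : ClassB p b₁ b₂) :
    IsSigma p b₁ b₂ (sigma p b₁ b₂) := isSigma_sigma hp hb.slow₁ hb.slow₂

theorem ClassB.sigmaInv_mem (hp : 0 < p) (hb : ClassB p b₁ b₂) {t : ℝ} (ht : t ∈ Icc (0 : ℝ) 1) :
    sigmaInv p b₁ b₂ t ∈ Icc (0 : ℝ) 1 :=
  Function.invFunOn_mem ((hb.isSigma hp).bijOn.surjOn ht)

theorem ClassB.sigma_sigmaInv (hp : 0 < p) (hb : ClassB p b₁ b₂) {t : ℝ}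
    (ht : t ∈ Icc (0 : ℝ) 1) : sigma p b₁ b₂ (sigmaInv p b₁ b₂ t) = t :=
  (hb.isSigma hp).bijOn.invOn_invFunOn.2 ht

theorem ClassB.sigmaInv_sigma (hp : 0 < p) (hb : ClassB p b₁ b₂) {t : ℝ}
    (ht : t ∈ Icc (0 : ℝ) 1) : sigmaInv p b₁ b₂ (sigma p b₁ b₂ t) = t :=
  (hb.isSigma hp).bijOn.invOn_invFunOn.1 ht

theorem ClassB.phi_mem_Icc (hp : 0 < p) (hb : ClassB p b₁ b₂) {u : ℝ} (hu : u ∈ Icc (0 : ℝ) 1) :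
    phi p b₁ b₂ u ∈ Icc (0 : ℝ) 1 :=
  rpow_mem_Icc hp (hb.sigmaInv_mem hp (rpow_mem_Icc (one_div_pos.2 hp) hu))

theorem ClassB.psi_mem_Icc (hp : 0 < p) (hb : ClassB p b₁ b₂) {u : ℝ} (hu : u ∈ Icc (0 : ℝ) 1) :
    psi p b₁ b₂ u ∈ Icc (0 : ℝ) 1 :=
  rpow_mem_Icc hp ((hb.isSigma hp).bijOn.mapsTo (rpow_mem_Icc (one_div_pos.2 hp) hu))

theorem ClassB.phi_psi (hp : 0 < p) (hb : ClassB p b₁ b₂) {s : ℝ} (hs : s ∈ Icc (0 : ℝ) 1) :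
    phi p b₁ b₂ (psi p b₁ b₂ s) = s := by
  have h1 := rpow_mem_Icc (one_div_pos.2 hp) hs
  have h2 := (hb.isSigma hp).bijOn.mapsTo h1
  rw [phi, psi, rpow_rpow_one_div hp h2.1, hb.sigmaInv_sigma hp h1, rpow_one_div_rpow hp hs.1]

theorem ClassB.psi_phi (hp : 0 < p) (hb : ClassB p b₁ b₂) {s : ℝ} (hs : s ∈ Icc (0 : ℝ) 1) :
    psi p b₁ b₂ (phi p b₁ b₂ s) = s := by
  have h1 := rpow_mem_Icc (one_div_pos.2 hp) hs
  have h2 := hb.sigmaInv_mem hp h1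
  rw [phi, psi, rpow_rpow_one_div hp h2.1, hb.sigma_sigmaInv hp h1, rpow_one_div_rpow hp hs.1]

theorem ClassB.strictMonoOn_psi (hp : 0 < p) (hb : ClassB p b₁ b₂) :
    StrictMonoOn (psi p b₁ b₂) (Icc 0 1) := by
  intro s hs t ht hst
  have h1 := rpow_mem_Icc (one_div_pos.2 hp) hs
  have h2 := rpow_mem_Icc (one_div_pos.2 hp) ht
  have h3 := (hb.isSigma hp).bijOn.mapsTo h1
  refine Real.rpow_lt_rpow h3.1 ((hb.isSigma hp).strictMonoOn h1 h2 ?_) hp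
  exact Real.rpow_lt_rpow hs.1 hst (one_div_pos.2 hp)

theorem ClassB.strictMonoOn_phi (hp : 0 < p) (hb : ClassB p b₁ b₂) :
    StrictMonoOn (phi p b₁ b₂) (Icc 0 1) := by
  intro s hs t ht hst
  by_contra hcon
  have := (hb.strictMonoOn_psi hp).monotoneOn (hb.phi_mem_Icc hp ht) (hb.phi_mem_Icc hp hs)
    (not_lt.1 hcon)
  rw [hb.psi_phi hp hs, hb.psi_phi hp ht] at this
  linarith

/-- The defining identity of σ, evaluated at σ⁻¹(u^{1/p}). From here on σ enters only through φ as a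
normalised primitive of the weight and ψ as its inverse. -/
theorem ClassB.phi_eq (hp : 0 < p) (hb : ClassB p b₁ b₂) {u : ℝ} (hu : u ∈ Icc (0 : ℝ) 1) :
    mass p b₁ b₂ * phi p b₁ b₂ u = ∫ s in (0 : ℝ)..u, weight p b₁ b₂ s := by
  have h1 := rpow_mem_Icc (one_div_pos.2 hp) hu
  have h2 := hb.sigmaInv_mem hp h1
  have h3 := (hb.isSigma hp).identity _ h2
  rw [hb.sigma_sigmaInv hp h1, rpow_one_div_rpow hp hu.1] at h3
  have hm := (hb.mass_pos hp).ne'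
  change phi p b₁ b₂ u = 1 / mass p b₁ b₂ * ∫ s in (0 : ℝ)..u, weight p b₁ b₂ s at h3
  rw [h3]
  field_simp

theorem ClassB.ofReal_phi (hp : 0 < p) (hb : ClassB p b₁ b₂) {u : ℝ} (hu : u ∈ Icc (0 : ℝ) 1) :
    ENNReal.ofReal (mass p b₁ b₂) * ENNReal.ofReal (phi p b₁ b₂ u) =
      ∫⁻ s in Ioo 0 u, ENNReal.ofReal (weight p b₁ b₂ s) := by
  rw [← ENNReal.ofReal_mul (hb.mass_pos hp).le, hb.phi_eq hp hu, hb.ofReal_integral_weight hp hu]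

theorem ClassB.phi_zero (hp : 0 < p) (hb : ClassB p b₁ b₂) : phi p b₁ b₂ 0 = 0 := by
  have := hb.phi_eq hp (u := 0) ⟨le_rfl, zero_le_one⟩
  rw [intervalIntegral.integral_same] at this
  exact (mul_eq_zero.1 this).resolve_left (hb.mass_pos hp).ne'

theorem ClassB.phi_one (hp : 0 < p) (hb : ClassB p b₁ b₂) : phi p b₁ b₂ 1 = 1 := by
  have := hb.phi_eq hp (u := 1) ⟨zero_le_one, le_rfl⟩
  exact mul_left_cancel₀ (hb.mass_pos hp).ne' (this.trans (mul_one _).symm)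

theorem ClassB.phi_mem (hp : 0 < p) (hb : ClassB p b₁ b₂) {u : ℝ} (hu : u ∈ Ioo (0 : ℝ) 1) :
    phi p b₁ b₂ u ∈ Ioo (0 : ℝ) 1 := by
  have h0 := hb.strictMonoOn_phi hp ⟨le_rfl, zero_le_one⟩ (Ioo_subset_Icc_self hu) hu.1
  have h1 := hb.strictMonoOn_phi hp (Ioo_subset_Icc_self hu) ⟨zero_le_one, le_rfl⟩ hu.2
  rw [hb.phi_zero hp] at h0
  rw [hb.phi_one hp] at h1
  exact ⟨h0, h1⟩

theorem ClassB.psi_mem (hp : 0 < p) (hb : ClassB p b₁ b₂) {u : ℝ} (hu : u ∈ Ioo (0 : ℝ) 1) :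
    psi p b₁ b₂ u ∈ Ioo (0 : ℝ) 1 := by
  have hI := hb.psi_mem_Icc hp (Ioo_subset_Icc_self hu)
  have e := hb.phi_psi hp (Ioo_subset_Icc_self hu)
  refine ⟨hI.1.lt_of_ne fun h => ?_, hI.2.lt_of_ne fun h => ?_⟩
  · rw [← h, hb.phi_zero hp] at e
    exact hu.1.ne e
  · rw [h, hb.phi_one hp] at e
    exact hu.2.ne' e

theorem ClassB.aemeasurable_phi (hp : 0 < p) (hb : ClassB p b₁ b₂) :
    AEMeasurable (phi p b₁ b₂) leb01 :=
  aemeasurable_restrict_of_monotoneOn measurableSet_Ioo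
    ((hb.strictMonoOn_phi hp).monotoneOn.mono Ioo_subset_Icc_self)

/-- The change of variables `r = φ(s)`. -/
theorem ClassB.lintegral_comp_phi (hp : 0 < p) (hb : ClassB p b₁ b₂) {F : ℝ → ℝ≥0∞}
    (hF : Measurable F) :
    ∫⁻ s, F (phi p b₁ b₂ s) * ENNReal.ofReal (weight p b₁ b₂ s) ∂leb01 =
      ENNReal.ofReal (mass p b₁ b₂) * ∫⁻ r, F r ∂leb01 := by
  set C := ENNReal.ofReal (mass p b₁ b₂)
  have hC0 : C ≠ 0 := (ENNReal.ofReal_pos.2 (hb.mass_pos hp)).ne'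
  have hCt : C ≠ ∞ := ENNReal.ofReal_ne_top
  set w : ℝ → ℝ≥0∞ := fun s => ENNReal.ofReal (weight p b₁ b₂ s)
  have hwm : AEMeasurable w leb01 := (hb.aemeasurable_weight hp).ennreal_ofReal
  set m := leb01.withDensity w
  have hm1 : m univ = C := by
    rw [withDensity_apply _ MeasurableSet.univ, Measure.restrict_univ,
      ← hb.ofReal_phi hp (u := 1) ⟨zero_le_one, le_rfl⟩, hb.phi_one hp, ENNReal.ofReal_one, mul_one]
  have hP : IsProbabilityMeasure (C⁻¹ • m) := ⟨by
    rw [Measure.smul_apply, hm1, smul_eq_mul, ENNReal.inv_mul_cancel hC0 hCt]⟩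
  have hφ : AEMeasurable (phi p b₁ b₂) (C⁻¹ • m) :=
    ((hb.aemeasurable_phi hp).mono_ac (withDensity_absolutelyContinuous _ _)).smul_measure _
  have hP' := Measure.isProbabilityMeasure_map hφ
  -- The normalised weight is a probability density whose distribution function is φ, so φ pushes it
  -- to Lebesgue measure: φ ≤ t means s ≤ ψ(t), a set of mass φ(ψ(t)) = t.
  have hmap : (C⁻¹ • m).map (phi p b₁ b₂) = leb01 := by
    refine eq_leb01_of_Iic fun t ht => ?_
    have hψ := hb.psi_mem hp ht
    rw [Measure.map_apply_of_aemeasurable hφ measurableSet_Iic, Measure.smul_apply, smul_eq_mul]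
    have hae : (phi p b₁ b₂ ⁻¹' Iic t : Set ℝ) =ᵐ[m] Ioo 0 (psi p b₁ b₂ t) := by
      refine (withDensity_absolutelyContinuous leb01 w).ae_eq ?_
      have hne : ∀ᵐ x ∂leb01, x ≠ psi p b₁ b₂ t := by
        rw [ae_iff]
        simp
      filter_upwards [ae_restrict_mem measurableSet_Ioo, hne] with x hx hxne
      have hx' := Ioo_subset_Icc_self hx
      refine propext ⟨fun h => ⟨hx.1, lt_of_le_of_ne ?_ hxne⟩, fun h => ?_⟩
      · have := (hb.strictMonoOn_psi hp).monotoneOn (hb.phi_mem_Icc hp hx')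
          (Ioo_subset_Icc_self ht) (show phi p b₁ b₂ x ≤ t from h)
        rwa [hb.psi_phi hp hx'] at this
      · have := (hb.strictMonoOn_phi hp).monotoneOn hx' (Ioo_subset_Icc_self hψ) h.2.le
        rwa [hb.phi_psi hp (Ioo_subset_Icc_self ht)] at this
    rw [measure_congr hae, withDensity_apply _ measurableSet_Ioo,
      Measure.restrict_restrict measurableSet_Ioo,
      inter_eq_left.2 (Ioo_subset_Ioo_right hψ.2.le),
      ← hb.ofReal_phi hp (Ioo_subset_Icc_self hψ), hb.phi_psi hp (Ioo_subset_Icc_self ht),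
      ← mul_assoc, ENNReal.inv_mul_cancel hC0 hCt, one_mul]
  have e1 : ∫⁻ s, F (phi p b₁ b₂ s) * w s ∂leb01 = ∫⁻ s, F (phi p b₁ b₂ s) ∂m := by
    have hFφ : AEMeasurable (fun s => F (phi p b₁ b₂ s)) leb01 :=
      hF.comp_aemeasurable (hb.aemeasurable_phi hp)
    rw [lintegral_withDensity_eq_lintegral_mul₀ hwm hFφ]
    simp only [Pi.mul_apply, mul_comm]
  rw [e1, ← hmap, lintegral_map' hF.aemeasurable hφ, lintegral_smul_measure, smul_eq_mul,
    ← mul_assoc, ENNReal.mul_inv_cancel hC0 hCt, one_mul]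

theorem ClassB.setLIntegral_comp_phi (hp : 0 < p) (hb : ClassB p b₁ b₂) {F : ℝ → ℝ≥0∞}
    (hF : Measurable F) {t : ℝ} (ht : t ∈ Ioo (0 : ℝ) 1) :
    ∫⁻ s in Ioo 0 t, F (phi p b₁ b₂ s) * ENNReal.ofReal (weight p b₁ b₂ s) =
      ENNReal.ofReal (mass p b₁ b₂) * ∫⁻ r in Ioo 0 (phi p b₁ b₂ t), F r := by
  have hr : ∀ {t : ℝ}, t ∈ Ioo (0 : ℝ) 1 → leb01.restrict (Ioo 0 t) = volume.restrict (Ioo 0 t) :=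
    fun ht => by
    rw [Measure.restrict_restrict measurableSet_Ioo,
      inter_eq_left.2 (Ioo_subset_Ioo_right ht.2.le)]
  have h := hb.lintegral_comp_phi hp (hF.indicator (measurableSet_Ioo (a := 0)
    (b := phi p b₁ b₂ t)))
  rw [lintegral_indicator measurableSet_Ioo, hr (hb.phi_mem hp ht)] at h
  rw [← h, ← hr ht, ← lintegral_indicator measurableSet_Ioo]
  refine lintegral_congr_ae ?_
  filter_upwards [ae_restrict_mem measurableSet_Ioo] with x hx
  have hlt := (hb.strictMonoOn_phi hp).lt_iff_lt (Ioo_subset_Icc_self hx) (Ioo_subset_Icc_self ht)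
  by_cases hxt : x < t
  · rw [indicator_of_mem (show x ∈ Ioo 0 t from ⟨hx.1, hxt⟩), indicator_of_mem
      (show phi p b₁ b₂ x ∈ Ioo 0 (phi p b₁ b₂ t) from ⟨(hb.phi_mem hp hx).1, hlt.2 hxt⟩)]
  · rw [indicator_of_notMem (fun h : x ∈ Ioo 0 t => hxt h.2), indicator_of_notMem
      (fun h : phi p b₁ b₂ x ∈ Ioo 0 (phi p b₁ b₂ t) => hxt (hlt.1 h.2)), zero_mul]

/-- The weight is nonincreasing, so its integral over (0,u) is at least u times its final value.
With the reverse bound from slow variation, φ(u) ≈ u w(u). -/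
theorem ClassB.mul_weight_le_phi (hp : 0 < p) (hb : ClassB p b₁ b₂) {u : ℝ}
    (hu : u ∈ Ioo (0 : ℝ) 1) : u * weight p b₁ b₂ u ≤ mass p b₁ b₂ * phi p b₁ b₂ u := by
  have hm := hb.mass_pos hp
  have hφ := (hb.phi_mem hp hu).1
  rw [← ENNReal.ofReal_le_ofReal_iff (by positivity), ENNReal.ofReal_mul hm.le,
    hb.ofReal_phi hp (Ioo_subset_Icc_self hu)]
  calc ENNReal.ofReal (u * weight p b₁ b₂ u)
      = ∫⁻ s in Ioo 0 u, ENNReal.ofReal (weight p b₁ b₂ u) := by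
        rw [lintegral_const, Measure.restrict_apply MeasurableSet.univ, univ_inter,
          Real.volume_Ioo, sub_zero, mul_comm u, ENNReal.ofReal_mul (hb.weight_pos hu).le]
    _ ≤ _ := setLIntegral_mono' measurableSet_Ioo fun s hs => ENNReal.ofReal_le_ofReal
        (hb.antitoneOn_weight hp ⟨hs.1, hs.2.trans hu.2⟩ hu hs.2.le)

theorem ClassB.phi_le_mul_weight (hp : 0 < p) (hb : ClassB p b₁ b₂) : ∃ K > 0,
    ∀ u ∈ Ioo (0 : ℝ) 1, phi p b₁ b₂ u ≤ K * (u * weight p b₁ b₂ u) := by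
  obtain ⟨K, hK, h⟩ := hb.weight_le_rpow_half hp
  have hm := hb.mass_pos hp
  refine ⟨2 * K / mass p b₁ b₂, by positivity, fun u hu => ?_⟩
  have hw := hb.weight_pos hu
  have h1 := lintegral_le_of_le_rpow_half hu.1 hK.le hw.le fun s hs =>
    h s ⟨hs.1, hs.2.trans hu.2⟩ u hu hs.2.le
  have := hu.1
  rw [← hb.ofReal_phi hp (Ioo_subset_Icc_self hu), ← ENNReal.ofReal_mul hm.le,
    ENNReal.ofReal_le_ofReal_iff (by positivity)] at h1
  rw [div_mul_eq_mul_div, le_div_iff₀ hm, mul_comm]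
  exact h1

/-- Monotonicity keeps b₁ away from 0 and b₂ bounded, so the weight has a positive lower bound. -/
theorem ClassB.mul_le_phi (hp : 0 < p) (hb : ClassB p b₁ b₂) : ∃ c > 0,
    ∀ u ∈ Ioo (0 : ℝ) 1, c * u ≤ phi p b₁ b₂ u := by
  obtain ⟨c, hc, h₁⟩ := hb.slow₁.exists_lower_const hb.anti₁
  obtain ⟨M, hM, h₂⟩ := hb.slow₂.exists_upper_const hb.mono₂
  have hm := hb.mass_pos hp
  refine ⟨(c * M⁻¹) ^ p / mass p b₁ b₂, by positivity, fun u hu => ?_⟩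
  have h1 := hb.slow₁.pos u hu
  have h2 := hb.slow₂.pos u hu
  have := hu.1
  rw [div_mul_eq_mul_div, div_le_iff₀ hm]
  calc (c * M⁻¹) ^ p * u ≤ weight p b₁ b₂ u * u := by
        unfold weight
        gcongr
        · exact h₁ u hu
        · exact h₂ u hu
    _ = u * weight p b₁ b₂ u := mul_comm _ _
    _ ≤ _ := hb.mul_weight_le_phi hp hu
    _ = _ := mul_comm _ _

/-- This is the usable form of condition (c), with φ(u) in place of u w(u). Near 0 the two arguments
are exchanged by φ(u) ≲ u w(u) and the Potter bound; away from 0, b₁ lies between positive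
constants. -/
theorem ClassB.le_comp_phi (hp : 0 < p) (hb : ClassB p b₁ b₂) : ∃ K > 0,
    ∀ u ∈ Ioo (0 : ℝ) 1, b₁ u ≤ K * b₁ (phi p b₁ b₂ u) := by
  obtain ⟨c, hc, C, hC, hev⟩ := hb.equiv_near_zero
  obtain ⟨K₁, hK₁, h₁⟩ := hb.slow₁.le_rpow_mul one_pos
  obtain ⟨K₂, hK₂, h₂⟩ := hb.phi_le_mul_weight hp
  obtain ⟨K₃, hK₃, h₃⟩ := hb.weight_le_rpow_half hp
  obtain ⟨c₄, hc₄, h₄⟩ := hb.slow₁.exists_lower_const hb.anti₁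
  have hh : (1 / 2 : ℝ) ∈ Ioo (0 : ℝ) 1 := by constructor <;> norm_num
  -- The bounds on b₁ hold only on (0,1), so u w(u) must be below 1; slow variation gives t w(t) ≲
  -- t^{1/2} near 0.
  have hsmall : ∀ᶠ t in 𝓝[>] (0 : ℝ), t * weight p b₁ b₂ t < 1 := by
    have hlim : Tendsto (fun t : ℝ => K₃ * weight p b₁ b₂ (1 / 2) * t ^ (1 / 2 : ℝ)) (𝓝[>] 0)
        (𝓝 (K₃ * weight p b₁ b₂ (1 / 2) * 0 ^ (1 / 2 : ℝ))) :=
      (((Real.continuous_rpow_const (by norm_num)).tendsto 0).mono_left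
        nhdsWithin_le_nhds).const_mul _
    rw [Real.zero_rpow (by norm_num), mul_zero] at hlim
    filter_upwards [(tendsto_order.1 hlim).2 1 one_pos,
      Ioo_mem_nhdsGT (show (0 : ℝ) < 1 / 2 by norm_num)] with t ht1 ht2
    refine lt_of_le_of_lt ?_ ht1
    have ht0 := ht2.1
    have hw := hb.weight_pos hh
    calc t * weight p b₁ b₂ t
        ≤ t * (K₃ * ((1 / 2) / t) ^ (1 / 2 : ℝ) * weight p b₁ b₂ (1 / 2)) := by
          gcongr
          exact h₃ t ⟨ht2.1, ht2.2.trans hh.2⟩ _ hh ht2.2.le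
      _ ≤ t * (K₃ * (1 / t) ^ (1 / 2 : ℝ) * weight p b₁ b₂ (1 / 2)) := by
          gcongr
          norm_num
      _ = K₃ * weight p b₁ b₂ (1 / 2) * (t * (1 / t) ^ (1 / 2 : ℝ)) := by ring
      _ = _ := by
          congr 1
          rw [Real.div_rpow zero_le_one ht0.le, Real.one_rpow, mul_one_div]
          nth_rewrite 1 [← Real.rpow_one t]
          rw [← Real.rpow_sub ht0]
          norm_num
  obtain ⟨δ, hδ, hδ'⟩ := mem_nhdsGT_iff_exists_Ioo_subset.1 (hev.and hsmall)
  have hm := hb.mass_pos hp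
  set d := min (δ / 2) (1 / 2) with hd
  have hδ0 : (0 : ℝ) < δ := hδ
  have hdm : d ∈ Ioo (0 : ℝ) 1 :=
    ⟨lt_min (by linarith) (by norm_num), (min_le_right _ _).trans_lt (by norm_num)⟩
  have hdδ : d < δ := (min_le_left _ _).trans_lt (by linarith)
  have hbd := hb.slow₁.pos d hdm
  refine ⟨max (C * max 1 (K₁ * K₂)) (b₁ d / c₄), lt_max_of_lt_right (by positivity),
    fun u hu => ?_⟩
  have hφ := hb.phi_mem hp hu
  have hbφ := hb.slow₁.pos _ hφ
  rcases lt_or_ge u d with hud | hud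
  · obtain ⟨⟨-, h5⟩, h6⟩ := hδ' ⟨hu.1, hud.trans hdδ⟩
    have hw := hb.weight_pos hu
    have e : u * b₁ u ^ p * b₂ u ^ (-p) = u * weight p b₁ b₂ u := by
      rw [hb.weight_eq hu, Real.rpow_neg (hb.slow₂.pos u hu).le]
      ring
    rw [e] at h5
    have hy : u * weight p b₁ b₂ u ∈ Ioo (0 : ℝ) 1 := ⟨mul_pos hu.1 hw, h6⟩
    have h7 : b₁ (u * weight p b₁ b₂ u) ≤ max 1 (K₁ * K₂) * b₁ (phi p b₁ b₂ u) := by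
      rcases le_total (phi p b₁ b₂ u) (u * weight p b₁ b₂ u) with hle | hle
      · calc _ ≤ b₁ (phi p b₁ b₂ u) := hb.anti₁ hφ hy hle
          _ = 1 * b₁ (phi p b₁ b₂ u) := (one_mul _).symm
          _ ≤ _ := by gcongr; exact le_max_left _ _
      · refine (h₁ _ hy _ hφ hle).trans ?_
        rw [Real.rpow_one]
        gcongr
        refine le_trans ?_ (le_max_right _ _)
        gcongr
        rw [div_le_iff₀ hy.1]
        exact h₂ u hu
    calc b₁ u ≤ C * b₁ (u * weight p b₁ b₂ u) := h5
      _ ≤ C * (max 1 (K₁ * K₂) * b₁ (phi p b₁ b₂ u)) := by gcongr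
      _ = C * max 1 (K₁ * K₂) * b₁ (phi p b₁ b₂ u) := by ring
      _ ≤ _ := by gcongr; exact le_max_left _ _
  · calc b₁ u ≤ b₁ d := hb.anti₁ hdm hu hud
      _ = b₁ d / c₄ * c₄ := by field_simp
      _ ≤ b₁ d / c₄ * b₁ (phi p b₁ b₂ u) := by gcongr; exact h₄ _ hφ
      _ ≤ _ := by gcongr; exact le_max_right _ _

end Weights

/-! ### Two-sided estimates of the K-functional. -/

section KFunctional

variable {R S : Type*} [MeasurableSpace R] [MeasurableSpace S] {μ : Measure R} {ν : Measure S}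
variable {p : ℝ} {b₁ b₂ : ℝ → ℝ}

theorem setLIntegral_comp_half_le (Φ : ℝ → ℝ≥0∞) (u : ℝ) :
    ∫⁻ s in Ioo 0 u, Φ (s / 2) ≤ 2 * ∫⁻ s in Ioo 0 u, Φ s := by
  have h2 : (2⁻¹ : ℝ) ≠ 0 := by norm_num
  have hmap := lintegral_map_equiv (μ := volume) ((Ioo 0 u).indicator Φ)
    (Homeomorph.mulLeft₀ (2⁻¹ : ℝ) h2).toMeasurableEquiv
  have e : Measure.map (Homeomorph.mulLeft₀ (2⁻¹ : ℝ) h2).toMeasurableEquiv volume =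
      (2 : ℝ≥0∞) • (volume : Measure ℝ) := by
    have := Real.map_volume_mul_left h2
    rw [inv_inv, abs_of_pos (by norm_num), ENNReal.ofReal_ofNat] at this
    exact this
  rw [e, lintegral_smul_measure, lintegral_indicator measurableSet_Ioo, smul_eq_mul] at hmap
  rw [hmap, ← lintegral_indicator measurableSet_Ioo]
  refine lintegral_mono fun s => ?_
  by_cases hs : s ∈ Ioo 0 u
  · have hs' : 2⁻¹ * s ∈ Ioo 0 u := ⟨by linarith [hs.1], by linarith [hs.1, hs.2]⟩
    rw [indicator_of_mem hs]
    change _ ≤ (Ioo 0 u).indicator Φ (2⁻¹ * s)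
    rw [indicator_of_mem hs', div_eq_inv_mul]
  · rw [indicator_of_notMem hs]
    exact zero_le

theorem add_rpow_le (hp : 0 < p) (x y : ℝ≥0∞) : (x + y) ^ p ≤ 2 ^ p * (x ^ p + y ^ p) := by
  have h : ∀ x y : ℝ≥0∞, x ≤ y → (x + y) ^ p ≤ 2 ^ p * (x ^ p + y ^ p) := fun x y hxy => by
    calc (x + y) ^ p ≤ (2 * y) ^ p := by
          gcongr
          rw [two_mul]
          gcongr
      _ = 2 ^ p * y ^ p := ENNReal.mul_rpow_of_nonneg _ _ hp.le
      _ ≤ _ := by gcongr; exact le_add_self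
  rcases le_total x y with hxy | hxy
  · exact h x y hxy
  · rw [add_comm x, add_comm (x ^ p)]
    exact h y x hxy

theorem rpow_add_rpow_le (hp : 0 < p) (x y : ℝ≥0∞) : x ^ p + y ^ p ≤ 2 * (x + y) ^ p := by
  rw [two_mul]
  gcongr
  · exact le_self_add
  · exact le_add_self

theorem karamata_eq (hp : 0 < p) (b : ℝ → ℝ) (f : R →ₘ[μ] ℂ) :
    karamata (ENNReal.ofReal p) b f =
      (∫⁻ t, (ENNReal.ofReal (b t) * star f t) ^ p ∂leb01) ^ (1 / p) := by
  rw [karamata, eLpNorm_eq_lintegral_rpow_enorm_toReal (ENNReal.ofReal_pos.2 hp).ne'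
    ENNReal.ofReal_ne_top, ENNReal.toReal_ofReal hp.le]
  rfl

theorem karamata_rpow (hp : 0 < p) (b : ℝ → ℝ) (f : R →ₘ[μ] ℂ) :
    karamata (ENNReal.ofReal p) b f ^ p = ∫⁻ t, (ENNReal.ofReal (b t) * star f t) ^ p ∂leb01 := by
  rw [karamata_eq hp, ← ENNReal.rpow_mul, one_div_mul_cancel hp.ne', ENNReal.rpow_one]

theorem karamata_top (b : ℝ → ℝ) (f : R →ₘ[μ] ℂ) :
    karamata ∞ b f = essSup (fun t => ENNReal.ofReal (b t) * star f t) leb01 := by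
  rw [karamata, eLpNorm_exponent_top]
  rfl

theorem aemeasurable_enorm_coe (f : R →ₘ[μ] ℂ) : AEMeasurable (fun x => ‖f x‖ₑ) μ :=
  f.aestronglyMeasurable.enorm

theorem measurable_star (f : R →ₘ[μ] ℂ) : Measurable (star f) := measurable_rearr _ _

theorem antitone_star (f : R →ₘ[μ] ℂ) : Antitone (star f) := antitone_rearr _ _

theorem lintegral_star_rpow [IsProbabilityMeasure μ] (f : R →ₘ[μ] ℂ) (p : ℝ) :
    ∫⁻ t, star f t ^ p ∂leb01 = ∫⁻ x, ‖f x‖ₑ ^ p ∂μ :=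
  lintegral_comp_rearr (aemeasurable_enorm_coe f) (Φ := fun y => y ^ p)
    (ENNReal.continuous_rpow_const.measurable)

theorem star_lt_top [IsFiniteMeasure μ] (f : R →ₘ[μ] ℂ) {t : ℝ} (ht : 0 < t) : star f t < ∞ := by
  have hanti : Antitone fun n : ℕ => {x | (n : ℝ≥0∞) < ‖f x‖ₑ} := fun m n hmn x hx =>
    lt_of_le_of_lt (Nat.cast_le.2 hmn) (show (n : ℝ≥0∞) < ‖f x‖ₑ from hx)
  have hlim := tendsto_measure_iInter_atTop (μ := μ)
    (fun n : ℕ => nullMeasurableSet_lt (aemeasurable_const (b := (n : ℝ≥0∞)))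
      (aemeasurable_enorm_coe f)) hanti ⟨0, measure_ne_top _ _⟩
  have hemp : ⋂ n : ℕ, {x | (n : ℝ≥0∞) < ‖f x‖ₑ} = ∅ := by
    refine eq_empty_of_forall_notMem fun x hx => ?_
    obtain ⟨n, hn⟩ := ENNReal.exists_nat_gt (enorm_ne_top (x := f x))
    exact absurd (mem_iInter.1 hx n) (not_lt.2 hn.le)
  rw [hemp, measure_empty] at hlim
  obtain ⟨n, hn⟩ := ((tendsto_order.1 hlim).2 _ (ENNReal.ofReal_pos.2 ht)).exists
  exact (rearr_le_iff.2 hn.le).trans_lt (ENNReal.natCast_lt_top n)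

/-- Reading L^p and L^∞ as Karamata spaces with b = 1 lets the same two K-functional estimates serve
both couples. -/
theorem eLpNorm_eq_karamata [IsProbabilityMeasure μ] (hp : 0 < p) (f : R →ₘ[μ] ℂ) :
    eLpNorm f (ENNReal.ofReal p) μ = karamata (ENNReal.ofReal p) (fun _ => 1) f := by
  rw [karamata_eq hp, eLpNorm_eq_lintegral_rpow_enorm_toReal (ENNReal.ofReal_pos.2 hp).ne'
    ENNReal.ofReal_ne_top, ENNReal.toReal_ofReal hp.le]
  simp only [ENNReal.ofReal_one, one_mul]
  rw [lintegral_star_rpow]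

theorem eLpNorm_top_eq_karamata [IsProbabilityMeasure μ] (f : R →ₘ[μ] ℂ) :
    eLpNorm f ∞ μ = karamata ∞ (fun _ => 1) f := by
  rw [karamata_top, eLpNorm_exponent_top]
  simp only [ENNReal.ofReal_one, one_mul]
  have h1 := essSup_map_measure (μ := μ) (g := fun y : ℝ≥0∞ => y) aemeasurable_id
    (aemeasurable_enorm_coe f)
  have h2 := essSup_map_measure (μ := leb01) (g := fun y : ℝ≥0∞ => y) aemeasurable_id
    (measurable_star f).aemeasurable
  have h3 : leb01.map (star f) = μ.map fun x => ‖f x‖ₑ := map_rearr (aemeasurable_enorm_coe f)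
  rw [h3, h1] at h2
  exact h2

/-- A lower estimate of the `K`-functional of a couple of Lorentz–Karamata spaces. -/
theorem setLIntegral_star_le_Kfun (hp : 0 < p) (h₁ : AntitoneOn b₁ (Ioo 0 1))
    (h₂ : ∀ s ∈ Ioo (0 : ℝ) 1, 0 < b₂ s) (hm₂ : AEMeasurable b₂ leb01) (A : ℝ≥0) :
    ∃ c : ℝ≥0, ∀ f : R →ₘ[μ] ℂ, ∀ u ∈ Ioo (0 : ℝ) 1, ∀ t : ℝ,
      ∫⁻ s in Ioo 0 u, ENNReal.ofReal (b₁ s * (b₂ s)⁻¹) ^ p ≤ A * ENNReal.ofReal t ^ p →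
      ∫⁻ s in Ioo 0 u, (star f s * ENNReal.ofReal (b₁ s)) ^ p ≤
        (c * Kfun (karamata (ENNReal.ofReal p) b₁) (karamata ∞ b₂) f t) ^ p := by
  have hb₁m : AEMeasurable b₁ leb01 := aemeasurable_restrict_of_antitoneOn measurableSet_Ioo h₁
  -- The factors come from (x + y)^p ≤ 2^p (x^p + y^p), the dilation s ↦ s/2, merging the constants
  -- 1 and A, and x^p + y^p ≤ 2 (x + y)^p.
  set c₀ : ℝ≥0 := 2 ^ p * (2 * (max 1 A * 2)) with hc₀
  have hc₀0 : c₀ ≠ 0 := by positivity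
  refine ⟨c₀ ^ (1 / p), fun f u hu t hA => ?_⟩
  have hr : leb01.restrict (Ioo 0 u) = volume.restrict (Ioo 0 u) := by
    rw [Measure.restrict_restrict measurableSet_Ioo,
      inter_eq_left.2 (Ioo_subset_Ioo_right hu.2.le)]
  -- For f = g + h one has f*(s) ≤ g*(s/2) + h*(s/2), and b₁(s) ≤ b₁(s/2). The g part is bounded by
  -- its Karamata norm; for the h part h* ≤ ‖h‖/b₂, leaving ∫_0^u (b₁/b₂)^p.
  have key : ∀ g h : R →ₘ[μ] ℂ, f = g + h →
      ∫⁻ s in Ioo 0 u, (star f s * ENNReal.ofReal (b₁ s)) ^ p ≤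
        c₀ * (karamata (ENNReal.ofReal p) b₁ g + ENNReal.ofReal t * karamata ∞ b₂ h) ^ p := by
    intro g h hf
    set Φ : (R →ₘ[μ] ℂ) → ℝ → ℝ≥0∞ := fun g s => (star g s * ENNReal.ofReal (b₁ s)) ^ p
    have hsum : ∀ s : ℝ, 0 < s → star f s ≤ star g (s / 2) + star h (s / 2) := by
      intro s hs
      have h1 : star f s ≤ rearr μ (fun x => ‖g x‖ₑ + ‖h x‖ₑ) s := by
        have : star f = rearr μ (fun x => ‖(g + h : R → ℂ) x‖ₑ) := by
          refine rearr_congr_ae ?_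
          filter_upwards [AEEqFun.coeFn_add g h] with x hx
          rw [hf, hx]
        rw [this]
        exact rearr_mono (fun x => enorm_add_le _ _) s
      have h2 := rearr_add_le (μ := μ) (fun x => ‖g x‖ₑ) (fun x => ‖h x‖ₑ)
        (s := s / 2) (t := s / 2) (by linarith) (by linarith)
      rw [add_halves] at h2
      exact h1.trans h2
    have hΦm : ∀ g, AEMeasurable (Φ g) (volume.restrict (Ioo 0 u)) := fun g => by
      rw [← hr]
      exact (((measurable_star g).aemeasurable.mul hb₁m.ennreal_ofReal).pow_const p).restrict
    have hg : ∫⁻ s in Ioo 0 u, Φ g s ≤ karamata (ENNReal.ofReal p) b₁ g ^ p := by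
      rw [karamata_rpow hp, ← hr]
      simp only [Φ, mul_comm]
      exact setLIntegral_le_lintegral _ _
    have hh : ∫⁻ s in Ioo 0 u, Φ h s ≤ A * (ENNReal.ofReal t * karamata ∞ b₂ h) ^ p := by
      have hae : ∀ᵐ s ∂leb01, ENNReal.ofReal (b₂ s) * star h s ≤ karamata ∞ b₂ h := by
        rw [karamata_top]
        exact ENNReal.ae_le_essSup _
      calc ∫⁻ s in Ioo 0 u, Φ h s
          ≤ ∫⁻ s in Ioo 0 u, karamata ∞ b₂ h ^ p * ENNReal.ofReal (b₁ s * (b₂ s)⁻¹) ^ p := by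
            rw [← hr]
            refine lintegral_mono_ae ?_
            have hae' := ae_restrict_of_ae (s := Ioo 0 u) hae
            filter_upwards [hae', ae_restrict_mem measurableSet_Ioo] with s hs hsu
            have hb2 := h₂ s ⟨hsu.1, hsu.2.trans hu.2⟩
            rw [← ENNReal.mul_rpow_of_nonneg _ _ hp.le]
            refine ENNReal.rpow_le_rpow ?_ hp.le
            have e : ENNReal.ofReal (b₁ s) =
                ENNReal.ofReal (b₂ s) * ENNReal.ofReal (b₁ s * (b₂ s)⁻¹) := by
              rw [← ENNReal.ofReal_mul hb2.le]
              congr 1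
              field_simp
            rw [e, ← mul_assoc, mul_comm (star h s)]
            gcongr
        _ = karamata ∞ b₂ h ^ p * ∫⁻ s in Ioo 0 u, ENNReal.ofReal (b₁ s * (b₂ s)⁻¹) ^ p := by
            refine lintegral_const_mul'' _ ?_
            rw [← hr]
            exact ((hb₁m.mul hm₂.inv).ennreal_ofReal.pow_const p).restrict
        _ ≤ karamata ∞ b₂ h ^ p * (A * ENNReal.ofReal t ^ p) := by gcongr
        _ = _ := by rw [ENNReal.mul_rpow_of_nonneg _ _ hp.le]; ring
    calc ∫⁻ s in Ioo 0 u, (star f s * ENNReal.ofReal (b₁ s)) ^ p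
        ≤ ∫⁻ s in Ioo 0 u, 2 ^ p * (Φ g (s / 2) + Φ h (s / 2)) := by
          refine setLIntegral_mono' measurableSet_Ioo fun s hs => ?_
          refine le_trans ?_ (add_rpow_le hp _ _)
          refine ENNReal.rpow_le_rpow ?_ hp.le
          rw [← add_mul]
          have hs1 : s ∈ Ioo (0 : ℝ) 1 := ⟨hs.1, hs.2.trans hu.2⟩
          gcongr
          · exact hsum s hs.1
          · exact h₁ ⟨by linarith [hs.1], by linarith [hs1.2, hs1.1]⟩ hs1 (by linarith [hs.1])
      _ ≤ 2 * ∫⁻ s in Ioo 0 u, 2 ^ p * (Φ g s + Φ h s) :=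
          setLIntegral_comp_half_le (fun s => 2 ^ p * (Φ g s + Φ h s)) u
      _ = 2 ^ p * (2 * ((∫⁻ s in Ioo 0 u, Φ g s) + ∫⁻ s in Ioo 0 u, Φ h s)) := by
          rw [lintegral_const_mul' _ _ (by simp), lintegral_add_left' (hΦm g)]
          ring
      _ ≤ 2 ^ p * (2 * (karamata (ENNReal.ofReal p) b₁ g ^ p +
            A * (ENNReal.ofReal t * karamata ∞ b₂ h) ^ p)) := by gcongr
      _ ≤ 2 ^ p * (2 * (max 1 A * (karamata (ENNReal.ofReal p) b₁ g ^ p +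
            (ENNReal.ofReal t * karamata ∞ b₂ h) ^ p))) := by
          rw [mul_add (↑(max 1 A) : ℝ≥0∞)]
          gcongr
          · refine le_mul_of_one_le_left zero_le ?_
            exact_mod_cast le_max_left 1 A
          · exact le_max_right _ _
      _ ≤ 2 ^ p * (2 * (max 1 A * (2 * (karamata (ENNReal.ofReal p) b₁ g +
            ENNReal.ofReal t * karamata ∞ b₂ h) ^ p))) := by
          gcongr
          exact rpow_add_rpow_le hp _ _
      _ = _ := by
          rw [hc₀]
          push_cast
          rw [ENNReal.coe_rpow_of_nonneg _ hp.le]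
          push_cast
          ring
  set I := ∫⁻ s in Ioo 0 u, (star f s * ENNReal.ofReal (b₁ s)) ^ p
  have hc1 : c₀ ^ (1 / p) ≠ 0 := by positivity
  have hle : I ^ (1 / p) ≤
      (c₀ ^ (1 / p) : ℝ≥0) * Kfun (karamata (ENNReal.ofReal p) b₁) (karamata ∞ b₂) f t := by
    rw [← ENNReal.div_le_iff' (by exact_mod_cast hc1) ENNReal.coe_ne_top]
    refine le_iInf fun g => le_iInf fun h => le_iInf fun _ => le_iInf fun _ => le_iInf fun hf => ?_
    rw [ENNReal.div_le_iff' (by exact_mod_cast hc1) ENNReal.coe_ne_top]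
    refine (ENNReal.rpow_le_rpow (key g h hf) (by positivity)).trans_eq ?_
    rw [ENNReal.mul_rpow_of_nonneg _ _ (by positivity), ← ENNReal.rpow_mul,
      mul_one_div_cancel hp.ne', ENNReal.rpow_one, ENNReal.coe_rpow_of_nonneg _ (by positivity)]
  calc I = (I ^ (1 / p)) ^ p := by
        rw [← ENNReal.rpow_mul, one_div_mul_cancel hp.ne', ENNReal.rpow_one]
    _ ≤ _ := ENNReal.rpow_le_rpow hle hp.le

/-- Radial truncation at height `l`. -/
def radialTrunc (l : ℝ≥0) (z : ℂ) : ℂ := if ‖z‖ ≤ l then z else ((l / ‖z‖ : ℝ) : ℂ) * z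

theorem measurable_radialTrunc (l : ℝ≥0) : Measurable (radialTrunc l) := by
  refine Measurable.ite (measurableSet_le measurable_norm measurable_const) measurable_id ?_
  exact (Complex.measurable_ofReal.comp (measurable_const.div measurable_norm)).mul measurable_id

theorem enorm_radialTrunc_le (l : ℝ≥0) (z : ℂ) : ‖radialTrunc l z‖ₑ ≤ min ‖z‖ₑ l := by
  unfold radialTrunc
  split_ifs with h
  · refine le_min le_rfl ?_
    rw [enorm_eq_nnnorm]
    exact_mod_cast h
  · have hz : 0 < ‖z‖ := l.2.trans_lt (not_le.1 h)
    have h2 : ‖((l / ‖z‖ : ℝ) : ℂ) * z‖₊ = l := by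
      apply NNReal.coe_injective
      rw [coe_nnnorm, norm_mul, Complex.norm_real, Real.norm_of_nonneg (by positivity)]
      field_simp
    rw [enorm_eq_nnnorm, h2, enorm_eq_nnnorm, le_min_iff]
    refine ⟨?_, le_rfl⟩
    exact_mod_cast (not_le.1 h).le

theorem enorm_sub_radialTrunc (l : ℝ≥0) (z : ℂ) : ‖z - radialTrunc l z‖ₑ = ‖z‖ₑ - l := by
  unfold radialTrunc
  split_ifs with h
  · rw [sub_self, enorm_zero, eq_comm, tsub_eq_zero_iff_le, enorm_eq_nnnorm]
    exact_mod_cast h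
  · have h' := not_le.1 h
    have hz : 0 < ‖z‖ := l.2.trans_lt h'
    have h2 : ‖z - ((l / ‖z‖ : ℝ) : ℂ) * z‖₊ = ‖z‖₊ - l := by
      apply NNReal.coe_injective
      rw [NNReal.coe_sub (by exact_mod_cast h'.le), coe_nnnorm, coe_nnnorm]
      have : z - ((l / ‖z‖ : ℝ) : ℂ) * z = ((1 - l / ‖z‖ : ℝ) : ℂ) * z := by push_cast; ring
      rw [this, norm_mul, Complex.norm_real, Real.norm_of_nonneg]
      · field_simp
      · rw [sub_nonneg, div_le_one hz]
        exact h'.le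
    rw [enorm_eq_nnnorm, h2, enorm_eq_nnnorm, ENNReal.coe_sub]

/-- An upper estimate of the `K`-functional of a couple of Lorentz–Karamata spaces. -/
theorem Kfun_le [IsFiniteMeasure μ] (hp : 0 < p) (h₂ : MonotoneOn b₂ (Ioo 0 1)) {f : R →ₘ[μ] ℂ}
    {u t : ℝ} (hu : u ∈ Ioo (0 : ℝ) 1)
    (hI : ∫⁻ s in Ioo 0 u, (star f s * ENNReal.ofReal (b₁ s)) ^ p < ∞) {M : ℝ≥0∞} (hM : M < ∞)
    (h : ∀ s ∈ Ioo (0 : ℝ) 1, u ≤ s → ENNReal.ofReal (b₂ s) * star f s ≤ M) :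
    Kfun (karamata (ENNReal.ofReal p) b₁) (karamata ∞ b₂) f t ≤
      (∫⁻ s in Ioo 0 u, (star f s * ENNReal.ofReal (b₁ s)) ^ p) ^ (1 / p) +
        ENNReal.ofReal t * M := by
  -- Truncate at height l = f*(u), which is finite: the excess has rearrangement zero from u on, and
  -- the truncated part is bounded by l.
  obtain ⟨l, hl⟩ : ∃ l : ℝ≥0, (l : ℝ≥0∞) = star f u :=
    ⟨(star f u).toNNReal, ENNReal.coe_toNNReal (star_lt_top f hu.1).ne⟩
  set k : R →ₘ[μ] ℂ := AEEqFun.compMeasurable (radialTrunc l) (measurable_radialTrunc l) f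
  have hk : k =ᵐ[μ] radialTrunc l ∘ f := AEEqFun.coeFn_compMeasurable _ _ _
  have hr : leb01.restrict (Ioo 0 u) = volume.restrict (Ioo 0 u) := by
    rw [Measure.restrict_restrict measurableSet_Ioo,
      inter_eq_left.2 (Ioo_subset_Ioo_right hu.2.le)]
  have hgs : star (f - k) = rearr μ fun x => ‖f x‖ₑ - l := by
    refine rearr_congr_ae ?_
    filter_upwards [hk, AEEqFun.coeFn_sub f k] with x hx hx'
    rw [hx', Pi.sub_apply, hx]
    exact enorm_sub_radialTrunc l (f x)
  have hks : ∀ s, star k s ≤ min (star f s) l := by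
    have : star k = rearr μ fun x => ‖radialTrunc l (f x)‖ₑ := by
      refine rearr_congr_ae ?_
      filter_upwards [hk] with x hx
      rw [hx]
      rfl
    intro s
    rw [this]
    refine le_min (rearr_mono (fun x => (enorm_radialTrunc_le l (f x)).trans (min_le_left _ _)) s)
      (rearr_le_iff.2 ?_)
    have : {x | (l : ℝ≥0∞) < ‖radialTrunc l (f x)‖ₑ} = ∅ :=
      eq_empty_of_forall_notMem fun x hx =>
        absurd ((enorm_radialTrunc_le l (f x)).trans (min_le_right _ _)) (not_le.2 hx)
    rw [this, measure_empty]
    exact zero_le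
  have hg0 : ∀ s, u ≤ s → star (f - k) s = 0 := by
    intro s hs
    refine le_antisymm ?_ zero_le
    rw [hgs, rearr_le_iff]
    refine le_trans (measure_mono fun x hx => ?_) ((measure_rearr_lt_le μ (fun x => ‖f x‖ₑ) u).trans
      (ENNReal.ofReal_le_ofReal hs))
    have : (l : ℝ≥0∞) < ‖f x‖ₑ := tsub_pos_iff_lt.1 hx
    rwa [hl] at this
  have hN0 : karamata (ENNReal.ofReal p) b₁ (f - k) ≤
      (∫⁻ s in Ioo 0 u, (star f s * ENNReal.ofReal (b₁ s)) ^ p) ^ (1 / p) := by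
    rw [karamata_eq hp, ← hr, ← lintegral_indicator (μ := leb01) measurableSet_Ioo]
    refine ENNReal.rpow_le_rpow (lintegral_mono_ae ?_) (by positivity)
    filter_upwards [ae_restrict_mem measurableSet_Ioo] with s hs
    rcases lt_or_ge s u with hsu | hsu
    · rw [indicator_of_mem (show s ∈ Ioo 0 u from ⟨hs.1, hsu⟩), mul_comm]
      refine ENNReal.rpow_le_rpow (mul_le_mul_left ?_ _) hp.le
      rw [hgs]
      exact rearr_mono (fun x => tsub_le_self) s
    · rw [hg0 s hsu, mul_zero, ENNReal.zero_rpow_of_pos hp]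
      exact zero_le
  have hN1 : karamata ∞ b₂ k ≤ M := by
    rw [karamata_top]
    refine essSup_le_of_ae_le _ ?_
    filter_upwards [ae_restrict_mem measurableSet_Ioo] with s hs
    rcases le_total u s with hus | hus
    · calc _ ≤ ENNReal.ofReal (b₂ s) * star f s := by
            gcongr
            exact (hks s).trans (min_le_left _ _)
        _ ≤ M := h s hs hus
    -- Left of u, k* is at most l = f*(u) and b₂ is largest at u, so the bound at u suffices.
    · calc _ ≤ ENNReal.ofReal (b₂ u) * star f u := by
            gcongr
            · exact h₂ hs hu hus
            · exact ((hks s).trans (min_le_right _ _)).trans_eq hl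
        _ ≤ M := h u hu le_rfl
  have hI' : (∫⁻ s in Ioo 0 u, (star f s * ENNReal.ofReal (b₁ s)) ^ p) ^ (1 / p) < ∞ :=
    ENNReal.rpow_lt_top_of_nonneg (by positivity) hI.ne
  refine (iInf_le_of_le (f - k) (iInf_le_of_le k (iInf_le_of_le (hN0.trans_lt hI')
    (iInf_le_of_le (hN1.trans_lt hM) (iInf_le_of_le (sub_add_cancel f k).symm le_rfl))))).trans ?_
  gcongr

end KFunctional

/-! ### Equivalence of the gaussible and the K-functional inequalities. -/

section GaussibleK

variable {R S : Type*} [MeasurableSpace R] [MeasurableSpace S] {μ : Measure R} {ν : Measure S}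
variable {p : ℝ} {b₁ b₂ : ℝ → ℝ}

theorem mul_ofReal_rpow (hp : 0 < p) (x : ℝ≥0∞) {y : ℝ} (hy : 0 ≤ y) :
    (x * ENNReal.ofReal y) ^ p = x ^ p * ENNReal.ofReal (y ^ p) := by
  rw [ENNReal.mul_rpow_of_nonneg _ _ hp.le, ENNReal.ofReal_rpow_of_nonneg hy hp.le]

theorem rpow_inv_rpow_cancel (hp : 0 < p) (x : ℝ≥0∞) : (x ^ (1 / p)) ^ p = x := by
  rw [← ENNReal.rpow_mul, one_div_mul_cancel hp.ne', ENNReal.rpow_one]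

theorem rpow_rpow_inv_cancel (hp : 0 < p) (x : ℝ≥0∞) : (x ^ p) ^ (1 / p) = x := by
  rw [← ENNReal.rpow_mul, mul_one_div_cancel hp.ne', ENNReal.rpow_one]

theorem ofReal_mul_le_setLIntegral {F : ℝ → ℝ≥0∞} (hF : Antitone F) (r : ℝ) :
    ENNReal.ofReal r * F r ≤ ∫⁻ s in Ioo 0 r, F s := by
  calc ENNReal.ofReal r * F r = ∫⁻ s in Ioo 0 r, F r := by simp [mul_comm]
    _ ≤ _ := setLIntegral_mono' measurableSet_Ioo fun s hs => hF hs.2.le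

/-- The averages over (0, r) of a nonincreasing function decrease with r; the statement avoids
division. -/
theorem ofReal_mul_setLIntegral_le {F : ℝ → ℝ≥0∞} (hF : Antitone F) {q r : ℝ} (hq : 0 < q)
    (hqr : q ≤ r) :
    ENNReal.ofReal q * ∫⁻ s in Ioo 0 r, F s ≤ ENNReal.ofReal r * ∫⁻ s in Ioo 0 q, F s := by
  set J := ∫⁻ s in Ioo 0 q, F s
  have h1 : ∫⁻ s in Ioo 0 r, F s ≤ J + ENNReal.ofReal (r - q) * F q := by
    calc ∫⁻ s in Ioo 0 r, F s ≤ ∫⁻ s in Ioo 0 q ∪ Ico q r, F s := by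
          refine lintegral_mono_set fun s hs => ?_
          rcases lt_or_ge s q with h | h
          · exact Or.inl ⟨hs.1, h⟩
          · exact Or.inr ⟨h, hs.2⟩
      _ ≤ J + ∫⁻ s in Ico q r, F s := lintegral_union_le _ _ _
      _ ≤ J + ∫⁻ s in Ico q r, F q := by
          gcongr 1
          exact setLIntegral_mono' measurableSet_Ico fun s hs => hF hs.1
      _ = _ := by simp [mul_comm]
  calc ENNReal.ofReal q * ∫⁻ s in Ioo 0 r, F s
      ≤ ENNReal.ofReal q * (J + ENNReal.ofReal (r - q) * F q) := by gcongr
    _ = ENNReal.ofReal q * J + ENNReal.ofReal (r - q) * (ENNReal.ofReal q * F q) := by ring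
    _ ≤ ENNReal.ofReal q * J + ENNReal.ofReal (r - q) * J := by
        gcongr
        exact ofReal_mul_le_setLIntegral hF q
    _ = _ := by
        rw [← add_mul, ← ENNReal.ofReal_add hq.le (by linarith), add_sub_cancel]

theorem antitone_star_rpow (hp : 0 < p) (f : R →ₘ[μ] ℂ) : Antitone fun s => star f s ^ p :=
  fun _ _ hst => ENNReal.rpow_le_rpow (antitone_star f hst) hp.le

theorem lintegral_gaussible_rhs (hp : 0 < p) (hb : ClassB p b₁ b₂) (f : R →ₘ[μ] ℂ) {t : ℝ}
    (ht : t ∈ Ioo (0 : ℝ) 1) :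
    ∫⁻ s in Ioo 0 t, (star f (sigmaInv p b₁ b₂ (s ^ (1 / p)) ^ p) *
        ENNReal.ofReal (b₁ s * (b₂ s)⁻¹)) ^ p =
      ENNReal.ofReal (mass p b₁ b₂) * ∫⁻ r in Ioo 0 (phi p b₁ b₂ t), star f r ^ p := by
  rw [← hb.setLIntegral_comp_phi hp (F := fun r => star f r ^ p)
    ((measurable_star f).pow_const p) ht]
  refine setLIntegral_congr_fun measurableSet_Ioo fun s hs => ?_
  have hs' : s ∈ Ioo (0 : ℝ) 1 := ⟨hs.1, hs.2.trans ht.2⟩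
  have h1 := hb.slow₁.pos s hs'
  have h2 := hb.slow₂.pos s hs'
  rw [mul_ofReal_rpow hp _ (by positivity)]
  rfl

theorem Kfun_eLpNorm [IsProbabilityMeasure μ] (hp : 0 < p) (f : R →ₘ[μ] ℂ) (t : ℝ) :
    Kfun (fun g : R →ₘ[μ] ℂ => eLpNorm g (ENNReal.ofReal p) μ) (fun g => eLpNorm g ∞ μ) f t =
      Kfun (karamata (ENNReal.ofReal p) fun _ => 1) (karamata ∞ fun _ => 1) f t := by
  simp only [eLpNorm_eq_karamata hp, eLpNorm_top_eq_karamata]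

theorem lintegral_enorm_rpow_lt_top [IsProbabilityMeasure μ] (hp : 0 < p)
    (f : Lp ℂ (ENNReal.ofReal p) μ) : ∫⁻ x, ‖(f : R →ₘ[μ] ℂ) x‖ₑ ^ p ∂μ < ∞ := by
  have := Lp.eLpNorm_lt_top f
  rw [eLpNorm_eq_lintegral_rpow_enorm_toReal (ENNReal.ofReal_pos.2 hp).ne'
    ENNReal.ofReal_ne_top, ENNReal.toReal_ofReal hp.le] at this
  exact (ENNReal.rpow_lt_top_iff_of_pos (by positivity)).1 this

theorem setLIntegral_star_rpow_lt_top [IsProbabilityMeasure μ] (hp : 0 < p)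
    (f : Lp ℂ (ENNReal.ofReal p) μ) {u : ℝ} (hu : u ≤ 1) :
    ∫⁻ s in Ioo 0 u, star (f : R →ₘ[μ] ℂ) s ^ p < ∞ := by
  refine lt_of_le_of_lt (lintegral_mono_set (Ioo_subset_Ioo_right hu)) ?_
  rw [lintegral_star_rpow]
  exact lintegral_enorm_rpow_lt_top hp f

theorem Kfun_Lp_le [IsProbabilityMeasure μ] (hp : 0 < p) (f : Lp ℂ (ENNReal.ofReal p) μ) {t : ℝ}
    (ht : t ∈ Ioo (0 : ℝ) 1) :
    Kfun (karamata (ENNReal.ofReal p) fun _ => 1) (karamata ∞ fun _ => 1) (f : R →ₘ[μ] ℂ) t ≤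
      2 * (∫⁻ s in Ioo 0 (t ^ p), star (f : R →ₘ[μ] ℂ) s ^ p) ^ (1 / p) := by
  have hu : t ^ p ∈ Ioo (0 : ℝ) 1 :=
    ⟨Real.rpow_pos_of_pos ht.1 _, Real.rpow_lt_one ht.1.le ht.2 hp⟩
  have hI := setLIntegral_star_rpow_lt_top hp f hu.2.le
  have h := Kfun_le (b₁ := fun _ => 1) (b₂ := fun _ => 1) hp (fun _ _ _ _ _ => le_rfl)
    (f := (f : R →ₘ[μ] ℂ)) (t := t) hu (by simpa using hI) (star_lt_top _ hu.1)
    (fun s _ hus => by simpa using antitone_star (f : R →ₘ[μ] ℂ) hus)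
  simp only [ENNReal.ofReal_one, mul_one] at h
  refine h.trans ?_
  rw [two_mul]
  gcongr 1
  calc ENNReal.ofReal t * star (f : R →ₘ[μ] ℂ) (t ^ p)
      = (ENNReal.ofReal (t ^ p) * star (f : R →ₘ[μ] ℂ) (t ^ p) ^ p) ^ (1 / p) := by
        rw [← ENNReal.ofReal_rpow_of_nonneg ht.1.le hp.le, ← ENNReal.mul_rpow_of_nonneg _ _ hp.le,
          rpow_rpow_inv_cancel hp]
    _ ≤ _ := by
        refine ENNReal.rpow_le_rpow ?_ (by positivity)
        exact ofReal_mul_le_setLIntegral (antitone_star_rpow hp _) (t ^ p)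

theorem exists_star_le_Kfun_Lp (hp : 0 < p) :
    ∃ c : ℝ≥0, ∀ f : R →ₘ[μ] ℂ, ∀ t ∈ Ioo (0 : ℝ) 1,
      ∫⁻ s in Ioo 0 (t ^ p), star f s ^ p ≤
        (c * Kfun (karamata (ENNReal.ofReal p) fun _ => 1) (karamata ∞ fun _ => 1) f t) ^ p := by
  obtain ⟨c, hc⟩ := setLIntegral_star_le_Kfun (μ := μ) (b₁ := fun _ => 1) (b₂ := fun _ => 1) hp
    (fun _ _ _ _ _ => le_rfl) (fun _ _ => one_pos) aemeasurable_const 1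
  refine ⟨c, fun f t ht => ?_⟩
  have hu : t ^ p ∈ Ioo (0 : ℝ) 1 :=
    ⟨Real.rpow_pos_of_pos ht.1 _, Real.rpow_lt_one ht.1.le ht.2 hp⟩
  have := hc f (t ^ p) hu t (by
    simp [ENNReal.ofReal_rpow_of_nonneg ht.1.le hp.le])
  simpa using this

/-- Decompose Tf at u = ψ(t^p), so that φ(u) = t^p. The integral part is the gaussible inequality at
u. For the supremum part, φ(s) ≲ s w(s) bounds φ(s)(b₂(s)(Tf)*(s))^p by ∫_0^s ((Tf)* b₁)^p, hence by
∫_0^{φ(s)} (f*)^p. Decreasing averages replace φ(s) by t^p. -/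
theorem IsGaussible.kInequality [IsProbabilityMeasure μ] [IsProbabilityMeasure ν] (hp : 0 < p)
    (hb : ClassB p b₁ b₂) {T : Lp ℂ (ENNReal.ofReal p) μ → (S →ₘ[ν] ℂ)}
    (hT : IsGaussible p b₁ b₂ T) : KInequality p b₁ b₂ T := by
  obtain ⟨C, hC⟩ := hT
  obtain ⟨c, hc⟩ := exists_star_le_Kfun_Lp (μ := μ) hp
  obtain ⟨L, hL, hphi⟩ := hb.phi_le_mul_weight hp
  set D : ℝ≥0 := C * (mass p b₁ b₂).toNNReal with hD
  set E : ℝ≥0 := L.toNNReal * D with hE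
  refine ⟨(D ^ (1 / p) + E ^ (1 / p)) * c, fun f t ht => ?_⟩
  rw [Kfun_eLpNorm hp]
  set f' : R →ₘ[μ] ℂ := f.1
  have htp : t ^ p ∈ Ioo (0 : ℝ) 1 :=
    ⟨Real.rpow_pos_of_pos ht.1 _, Real.rpow_lt_one ht.1.le ht.2 hp⟩
  have hu := hb.psi_mem hp htp
  have hφu := hb.phi_psi hp (Ioo_subset_Icc_self htp)
  set u := psi p b₁ b₂ (t ^ p)
  have hG : ∀ s ∈ Ioo (0 : ℝ) 1, ∫⁻ r in Ioo 0 s, (star (T f) r * ENNReal.ofReal (b₁ r)) ^ p ≤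
      D * ∫⁻ r in Ioo 0 (phi p b₁ b₂ s), star f' r ^ p := fun s hs => by
    refine (hC f s hs).trans_eq ?_
    rw [lintegral_gaussible_rhs hp hb _ hs, ← mul_assoc, hD, ENNReal.coe_mul]
    rfl
  set J := ∫⁻ r in Ioo 0 (t ^ p), star f' r ^ p
  have hJ : J < ∞ := setLIntegral_star_rpow_lt_top hp f htp.2.le
  have htp0 : ENNReal.ofReal (t ^ p) ≠ 0 := (ENNReal.ofReal_pos.2 htp.1).ne'
  have hI := hG u hu
  rw [hφu] at hI
  -- Chosen so that multiplying by t gives exactly (E J)^{1/p}.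
  set M : ℝ≥0∞ := (E * J / ENNReal.ofReal (t ^ p)) ^ (1 / p)
  have hM : M < ∞ := ENNReal.rpow_lt_top_of_nonneg (by positivity)
    (ENNReal.div_lt_top (ENNReal.mul_lt_top ENNReal.coe_lt_top hJ).ne htp0).ne
  have hbound : ∀ s ∈ Ioo (0 : ℝ) 1, u ≤ s → ENNReal.ofReal (b₂ s) * star (T f) s ≤ M := by
    intro s hs hus
    have h1 := hb.slow₁.pos s hs
    have h2 := hb.slow₂.pos s hs
    have hφs := hb.phi_mem hp hs
    have hle : t ^ p ≤ phi p b₁ b₂ s := by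
      rw [← hφu]
      exact (hb.strictMonoOn_phi hp).monotoneOn (Ioo_subset_Icc_self hu) (Ioo_subset_Icc_self hs)
        hus
    set X := ENNReal.ofReal (b₂ s) * star (T f) s with hXdef
    have hX : X ^ p = star (T f) s ^ p * ENNReal.ofReal (b₂ s ^ p) := by
      rw [hXdef, mul_comm, mul_ofReal_rpow hp _ h2.le]
    have e1 : ENNReal.ofReal (phi p b₁ b₂ s) * X ^ p ≤
        L.toNNReal * ∫⁻ r in Ioo 0 s, (star (T f) r * ENNReal.ofReal (b₁ r)) ^ p := by
      calc ENNReal.ofReal (phi p b₁ b₂ s) * X ^ p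
          ≤ ENNReal.ofReal (L * (s * weight p b₁ b₂ s)) * X ^ p := by
            gcongr
            exact hphi s hs
        _ = ENNReal.ofReal L * ∫⁻ r in Ioo 0 s, (star (T f) s * ENNReal.ofReal (b₁ s)) ^ p := by
            rw [lintegral_const, Measure.restrict_apply MeasurableSet.univ, univ_inter,
              Real.volume_Ioo, sub_zero, ENNReal.ofReal_mul hL.le, ENNReal.ofReal_mul hs.1.le,
              hb.weight_eq hs, mul_ofReal_rpow hp _ h1.le, hX]
            have e : ENNReal.ofReal (b₁ s ^ p / b₂ s ^ p) * ENNReal.ofReal (b₂ s ^ p) =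
                ENNReal.ofReal (b₁ s ^ p) := by
              rw [← ENNReal.ofReal_mul (by positivity)]
              congr 1
              field_simp
            rw [← e]
            ring
        _ ≤ _ := by
            refine mul_le_mul' le_rfl ?_
            refine setLIntegral_mono_ae' measurableSet_Ioo (ae_of_all _ fun r hr => ?_)
            refine ENNReal.rpow_le_rpow ?_ hp.le
            gcongr
            · exact antitone_star _ hr.2.le
            · exact hb.anti₁ ⟨hr.1, hr.2.trans hs.2⟩ hs hr.2.le
    have e2 := ofReal_mul_setLIntegral_le (antitone_star_rpow hp f') htp.1 hle
    have hφ0 : ENNReal.ofReal (phi p b₁ b₂ s) ≠ 0 := (ENNReal.ofReal_pos.2 hφs.1).ne'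
    have e3 : ENNReal.ofReal (t ^ p) * X ^ p ≤ E * J := by
      refine (ENNReal.mul_le_mul_iff_right hφ0 ENNReal.ofReal_ne_top).1 ?_
      calc ENNReal.ofReal (phi p b₁ b₂ s) * (ENNReal.ofReal (t ^ p) * X ^ p)
          = ENNReal.ofReal (t ^ p) * (ENNReal.ofReal (phi p b₁ b₂ s) * X ^ p) := by ring
        _ ≤ ENNReal.ofReal (t ^ p) * (L.toNNReal * (D *
              ∫⁻ r in Ioo 0 (phi p b₁ b₂ s), star f' r ^ p)) := by
            exact mul_le_mul' le_rfl (e1.trans (mul_le_mul' le_rfl (hG s hs)))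
        _ = E * (ENNReal.ofReal (t ^ p) * ∫⁻ r in Ioo 0 (phi p b₁ b₂ s), star f' r ^ p) := by
            rw [hE, ENNReal.coe_mul L.toNNReal D]
            ring
        _ ≤ E * (ENNReal.ofReal (phi p b₁ b₂ s) * J) := by gcongr
        _ = _ := by ring
    rw [← rpow_rpow_inv_cancel hp X]
    refine ENNReal.rpow_le_rpow ?_ (by positivity)
    rw [ENNReal.le_div_iff_mul_le (Or.inl htp0) (Or.inl ENNReal.ofReal_ne_top), mul_comm]
    exact e3
  have hfin : ∫⁻ r in Ioo 0 u, (star (T f) r * ENNReal.ofReal (b₁ r)) ^ p < ∞ :=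
    hI.trans_lt (ENNReal.mul_lt_top ENNReal.coe_lt_top hJ)
  have hJK : J ^ (1 / p) ≤
      c * Kfun (karamata (ENNReal.ofReal p) fun _ => 1) (karamata ∞ fun _ => 1) f' t := by
    rw [← rpow_rpow_inv_cancel hp (c * _)]
    exact ENNReal.rpow_le_rpow (hc f' t ht) (by positivity)
  refine (Kfun_le hp hb.mono₂ hu hfin hM hbound (t := t)).trans ?_
  have hp' : 0 ≤ 1 / p := by positivity
  calc (∫⁻ r in Ioo 0 u, (star (T f) r * ENNReal.ofReal (b₁ r)) ^ p) ^ (1 / p) +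
        ENNReal.ofReal t * M
      ≤ (D * J) ^ (1 / p) + (E * J) ^ (1 / p) := by
        refine add_le_add (ENNReal.rpow_le_rpow hI hp') (le_of_eq ?_)
        have et : ENNReal.ofReal t = ENNReal.ofReal (t ^ p) ^ (1 / p) := by
          rw [← ENNReal.ofReal_rpow_of_nonneg ht.1.le hp.le, rpow_rpow_inv_cancel hp]
        rw [et, ← ENNReal.mul_rpow_of_nonneg _ _ hp',
          ENNReal.mul_div_cancel htp0 ENNReal.ofReal_ne_top]
    _ = ((D ^ (1 / p) + E ^ (1 / p) : ℝ≥0) : ℝ≥0∞) * J ^ (1 / p) := by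
        rw [ENNReal.mul_rpow_of_nonneg _ _ hp', ENNReal.mul_rpow_of_nonneg _ _ hp',
          ENNReal.coe_add, ENNReal.coe_rpow_of_nonneg _ hp', ENNReal.coe_rpow_of_nonneg _ hp',
          add_mul]
    _ ≤ _ := by
        rw [ENNReal.coe_mul, mul_assoc]
        gcongr

theorem KInequality.isGaussible [IsProbabilityMeasure μ] (hp : 0 < p)
    (hb : ClassB p b₁ b₂) {T : Lp ℂ (ENNReal.ofReal p) μ → (S →ₘ[ν] ℂ)}
    (hT : KInequality p b₁ b₂ T) : IsGaussible p b₁ b₂ T := by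
  obtain ⟨C, hC⟩ := hT
  have hm := hb.mass_pos hp
  obtain ⟨c, hc⟩ := setLIntegral_star_le_Kfun (μ := ν) hp hb.anti₁ hb.slow₂.pos hb.aemeasurable₂
    (mass p b₁ b₂).toNNReal
  refine ⟨(c * (C * 2)) ^ p * (mass p b₁ b₂).toNNReal⁻¹, fun f s hs => ?_⟩
  set f' : R →ₘ[μ] ℂ := f.1
  have hφ := hb.phi_mem hp hs
  -- With this t, the integral of (b₁/b₂)^p over (0, s) equals the total mass times t^p, so the
  -- lower K-estimate applies with A equal to the mass.
  set t := phi p b₁ b₂ s ^ (1 / p)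
  have ht : t ∈ Ioo (0 : ℝ) 1 := ⟨Real.rpow_pos_of_pos hφ.1 _,
    Real.rpow_lt_one hφ.1.le hφ.2 (by positivity)⟩
  have htp : t ^ p = phi p b₁ b₂ s := rpow_one_div_rpow hp hφ.1.le
  have h1 := hc (T f) s hs t (by
    rw [ENNReal.ofReal_rpow_of_nonneg ht.1.le hp.le, htp]
    refine le_of_eq (Eq.trans ?_ (hb.ofReal_phi hp (Ioo_subset_Icc_self hs)).symm)
    refine setLIntegral_congr_fun measurableSet_Ioo fun r hr => ?_
    have hr' : r ∈ Ioo (0 : ℝ) 1 := ⟨hr.1, hr.2.trans hs.2⟩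
    have q₁ := hb.slow₁.pos r hr'
    have q₂ := hb.slow₂.pos r hr'
    exact ENNReal.ofReal_rpow_of_nonneg (by positivity) hp.le)
  have h2 := hC f t ht
  rw [Kfun_eLpNorm hp] at h2
  have h3 := Kfun_Lp_le hp f ht
  rw [htp] at h3
  rw [lintegral_gaussible_rhs hp hb _ hs]
  set J := ∫⁻ r in Ioo 0 (phi p b₁ b₂ s), star f' r ^ p
  have hm0 : (mass p b₁ b₂).toNNReal ≠ 0 := (Real.toNNReal_pos.2 hm).ne'
  calc ∫⁻ r in Ioo 0 s, (star (T f) r * ENNReal.ofReal (b₁ r)) ^ p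
      ≤ (c * (C * (2 * J ^ (1 / p)))) ^ p := by
        refine h1.trans (ENNReal.rpow_le_rpow ?_ hp.le)
        gcongr
        refine h2.trans ?_
        gcongr
    _ = (((c * (C * 2) : ℝ≥0) : ℝ≥0∞) * J ^ (1 / p)) ^ p := by
        push_cast
        ring_nf
    _ = ((c * (C * 2) : ℝ≥0) : ℝ≥0∞) ^ p * J := by
        rw [ENNReal.mul_rpow_of_nonneg _ _ hp.le, rpow_inv_rpow_cancel hp]
    _ = ((c * (C * 2) : ℝ≥0) : ℝ≥0∞) ^ p *
          (((mass p b₁ b₂).toNNReal⁻¹ * (mass p b₁ b₂).toNNReal : ℝ≥0) : ℝ≥0∞) * J := by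
        rw [inv_mul_cancel₀ hm0, ENNReal.coe_one, mul_one]
    _ = _ := by
        rw [ENNReal.coe_mul ((c * (C * 2)) ^ p), ENNReal.coe_mul (mass p b₁ b₂).toNNReal⁻¹,
          ENNReal.coe_rpow_of_nonneg _ hp.le]
        change _ = _ * (((mass p b₁ b₂).toNNReal : ℝ≥0∞) * J)
        ring

end GaussibleK

/-! ### From the bound on T in the associate spaces to gaussible operators. -/

section DualToGaussible

variable {R S : Type*} [MeasurableSpace R] [MeasurableSpace S] {μ : Measure R} {ν : Measure S}
variable {p : ℝ} {b₁ b₂ : ℝ → ℝ} {ρX ρY : (ℝ → ℝ≥0∞) → ℝ≥0∞}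

theorem powNorm_rpow (hp : 0 < p) (ρ : (ℝ → ℝ≥0∞) → ℝ≥0∞) (f : ℝ → ℝ≥0∞) :
    powNorm p ρ (fun t => f t ^ p) = ρ f ^ p := by
  simp only [powNorm, rpow_rpow_inv_cancel hp]

theorem antitone_opT (g : ℝ →ₘ[leb01] ℂ) : Antitone (opT p b₁ b₂ g) := fun _ _ hst =>
  biSup_mono fun _ hr => ⟨hst.trans hr.1, hr.2⟩

theorem PConvex.lintegral_enorm_rpow_lt_top [IsProbabilityMeasure μ] (hp : 0 < p)
    (hXp : PConvex p ρX) {f : R →ₘ[μ] ℂ} (hf : spaceNorm ρX f < ∞) :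
    ∫⁻ x, ‖f x‖ₑ ^ p ∂μ < ∞ := by
  rw [← lintegral_star_rpow]
  refine IsRIBanachNorm.lintegral_lt_top hXp ((measurable_star f).pow_const p).aemeasurable ?_
  rw [powNorm_rpow hp]
  exact ENNReal.rpow_lt_top_of_nonneg hp.le hf.ne

/-- A Banach norm dominates L¹, so p-convexity embeds X in L^p. This settles the requirement that
operators be defined on all of X. -/
theorem PConvex.mem_Lp [IsProbabilityMeasure μ] (hp : 0 < p)
    (hXp : PConvex p ρX) {f : R →ₘ[μ] ℂ} (hf : spaceNorm ρX f < ∞) :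
    f ∈ Lp ℂ (ENNReal.ofReal p) μ := by
  rw [Lp.mem_Lp_iff_eLpNorm_lt_top, eLpNorm_eq_lintegral_rpow_enorm_toReal
    (ENNReal.ofReal_pos.2 hp).ne' ENNReal.ofReal_ne_top, ENNReal.toReal_ofReal hp.le]
  exact ENNReal.rpow_lt_top_of_nonneg (by positivity) (hXp.lintegral_enorm_rpow_lt_top hp hf).ne

theorem IsGaussible.boundedOp_of_opT [IsProbabilityMeasure μ] (hp : 0 < p) (hb : ClassB p b₁ b₂)
    (hXp : PConvex p ρX) (hYp : PConvex p ρY)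
    (h : Bounded01 (assoc (powNorm p ρY)) (assoc (powNorm p ρX)) (opT p b₁ b₂))
    {T : Lp ℂ (ENNReal.ofReal p) μ → (S →ₘ[ν] ℂ)} (hT : IsGaussible p b₁ b₂ T) :
    BoundedOp p ρX ρY T := by
  obtain ⟨C, hC⟩ := h
  obtain ⟨D, hD⟩ := hT
  set K : ℝ≥0 := D * (mass p b₁ b₂).toNNReal * C with hK
  refine ⟨K ^ (1 / p), fun f hf => ⟨hXp.mem_Lp hp hf, ?_⟩⟩
  set f' : Lp ℂ (ENNReal.ofReal p) μ := ⟨f, hXp.mem_Lp hp hf⟩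
  set F : ℝ → ℝ≥0∞ := fun t => star f t ^ p
  have hF : Measurable F := (measurable_star f).pow_const p
  have hFN : powNorm p ρX F = spaceNorm ρX f ^ p := powNorm_rpow hp ρX _
  have hFtop : powNorm p ρX F < ∞ := by
    rw [hFN]
    exact ENNReal.rpow_lt_top_of_nonneg hp.le hf.ne
  have key : powNorm p ρY (fun t => star (T f') t ^ p) ≤ K * powNorm p ρX F := by
    refine IsRIBanachNorm.le_of_forall_star hYp ((antitone_star_rpow hp _).antitoneOn _)
      fun g hg => ?_
    have hg' : assoc (powNorm p ρX) (opT p b₁ b₂ g) ≤ C := by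
      refine (hC g (lt_of_le_of_lt hg ENNReal.one_lt_top)).trans ?_
      exact mul_le_of_le_one_right zero_le hg
    -- The least nonincreasing majorant of g*/b₁^p. Its monotonicity permits Hardy's lemma, and at s
    -- it is at most `opT` g evaluated at φ(s).
    set d : ℝ → ℝ≥0∞ := fun t => ⨆ s ∈ Ico t 1, star g s / ENNReal.ofReal (b₁ s ^ p)
    have hd : Antitone d := fun _ _ hst => biSup_mono fun _ hr => ⟨hst.trans hr.1, hr.2⟩
    have hdT : ∀ s ∈ Ioo (0 : ℝ) 1, d s ≤ opT p b₁ b₂ g (phi p b₁ b₂ s) := by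
      intro s hs
      refine iSup₂_le fun r hr => ?_
      have hr' : r ∈ Ioo (0 : ℝ) 1 := ⟨hs.1.trans_le hr.1, hr.2⟩
      have hψ := hb.psi_phi hp (Ioo_subset_Icc_self hr')
      refine le_trans (le_of_eq ?_) (le_iSup₂_of_le (phi p b₁ b₂ r) ⟨?_, (hb.phi_mem hp hr').2⟩
        le_rfl)
      · change _ = star g (psi p b₁ b₂ (phi p b₁ b₂ r)) /
          ENNReal.ofReal (b₁ (psi p b₁ b₂ (phi p b₁ b₂ r)) ^ p)
        rw [hψ]
      · exact (hb.strictMonoOn_phi hp).monotoneOn (Ioo_subset_Icc_self hs)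
          (Ioo_subset_Icc_self hr') hr.1
    have hb₁m := hb.aemeasurable₁.ennreal_ofReal
    calc ∫⁻ t, star (T f') t ^ p * star g t ∂leb01
        ≤ ∫⁻ t, (star (T f') t * ENNReal.ofReal (b₁ t)) ^ p * d t ∂leb01 := by
          refine lintegral_mono_ae ?_
          filter_upwards [ae_restrict_mem measurableSet_Ioo] with t ht
          have h1 := hb.slow₁.pos t ht
          have h1p : 0 < b₁ t ^ p := Real.rpow_pos_of_pos h1 p
          rw [mul_ofReal_rpow hp _ h1.le, mul_assoc]
          gcongr
          calc star g t = ENNReal.ofReal (b₁ t ^ p) * (star g t / ENNReal.ofReal (b₁ t ^ p)) :=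
                (ENNReal.mul_div_cancel (ENNReal.ofReal_pos.2 h1p).ne' ENNReal.ofReal_ne_top).symm
            _ ≤ _ := by
                gcongr
                exact le_iSup₂_of_le t ⟨le_rfl, ht.2⟩ le_rfl
      _ ≤ D * ∫⁻ t, (star f (phi p b₁ b₂ t) * ENNReal.ofReal (b₁ t * (b₂ t)⁻¹)) ^ p * d t
            ∂leb01 := by
          refine lintegral_mul_le_of_antitoneOn
            (((measurable_star _).aemeasurable.mul hb₁m).pow_const p) ?_ (hd.antitoneOn _)
            (hD f')
          exact (((measurable_star f).comp_aemeasurable (hb.aemeasurable_phi hp)).mul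
            (hb.aemeasurable₁.mul hb.aemeasurable₂.inv).ennreal_ofReal).pow_const p
      _ ≤ D * ∫⁻ t, (F (phi p b₁ b₂ t) * opT p b₁ b₂ g (phi p b₁ b₂ t)) *
            ENNReal.ofReal (weight p b₁ b₂ t) ∂leb01 := by
          refine mul_le_mul' le_rfl (lintegral_mono_ae ?_)
          filter_upwards [ae_restrict_mem measurableSet_Ioo] with t ht
          have h1 := hb.slow₁.pos t ht
          have h2 := hb.slow₂.pos t ht
          rw [mul_ofReal_rpow hp _ (by positivity), mul_right_comm]
          refine mul_le_mul' (mul_le_mul' le_rfl (hdT t ht)) le_rfl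
      _ = D * (ENNReal.ofReal (mass p b₁ b₂) * ∫⁻ r, F r * opT p b₁ b₂ g r ∂leb01) := by
          rw [hb.lintegral_comp_phi hp (F := fun r => F r * opT p b₁ b₂ g r)
            (hF.mul (antitone_opT g).measurable)]
      _ ≤ D * (ENNReal.ofReal (mass p b₁ b₂) * (C * powNorm p ρX F)) := by
          refine mul_le_mul' le_rfl (mul_le_mul' le_rfl ?_)
          simp only [mul_comm (F _)]
          refine (IsRIQuasiNorm.lintegral_mul_le hXp.toIsRIQuasiNorm _ hF.aemeasurable
            hFtop).trans ?_
          gcongr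
      _ = _ := by
          rw [hK, ENNReal.coe_mul _ C, ENNReal.coe_mul D]
          change _ = (D : ℝ≥0∞) * ENNReal.ofReal (mass p b₁ b₂) * C * _
          ring
  rw [powNorm_rpow hp, hFN] at key
  have := ENNReal.rpow_le_rpow key (show 0 ≤ 1 / p by positivity)
  rw [rpow_rpow_inv_cancel hp, ENNReal.mul_rpow_of_nonneg _ _ (by positivity),
    rpow_rpow_inv_cancel hp, ← ENNReal.coe_rpow_of_nonneg _ (by positivity)] at this
  exact this

end DualToGaussible

/-! ### From gaussible operators to the operators U and S. -/

section GaussibleToConcrete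

variable {R S : Type*} [MeasurableSpace R] [MeasurableSpace S] {μ : Measure R} {ν : Measure S}
variable {p : ℝ} {b₁ b₂ : ℝ → ℝ} {ρX ρY : (ℝ → ℝ≥0∞) → ℝ≥0∞}

theorem star_zero : star (0 : R →ₘ[μ] ℂ) = fun _ => 0 := by
  funext t
  refine le_antisymm (rearr_le_iff.2 ?_) zero_le
  have : μ {x | (0 : ℝ≥0∞) < ‖(0 : R →ₘ[μ] ℂ) x‖ₑ} = 0 := by
    refine measure_eq_zero_iff_ae_notMem.2 ?_
    filter_upwards [AEEqFun.coeFn_zero (μ := μ) (β := ℂ)] with x hx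
    simp [hx]
  rw [this]
  exact zero_le

theorem star_compMeasurePreserving {U : R → ℝ} (hU : MeasurePreserving U μ leb01)
    (h : ℝ →ₘ[leb01] ℂ) : star (h.compMeasurePreserving U hU) = star h := by
  have e : star (h.compMeasurePreserving U hU) = rearr μ fun x => ‖h (U x)‖ₑ := by
    refine rearr_congr_ae ?_
    filter_upwards [AEEqFun.coeFn_compMeasurePreserving h hU] with x hx
    rw [hx]
    rfl
  rw [e]
  exact rearr_comp (aemeasurable_enorm_coe h) hU

theorem compMeasurePreserving_injective {U : R → ℝ} (hU : MeasurePreserving U μ leb01) :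
    Function.Injective fun h : ℝ →ₘ[leb01] ℂ => h.compMeasurePreserving U hU := by
  intro h k hhk
  have h1 := (AEEqFun.coeFn_compMeasurePreserving h hU).symm.trans
    ((AEEqFun.ext_iff.1 hhk).trans (AEEqFun.coeFn_compMeasurePreserving k hU))
  refine AEEqFun.ext ?_
  have hs : NullMeasurableSet {x | h x = k x} leb01 :=
    nullMeasurableSet_eq_fun h.aestronglyMeasurable.aemeasurable
      k.aestronglyMeasurable.aemeasurable
  have h2 : leb01 {x | h x = k x}ᶜ = 0 := by
    rw [← hU.measure_preimage hs.compl]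
    exact h1
  exact h2

/-- If all gaussible operators are bounded, so is every operator on `(0,1)` with nonincreasing
values which satisfies a gaussible estimate. -/
theorem bounded01_of_forall_isGaussible [IsProbabilityMeasure μ] [IsProbabilityMeasure ν]
    (hμ : Nonatomic μ) (hν : Nonatomic ν) (hp : 0 < p) (hb : ClassB p b₁ b₂)
    (hY : IsRIQuasiNorm ρY) (hXp : PConvex p ρX)
    (H : ∀ T : Lp ℂ (ENNReal.ofReal p) μ → (S →ₘ[ν] ℂ), IsGaussible p b₁ b₂ T →
      BoundedOp p ρX ρY T)
    {A : (ℝ →ₘ[leb01] ℂ) → ℝ → ℝ≥0∞} (hanti : ∀ h, AntitoneOn (A h) (Ioo 0 1))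
    (hfin : ∀ h : ℝ →ₘ[leb01] ℂ, ∫⁻ x, ‖h x‖ₑ ^ p ∂leb01 < ∞ → ∀ t ∈ Ioo (0 : ℝ) 1, A h t < ∞)
    {C : ℝ≥0} (hA : ∀ h : ℝ →ₘ[leb01] ℂ, ∀ t ∈ Ioo (0 : ℝ) 1,
      ∫⁻ s in Ioo 0 t, (A h s * ENNReal.ofReal (b₁ s)) ^ p ≤
        C * ∫⁻ s in Ioo 0 (phi p b₁ b₂ t), star h s ^ p) :
    Bounded01 ρX ρY A := by
  obtain ⟨U, hU⟩ := hμ.exists_measurePreserving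
  obtain ⟨V, hV⟩ := hν.exists_measurePreserving
  have hAm : ∀ h, AEMeasurable (A h) leb01 := fun h =>
    aemeasurable_restrict_of_antitoneOn measurableSet_Ioo (hanti h)
  have hAV : ∀ h, AEStronglyMeasurable (fun y => ((A h (V y)).toReal : ℂ)) ν := fun h =>
    (Complex.measurable_ofReal.comp_aemeasurable
      ((hAm h).comp_quasiMeasurePreserving hV.quasiMeasurePreserving).ennreal_toReal
      ).aestronglyMeasurable
  let B : (ℝ →ₘ[leb01] ℂ) → (S →ₘ[ν] ℂ) := fun h => AEEqFun.mk _ (hAV h)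
  have henorm : ∀ x : ℝ≥0∞, x ≠ ∞ → ‖(x.toReal : ℂ)‖ₑ = x := fun x hx => by
    lift x to ℝ≥0 using hx
    simp [enorm_eq_nnnorm]
  have henorm_le : ∀ x : ℝ≥0∞, ‖(x.toReal : ℂ)‖ₑ ≤ x := fun x => by
    rcases eq_or_ne x ∞ with rfl | hx
    · exact le_top
    · exact (henorm x hx).le
  have hstarB : ∀ h, star (B h) = rearr ν fun y => ‖((A h (V y)).toReal : ℂ)‖ₑ := fun h => by
    refine rearr_congr_ae ?_
    filter_upwards [AEEqFun.coeFn_mk _ (hAV h)] with y hy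
    rw [hy]
  -- In general only ≤ holds, because `toReal` sends ∞ to 0; this suffices for the gaussible
  -- estimate. Equality with the rearrangement of A h is needed, and available, when |h|^p is
  -- integrable.
  have hstarB_le : ∀ h, ∀ s ∈ Ioo (0 : ℝ) 1, star (B h) s ≤ A h s := fun h s hs => by
    rw [hstarB]
    refine (rearr_mono (fun y => henorm_le _) s).trans ?_
    rw [rearr_comp (hAm h) hV]
    exact rearr_le_of_antitoneOn (hanti h) hs
  have hstarB_eq : ∀ h : ℝ →ₘ[leb01] ℂ, ∫⁻ x, ‖h x‖ₑ ^ p ∂leb01 < ∞ →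
      star (B h) = rearr leb01 (A h) := fun h hh => by
    rw [hstarB, ← rearr_comp (hAm h) hV]
    refine rearr_congr_ae ?_
    have : ∀ᵐ t ∂leb01, A h t ≠ ∞ := by
      filter_upwards [ae_restrict_mem measurableSet_Ioo] with t ht
      exact (hfin h hh t ht).ne
    filter_upwards [hV.quasiMeasurePreserving.ae this] with y hy
    exact henorm _ hy
  classical
  -- No linearity is required, so T may vanish on every f that does not factor through U. On h ∘ U
  -- it is a copy of A h on S, well determined since composition with U is injective.
  let T : Lp ℂ (ENNReal.ofReal p) μ → (S →ₘ[ν] ℂ) := fun f =>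
    if hf : ∃ h : ℝ →ₘ[leb01] ℂ, h.compMeasurePreserving U hU = f.1 then B hf.choose else 0
  have hm := hb.mass_pos hp
  have hm0 : (mass p b₁ b₂).toNNReal ≠ 0 := (Real.toNNReal_pos.2 hm).ne'
  have hT : IsGaussible p b₁ b₂ T := by
    refine ⟨C * (mass p b₁ b₂).toNNReal⁻¹, fun f t ht => ?_⟩
    rw [lintegral_gaussible_rhs hp hb _ ht]
    by_cases hf : ∃ h : ℝ →ₘ[leb01] ℂ, h.compMeasurePreserving U hU = f.1
    · have e : T f = B hf.choose := dif_pos hf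
      have hs : star hf.choose = star f.1 := by
        have h1 := congrArg star hf.choose_spec
        rwa [star_compMeasurePreserving] at h1
      rw [e, ← hs]
      calc ∫⁻ s in Ioo 0 t, (star (B hf.choose) s * ENNReal.ofReal (b₁ s)) ^ p
          ≤ ∫⁻ s in Ioo 0 t, (A hf.choose s * ENNReal.ofReal (b₁ s)) ^ p := by
            refine setLIntegral_mono_ae' measurableSet_Ioo (ae_of_all _ fun s hst => ?_)
            refine ENNReal.rpow_le_rpow (mul_le_mul' ?_ le_rfl) hp.le
            exact hstarB_le _ s ⟨hst.1, hst.2.trans ht.2⟩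
        _ ≤ C * ∫⁻ s in Ioo 0 (phi p b₁ b₂ t), star hf.choose s ^ p := hA _ t ht
        _ = C * (((mass p b₁ b₂).toNNReal⁻¹ * (mass p b₁ b₂).toNNReal : ℝ≥0) : ℝ≥0∞) *
              ∫⁻ s in Ioo 0 (phi p b₁ b₂ t), star hf.choose s ^ p := by
            rw [inv_mul_cancel₀ hm0, ENNReal.coe_one, mul_one]
        _ = _ := by
            rw [ENNReal.coe_mul C, ENNReal.coe_mul (mass p b₁ b₂).toNNReal⁻¹]
            change _ = _ * (((mass p b₁ b₂).toNNReal : ℝ≥0∞) * _)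
            ring
    · have e : T f = 0 := dif_neg hf
      rw [e, star_zero]
      simp [ENNReal.zero_rpow_of_pos hp]
  obtain ⟨D, hD⟩ := H T hT
  refine ⟨D, fun h hh => ?_⟩
  have hst := star_compMeasurePreserving hU h
  obtain ⟨hf, hle⟩ := hD (h.compMeasurePreserving U hU) (by rwa [spaceNorm, hst])
  have hex : ∃ k : ℝ →ₘ[leb01] ℂ, k.compMeasurePreserving U hU = h.compMeasurePreserving U hU :=
    ⟨h, rfl⟩
  have e : T ⟨h.compMeasurePreserving U hU, hf⟩ = B h := by
    have e1 : T ⟨h.compMeasurePreserving U hU, hf⟩ = B hex.choose := dif_pos hex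
    rw [e1, compMeasurePreserving_injective hU hex.choose_spec]
  rw [e, spaceNorm, spaceNorm, hst, hstarB_eq h (hXp.lintegral_enorm_rpow_lt_top hp hh),
    hY.apply_rearr (hAm h)] at hle
  exact hle

theorem ClassB.antitoneOn_opU (hp : 0 < p) (hb : ClassB p b₁ b₂) (h : ℝ →ₘ[leb01] ℂ) :
    AntitoneOn (opU p b₁ b₂ h) (Ioo 0 1) := by
  intro s hs t ht hst
  refine ENNReal.div_le_div (antitone_star h ?_) (ENNReal.ofReal_le_ofReal (hb.mono₂ hs ht hst))
  exact (hb.strictMonoOn_phi hp).monotoneOn (Ioo_subset_Icc_self hs) (Ioo_subset_Icc_self ht) hst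

theorem antitone_opS (h : ℝ →ₘ[leb01] ℂ) (hp : 0 < p) : Antitone (opS p b₁ h) := fun _ _ hst =>
  ENNReal.rpow_le_rpow (lintegral_mono_set (Ioo_subset_Ioo_left hst)) (by positivity)

theorem bounded01_opU_of_forall_isGaussible [IsProbabilityMeasure μ] [IsProbabilityMeasure ν]
    (hμ : Nonatomic μ) (hν : Nonatomic ν) (hp : 0 < p) (hb : ClassB p b₁ b₂)
    (hY : IsRIQuasiNorm ρY) (hXp : PConvex p ρX)
    (H : ∀ T : Lp ℂ (ENNReal.ofReal p) μ → (S →ₘ[ν] ℂ), IsGaussible p b₁ b₂ T →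
      BoundedOp p ρX ρY T) :
    Bounded01 ρX ρY (opU p b₁ b₂) := by
  refine bounded01_of_forall_isGaussible hμ hν hp hb hY hXp H (C := (mass p b₁ b₂).toNNReal)
    (hb.antitoneOn_opU hp) (fun h _ t ht => ?_) fun h t ht => ?_
  · exact ENNReal.div_lt_top (star_lt_top h (hb.phi_mem hp ht).1).ne
      (ENNReal.ofReal_pos.2 (hb.slow₂.pos t ht)).ne'
  -- The factor b₁ in the gaussible inequality combines with 1/b₂ in U, so the estimate holds with
  -- equality.
  · refine le_of_eq (Eq.trans ?_ (lintegral_gaussible_rhs hp hb h ht))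
    refine setLIntegral_congr_fun measurableSet_Ioo fun s hs => ?_
    have hs' : s ∈ Ioo (0 : ℝ) 1 := ⟨hs.1, hs.2.trans ht.2⟩
    have h1 := hb.slow₁.pos s hs'
    have h2 := hb.slow₂.pos s hs'
    dsimp only [opU]
    rw [ENNReal.ofReal_mul h1.le, ENNReal.ofReal_inv_of_pos h2, div_eq_mul_inv]
    congr 1
    ring

theorem lintegral_mul_lintegral_Ioo {B k : ℝ → ℝ≥0∞} (hB : AEMeasurable B leb01)
    (hk : AEMeasurable k leb01) :
    ∫⁻ s, B s * (∫⁻ r in Ioo s 1, k r) ∂leb01 = ∫⁻ r, k r * (∫⁻ s in Ioo 0 r, B s) ∂leb01 := by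
  have hm : AEMeasurable (Function.uncurry fun s r => {q : ℝ × ℝ | q.1 < q.2}.indicator
      (fun q => B q.1 * k q.2) (s, r)) (leb01.prod leb01) :=
    ((hB.comp_fst).mul hk.comp_snd).indicator (measurableSet_lt measurable_fst measurable_snd)
  have hswap := lintegral_lintegral_swap hm
  calc ∫⁻ s, B s * (∫⁻ r in Ioo s 1, k r) ∂leb01
      = ∫⁻ s, ∫⁻ r, {q : ℝ × ℝ | q.1 < q.2}.indicator (fun q => B q.1 * k q.2) (s, r)
          ∂leb01 ∂leb01 := by
        refine lintegral_congr_ae ?_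
        filter_upwards [ae_restrict_mem measurableSet_Ioo] with s hs
        have e : ∀ r, {q : ℝ × ℝ | q.1 < q.2}.indicator (fun q => B q.1 * k q.2) (s, r) =
            (Ioi s).indicator (fun r => B s * k r) r := fun r => rfl
        simp only [e]
        rw [lintegral_indicator measurableSet_Ioi, Measure.restrict_restrict measurableSet_Ioi]
        have e2 : Ioi s ∩ Ioo 0 1 = Ioo s 1 := by
          ext r
          exact ⟨fun h => ⟨h.1, h.2.2⟩, fun h => ⟨h.1, hs.1.trans h.1, h.2⟩⟩
        rw [e2, lintegral_const_mul'']
        exact hk.mono_measure (Measure.restrict_mono (Ioo_subset_Ioo_left hs.1.le) le_rfl)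
    _ = ∫⁻ r, ∫⁻ s, {q : ℝ × ℝ | q.1 < q.2}.indicator (fun q => B q.1 * k q.2) (s, r)
          ∂leb01 ∂leb01 := hswap
    _ = _ := by
        refine lintegral_congr_ae ?_
        filter_upwards [ae_restrict_mem measurableSet_Ioo] with r hr
        have e : ∀ s, {q : ℝ × ℝ | q.1 < q.2}.indicator (fun q => B q.1 * k q.2) (s, r) =
            (Iio r).indicator (fun s => k r * B s) s := fun s => by
          simp only [indicator, mem_ofPred_eq, mem_Iio, mul_comm]
        simp only [e]
        rw [lintegral_indicator measurableSet_Iio, Measure.restrict_restrict measurableSet_Iio]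
        have e2 : Iio r ∩ Ioo 0 1 = Ioo 0 r := by
          ext s
          exact ⟨fun h => ⟨h.2.1, h.1⟩, fun h => ⟨h.2, h.1, h.2.trans hr.2⟩⟩
        rw [e2, lintegral_const_mul'']
        exact hB.mono_measure (Measure.restrict_mono (Ioo_subset_Ioo_right hr.2.le) le_rfl)

theorem ClassB.aemeasurable_kernel (hb : ClassB p b₁ b₂) (h : ℝ →ₘ[leb01] ℂ) :
    AEMeasurable (fun r => ‖h r‖ₑ ^ p / ENNReal.ofReal (r * b₁ r ^ p)) leb01 :=
  ((aemeasurable_enorm_coe h).pow_const p).div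
    (aemeasurable_id.mul (hb.aemeasurable₁.pow_const p)).ennreal_ofReal

theorem opS_rpow (hp : 0 < p) (h : ℝ →ₘ[leb01] ℂ) (t : ℝ) :
    opS p b₁ h t ^ p = ∫⁻ s in Ioo t 1, ‖h s‖ₑ ^ p / ENNReal.ofReal (s * b₁ s ^ p) :=
  rpow_inv_rpow_cancel hp _

/-- On (t,1) the kernel 1/(s b₁(s)^p) is bounded, because b₁ stays away from 0. -/
theorem ClassB.opS_lt_top (hp : 0 < p) (hb : ClassB p b₁ b₂) {h : ℝ →ₘ[leb01] ℂ}
    (hh : ∫⁻ x, ‖h x‖ₑ ^ p ∂leb01 < ∞) {t : ℝ} (ht : t ∈ Ioo (0 : ℝ) 1) : opS p b₁ h t < ∞ := by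
  obtain ⟨c, hc, h₁⟩ := hb.slow₁.exists_lower_const hb.anti₁
  have hpos : 0 < t * c ^ p := mul_pos ht.1 (Real.rpow_pos_of_pos hc p)
  refine ENNReal.rpow_lt_top_of_nonneg (by positivity) (ne_of_lt ?_)
  calc ∫⁻ s in Ioo t 1, ‖h s‖ₑ ^ p / ENNReal.ofReal (s * b₁ s ^ p)
      ≤ ∫⁻ s in Ioo t 1, ‖h s‖ₑ ^ p * (ENNReal.ofReal (t * c ^ p))⁻¹ := by
        refine setLIntegral_mono_ae' measurableSet_Ioo (ae_of_all _ fun s hs => ?_)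
        have hs' : s ∈ Ioo (0 : ℝ) 1 := ⟨ht.1.trans hs.1, hs.2⟩
        rw [div_eq_mul_inv]
        gcongr
        · exact hs'.1.le
        · exact hs.1.le
        · exact h₁ s hs'
    _ = (∫⁻ s in Ioo t 1, ‖h s‖ₑ ^ p) * (ENNReal.ofReal (t * c ^ p))⁻¹ :=
        lintegral_mul_const' _ _ (ENNReal.inv_ne_top.2 (ENNReal.ofReal_pos.2 hpos).ne')
    _ < ∞ := ENNReal.mul_lt_top
        (lt_of_le_of_lt (lintegral_mono_set (Ioo_subset_Ioo_left ht.1.le)) hh)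
        (ENNReal.inv_lt_top.2 (ENNReal.ofReal_pos.2 hpos))

/-- By Fubini the left side is ∫ |h(r)|^p (r b₁(r)^p)⁻¹ ∫_0^{min(r,t)} b₁^p dr. The inner integral
is ≲ m b₁(m)^p with m = min(r,t), so |h|^p is integrated against at most an explicit kernel κ. Since
κ is bounded with integral ≲ φ(t), `lintegral_mul_le_rearr` yields ∫_0^{φ(t)} (h*)^p. -/
theorem ClassB.exists_opS_gaussible (hp : 0 < p) (hb : ClassB p b₁ b₂) : ∃ C : ℝ≥0,
    ∀ h : ℝ →ₘ[leb01] ℂ, ∀ t ∈ Ioo (0 : ℝ) 1,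
      ∫⁻ s in Ioo 0 t, (opS p b₁ h s * ENNReal.ofReal (b₁ s)) ^ p ≤
        C * ∫⁻ s in Ioo 0 (phi p b₁ b₂ t), star h s ^ p := by
  obtain ⟨K, hK, hslow⟩ := hb.rpow_le_rpow_half hp
  obtain ⟨D, hD⟩ := hb.bounded
  obtain ⟨c, hc, hcφ⟩ := hb.mul_le_phi hp
  have hm := hb.mass_pos hp
  set L : ℝ≥0 := (2 * K).toNNReal * max 1 K.toNNReal
  set M : ℝ≥0 := (2 * K / c).toNNReal + (2 * K * mass p b₁ b₂).toNNReal * D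
  refine ⟨L + M, fun h t ht => ?_⟩
  have hr : leb01.restrict (Ioo 0 t) = volume.restrict (Ioo 0 t) := by
    rw [Measure.restrict_restrict measurableSet_Ioo,
      inter_eq_left.2 (Ioo_subset_Ioo_right ht.2.le)]
  have hr' : leb01.restrict (Ioo t 1) = volume.restrict (Ioo t 1) := by
    rw [Measure.restrict_restrict measurableSet_Ioo,
      inter_eq_left.2 (Ioo_subset_Ioo_left ht.1.le)]
  set k : ℝ → ℝ≥0∞ := fun r => ‖h r‖ₑ ^ p / ENNReal.ofReal (r * b₁ r ^ p) with hkdef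
  have hk : AEMeasurable k leb01 := hb.aemeasurable_kernel h
  set B : ℝ → ℝ≥0∞ := (Ioo 0 t).indicator fun s => ENNReal.ofReal (b₁ s ^ p)
  have hB : AEMeasurable B leb01 :=
    (hb.aemeasurable₁.pow_const p).ennreal_ofReal.indicator measurableSet_Ioo
  -- Constant on (0,t), since there r b₁(r)^p cancels, and decaying as t b₁(t)^p/(r b₁(r)^p) beyond
  -- t. The constant L bounds κ, and M φ(t) bounds its integral.
  set κ : ℝ → ℝ≥0∞ := fun r => (Ioo 0 t).indicator (fun _ => ENNReal.ofReal (2 * K)) r +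
    (Ico t 1).indicator (fun r => ENNReal.ofReal (2 * K * (t * b₁ t ^ p)) *
      ENNReal.ofReal (1 / (r * b₁ r ^ p))) r with hκdef
  have hinvm : AEMeasurable (fun r => ENNReal.ofReal (1 / (r * b₁ r ^ p))) leb01 :=
    ((aemeasurable_id.mul (hb.aemeasurable₁.pow_const p)).const_div 1).ennreal_ofReal
  have hκm : AEMeasurable κ leb01 :=
    (aemeasurable_const.indicator measurableSet_Ioo).add
      ((hinvm.const_mul _).indicator measurableSet_Ico)
  have hb1t := Real.rpow_pos_of_pos (hb.slow₁.pos t ht) p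
  have hb2t := Real.rpow_pos_of_pos (hb.slow₂.pos t ht) p
  have ht0 := ht.1
  have hprim : ∀ u ∈ Ioo (0 : ℝ) 1, ∫⁻ s in Ioo 0 u, ENNReal.ofReal (b₁ s ^ p) ≤
      ENNReal.ofReal (2 * K * (u * b₁ u ^ p)) := fun u hu =>
    lintegral_le_of_le_rpow_half hu.1 hK.le (Real.rpow_pos_of_pos (hb.slow₁.pos u hu) p).le
      fun s hs => hslow s ⟨hs.1, hs.2.trans hu.2⟩ u hu hs.2.le
  have hκlt : ∀ r ∈ Ioo 0 t, κ r = ENNReal.ofReal (2 * K) := fun r hr => by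
    simp only [hκdef]
    rw [indicator_of_mem hr, indicator_of_notMem (fun h => absurd h.1 (not_le.2 hr.2)), add_zero]
  have hκge : ∀ r ∈ Ico t 1, κ r = ENNReal.ofReal (2 * K * (t * b₁ t ^ p)) *
      ENNReal.ofReal (1 / (r * b₁ r ^ p)) := fun r hr => by
    simp only [hκdef]
    rw [indicator_of_mem hr, indicator_of_notMem (fun h => absurd h.2 (not_lt.2 hr.1)), zero_add]
  have hpoint : ∀ r ∈ Ioo (0 : ℝ) 1, k r * (∫⁻ s in Ioo 0 r, B s) ≤ ‖h r‖ₑ ^ p * κ r := by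
    intro r hr
    have hb1r := Real.rpow_pos_of_pos (hb.slow₁.pos r hr) p
    have hr0 := hr.1
    have hpos : 0 < r * b₁ r ^ p := by positivity
    rw [hkdef]
    simp only
    rw [div_eq_mul_inv, mul_assoc, ← ENNReal.ofReal_inv_of_pos hpos]
    refine mul_le_mul' le_rfl ?_
    rcases lt_or_ge r t with hrt | hrt
    · rw [hκlt r ⟨hr.1, hrt⟩]
      calc _ ≤ ENNReal.ofReal (r * b₁ r ^ p)⁻¹ * ENNReal.ofReal (2 * K * (r * b₁ r ^ p)) := by
            refine mul_le_mul' le_rfl (le_trans (lintegral_mono fun s => ?_) (hprim r hr))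
            exact indicator_le_self _ _ s
        _ = _ := by
            rw [← ENNReal.ofReal_mul (by positivity)]
            congr 1
            field_simp
    · rw [hκge r ⟨hrt, hr.2⟩, mul_comm, one_div]
      refine mul_le_mul' ?_ le_rfl
      calc ∫⁻ s in Ioo 0 r, B s ≤ ∫⁻ s, B s := setLIntegral_le_lintegral _ _
        _ = ∫⁻ s in Ioo 0 t, ENNReal.ofReal (b₁ s ^ p) := lintegral_indicator measurableSet_Ioo _
        _ ≤ _ := hprim t ht
  have hκle : ∀ᵐ r ∂leb01, κ r ≤ L := by
    filter_upwards [ae_restrict_mem measurableSet_Ioo] with r hr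
    rcases lt_or_ge r t with hrt | hrt
    · rw [hκlt r ⟨hr.1, hrt⟩, ENNReal.coe_mul]
      refine le_mul_of_one_le_right zero_le ?_
      exact_mod_cast le_max_left 1 K.toNNReal
    · rw [hκge r ⟨hrt, hr.2⟩, ← ENNReal.ofReal_mul (by positivity), ENNReal.coe_mul]
      have hb1r := Real.rpow_pos_of_pos (hb.slow₁.pos r hr) p
      have hr0 := hr.1
      have hle : t * b₁ t ^ p ≤ K * (r * b₁ r ^ p) := by
        have h1 := hslow t ht r hr hrt
        have h2 : (r / t) ^ (1 / 2 : ℝ) ≤ r / t := by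
          conv_rhs => rw [← Real.rpow_one (r / t)]
          exact Real.rpow_le_rpow_of_exponent_le ((one_le_div ht.1).2 hrt) (by norm_num)
        calc t * b₁ t ^ p ≤ t * (K * (r / t) * b₁ r ^ p) := by
              gcongr
              exact h1.trans (by gcongr)
          _ = _ := by field_simp
      calc ENNReal.ofReal (2 * K * (t * b₁ t ^ p) * (1 / (r * b₁ r ^ p)))
          ≤ ENNReal.ofReal (2 * K * K) := by
            refine ENNReal.ofReal_le_ofReal ?_
            rw [mul_assoc]
            gcongr
            rw [mul_one_div, div_le_iff₀ (by positivity)]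
            exact hle
        _ = ((2 * K).toNNReal : ℝ≥0∞) * (K.toNNReal : ℝ≥0∞) := ENNReal.ofReal_mul (by positivity)
        _ ≤ _ := by
            gcongr
            exact le_max_right _ _
  have hφ := hb.phi_mem hp ht
  have hκint : ∫⁻ r, κ r ∂leb01 ≤ M * ENNReal.ofReal (phi p b₁ b₂ t) := by
    rw [hκdef, lintegral_add_left' (aemeasurable_const.indicator measurableSet_Ioo),
      lintegral_indicator measurableSet_Ioo, lintegral_indicator measurableSet_Ico, hr,
      ENNReal.coe_add, add_mul]
    refine add_le_add ?_ ?_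
    · calc ∫⁻ s in Ioo 0 t, ENNReal.ofReal (2 * K) = ENNReal.ofReal (2 * K * t) := by
            rw [lintegral_const, Measure.restrict_apply MeasurableSet.univ, univ_inter,
              Real.volume_Ioo, sub_zero,
              ← ENNReal.ofReal_mul (show (0 : ℝ) ≤ 2 * K by positivity)]
        _ ≤ ENNReal.ofReal (2 * K / c * phi p b₁ b₂ t) := by
            refine ENNReal.ofReal_le_ofReal ?_
            rw [div_mul_eq_mul_div, le_div_iff₀ hc, mul_assoc, mul_comm t]
            gcongr
            exact hcφ t ht
        _ = _ := ENNReal.ofReal_mul (by positivity)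
    · rw [lintegral_const_mul' _ _ ENNReal.ofReal_ne_top]
      have e1 : ∫⁻ r in Ico t 1, ENNReal.ofReal (1 / (r * b₁ r ^ p)) ∂leb01 =
          ∫⁻ r in Ioo t 1, ENNReal.ofReal (1 / (r * b₁ r ^ p)) := by
        rw [← hr']
        exact (setLIntegral_congr (Ioo_ae_eq_Ico (μ := leb01))).symm
      rw [e1]
      set I := ∫⁻ r in Ioo t 1, ENNReal.ofReal (1 / (r * b₁ r ^ p))
      -- Condition (d): inserting b₂(t)^p turns t b₁(t)^p into t w(t), which is ≲ φ(t).
      have hDt : ENNReal.ofReal (b₂ t ^ p) * I ≤ D := hD t ht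
      calc ENNReal.ofReal (2 * K * (t * b₁ t ^ p)) * I
          = ENNReal.ofReal (2 * K * (t * weight p b₁ b₂ t)) *
              (ENNReal.ofReal (b₂ t ^ p) * I) := by
            rw [← mul_assoc (ENNReal.ofReal (2 * K * (t * weight p b₁ b₂ t))),
              ← ENNReal.ofReal_mul
                (mul_nonneg (by positivity) (mul_nonneg ht0.le (hb.weight_pos ht).le)),
              hb.weight_eq ht]
            congr 2
            field_simp
        _ ≤ ENNReal.ofReal (2 * K * (mass p b₁ b₂ * phi p b₁ b₂ t)) * D := by
            exact mul_le_mul' (ENNReal.ofReal_le_ofReal (mul_le_mul_of_nonneg_left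
              (hb.mul_weight_le_phi hp ht) (by positivity))) hDt
        _ = ENNReal.ofReal (2 * K * mass p b₁ b₂) * ENNReal.ofReal (phi p b₁ b₂ t) * D := by
            rw [← ENNReal.ofReal_mul (by positivity), mul_assoc (2 * K)]
        _ = _ := by
            rw [ENNReal.coe_mul]
            change _ = ENNReal.ofReal (2 * K * mass p b₁ b₂) * D * _
            ring
  calc ∫⁻ s in Ioo 0 t, (opS p b₁ h s * ENNReal.ofReal (b₁ s)) ^ p
      = ∫⁻ s, B s * (∫⁻ r in Ioo s 1, k r) ∂leb01 := by
        rw [← hr, ← lintegral_indicator (μ := leb01) measurableSet_Ioo]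
        refine lintegral_congr fun s => ?_
        dsimp only [B]
        by_cases hs : s ∈ Ioo 0 t
        · rw [indicator_of_mem hs, indicator_of_mem hs, mul_ofReal_rpow hp _
            (hb.slow₁.pos s ⟨hs.1, hs.2.trans ht.2⟩).le, opS_rpow hp, mul_comm]
        · rw [indicator_of_notMem hs, indicator_of_notMem hs, zero_mul]
    _ = ∫⁻ r, k r * (∫⁻ s in Ioo 0 r, B s) ∂leb01 := lintegral_mul_lintegral_Ioo hB hk
    _ ≤ ∫⁻ r, ‖h r‖ₑ ^ p * κ r ∂leb01 := by
        refine lintegral_mono_ae ?_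
        filter_upwards [ae_restrict_mem measurableSet_Ioo] with r hr
        exact hpoint r hr
    _ ≤ (L + M) * ∫⁻ s in Ioo 0 (phi p b₁ b₂ t), rearr leb01 (fun r => ‖h r‖ₑ ^ p) s :=
        lintegral_mul_le_rearr ((aemeasurable_enorm_coe h).pow_const p) hκm hφ hκle hκint
    _ = _ := by
        simp only [rearr_rpow hp]
        rfl

theorem bounded01_opS_of_forall_isGaussible [IsProbabilityMeasure μ] [IsProbabilityMeasure ν]
    (hμ : Nonatomic μ) (hν : Nonatomic ν) (hp : 0 < p) (hb : ClassB p b₁ b₂)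
    (hY : IsRIQuasiNorm ρY) (hXp : PConvex p ρX)
    (H : ∀ T : Lp ℂ (ENNReal.ofReal p) μ → (S →ₘ[ν] ℂ), IsGaussible p b₁ b₂ T →
      BoundedOp p ρX ρY T) :
    Bounded01 ρX ρY (opS p b₁) := by
  obtain ⟨C, hC⟩ := hb.exists_opS_gaussible hp
  exact bounded01_of_forall_isGaussible hμ hν hp hb hY hXp H
    (fun h => (antitone_opS h hp).antitoneOn _) (fun h hh t ht => hb.opS_lt_top hp hh ht) hC

end GaussibleToConcrete

/-! ### From U and S to the bound on T in the associate spaces. -/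

section ConcreteToDual

variable {p : ℝ} {b₁ b₂ : ℝ → ℝ} {ρX ρY : (ℝ → ℝ≥0∞) → ℝ≥0∞}

theorem exists_enorm_rpow_ae_eq (hp : 0 < p) {F : ℝ → ℝ≥0∞} (hF : AEMeasurable F leb01)
    (hFtop : ∀ᵐ t ∂leb01, F t < ∞) :
    ∃ f : ℝ →ₘ[leb01] ℂ, (fun t => ‖f t‖ₑ ^ p) =ᵐ[leb01] F := by
  have hm : AEStronglyMeasurable (fun t => (((F t ^ (1 / p)).toReal : ℝ) : ℂ)) leb01 :=
    (Complex.measurable_ofReal.comp_aemeasurable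
      (hF.pow_const (1 / p)).ennreal_toReal).aestronglyMeasurable
  refine ⟨AEEqFun.mk _ hm, ?_⟩
  filter_upwards [AEEqFun.coeFn_mk _ hm, hFtop] with t ht ht'
  have hne : F t ^ (1 / p) ≠ ∞ := (ENNReal.rpow_lt_top_of_nonneg (by positivity) ht'.ne).ne
  have e : ‖(((F t ^ (1 / p)).toReal : ℝ) : ℂ)‖ₑ = F t ^ (1 / p) := by
    lift F t ^ (1 / p) to ℝ≥0 using hne with x
    simp [enorm_eq_nnnorm]
  rw [ht, e, rpow_inv_rpow_cancel hp]

theorem PConvex.spaceNorm_rpow (hp : 0 < p) (hXp : PConvex p ρX) {F : ℝ → ℝ≥0∞}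
    (hF : AEMeasurable F leb01) {f : ℝ →ₘ[leb01] ℂ}
    (hf : (fun t => ‖f t‖ₑ ^ p) =ᵐ[leb01] F) : spaceNorm ρX f ^ p = powNorm p ρX F := by
  rw [spaceNorm, ← powNorm_rpow hp]
  have e : (fun t => star f t ^ p) = rearr leb01 F := by
    rw [← rearr_congr_ae hf]
    exact funext fun t => (rearr_rpow hp _ t).symm
  rw [e]
  exact IsRIQuasiNorm.apply_rearr hXp.toIsRIQuasiNorm hF

theorem PConvex.lintegral_star_mul_rpow_le (hp : 0 < p) (hYp : PConvex p ρY)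
    {A : (ℝ →ₘ[leb01] ℂ) → ℝ → ℝ≥0∞} {C : ℝ≥0}
    (hA : ∀ f : ℝ →ₘ[leb01] ℂ, spaceNorm ρX f < ∞ → ρY (A f) ≤ C * spaceNorm ρX f)
    {f : ℝ →ₘ[leb01] ℂ} (hAm : AEMeasurable (A f) leb01) (hf : spaceNorm ρX f ^ p ≤ 1)
    (G : ℝ → ℝ≥0∞) :
    ∫⁻ t, G t * A f t ^ p ∂leb01 ≤ ((C ^ p : ℝ≥0) : ℝ≥0∞) * assoc (powNorm p ρY) G := by
  have hf1 : spaceNorm ρX f ≤ 1 := by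
    rwa [← ENNReal.one_rpow p, ENNReal.rpow_le_rpow_iff hp] at hf
  have hN : powNorm p ρY (fun t => A f t ^ p) ≤ ((C ^ p : ℝ≥0) : ℝ≥0∞) := by
    rw [powNorm_rpow hp, ENNReal.coe_rpow_of_nonneg _ hp.le]
    refine ENNReal.rpow_le_rpow ((hA f (hf1.trans_lt ENNReal.one_lt_top)).trans ?_) hp.le
    exact mul_le_of_le_one_right zero_le hf1
  refine (IsRIQuasiNorm.lintegral_mul_le hYp.toIsRIQuasiNorm G (hAm.pow_const p)
    (hN.trans_lt ENNReal.coe_lt_top)).trans ?_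
  rw [mul_comm]
  exact mul_le_mul' hN le_rfl

/-- After u = ψ(r) the supremum runs over u ≥ s. For u ≤ φ(s), b₁(s) ≲ b₁(φ(s)) ≤ b₁(u) and g*(u) ≤
g*(s), so the quotient at s dominates. The remaining u lie beyond φ(s) and give a function of φ(s),
ready for substituting back. -/
theorem ClassB.exists_opT_phi_le (hp : 0 < p) (hb : ClassB p b₁ b₂) : ∃ K : ℝ≥0,
    ∀ g : ℝ →ₘ[leb01] ℂ, ∀ s ∈ Ioo (0 : ℝ) 1, opT p b₁ b₂ g (phi p b₁ b₂ s) ≤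
      K * (star g s / ENNReal.ofReal (b₁ s ^ p)) +
        ⨆ r ∈ Ioo (phi p b₁ b₂ s) 1, star g r / ENNReal.ofReal (b₁ r ^ p) := by
  obtain ⟨K, hK, h⟩ := hb.le_comp_phi hp
  refine ⟨(K ^ p).toNNReal, fun g s hs => iSup₂_le fun r hr => ?_⟩
  have hφ := hb.phi_mem hp hs
  have hr' : r ∈ Ioo (0 : ℝ) 1 := ⟨hφ.1.trans_le hr.1, hr.2⟩
  change star g (psi p b₁ b₂ r) / ENNReal.ofReal (b₁ (psi p b₁ b₂ r) ^ p) ≤ _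
  have hu := hb.psi_mem hp hr'
  set u := psi p b₁ b₂ r
  rcases le_or_gt u (phi p b₁ b₂ s) with hle | hlt
  · refine le_trans ?_ le_self_add
    have hsu : s ≤ u := by
      rw [← hb.psi_phi hp (Ioo_subset_Icc_self hs)]
      exact (hb.strictMonoOn_psi hp).monotoneOn (Ioo_subset_Icc_self hφ)
        (Ioo_subset_Icc_self hr') hr.1
    have h1 := hb.slow₁.pos s hs
    have h2 := hb.slow₁.pos u hu
    have hbs : b₁ s ≤ K * b₁ u :=
      (h s hs).trans (mul_le_mul_of_nonneg_left (hb.anti₁ hu hφ hle) hK.le)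
    have hbp : (b₁ u ^ p)⁻¹ ≤ K ^ p * (b₁ s ^ p)⁻¹ := by
      have h1p := Real.rpow_pos_of_pos h1 p
      have h2p := Real.rpow_pos_of_pos h2 p
      have h3 : b₁ s ^ p ≤ K ^ p * b₁ u ^ p := by
        rw [← Real.mul_rpow hK.le h2.le]
        exact Real.rpow_le_rpow h1.le hbs hp.le
      rw [← div_eq_mul_inv, le_div_iff₀ h1p, inv_mul_le_iff₀ h2p, mul_comm]
      exact h3
    rw [div_eq_mul_inv, div_eq_mul_inv, ← ENNReal.ofReal_inv_of_pos (Real.rpow_pos_of_pos h1 p),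
      ← ENNReal.ofReal_inv_of_pos (Real.rpow_pos_of_pos h2 p)]
    calc star g u * ENNReal.ofReal (b₁ u ^ p)⁻¹
        ≤ star g s * ENNReal.ofReal (K ^ p * (b₁ s ^ p)⁻¹) :=
          mul_le_mul' (antitone_star g hsu) (ENNReal.ofReal_le_ofReal hbp)
      _ = _ := by
          rw [ENNReal.ofReal_mul (by positivity)]
          change _ = ENNReal.ofReal (K ^ p) * _
          ring
  · refine le_trans ?_ le_add_self
    exact le_iSup₂_of_le u ⟨hlt, hu.2⟩ le_rfl

/-- Slow variation makes the quotient on (r/2, r) at least a fixed fraction of its value at r. That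
interval has length r/2 > t/2, so the rearrangement at t/2 is at least the same fraction. -/
theorem ClassB.exists_iSup_le_rearr_half (hp : 0 < p) (hb : ClassB p b₁ b₂) : ∃ K : ℝ≥0,
    ∀ g : ℝ →ₘ[leb01] ℂ, ∀ t ∈ Ioo (0 : ℝ) 1,
      ⨆ r ∈ Ioo t 1, star g r / ENNReal.ofReal (b₁ r ^ p) ≤
        K * rearr leb01 (fun r => star g r / ENNReal.ofReal (b₁ r ^ p)) (t / 2) := by
  obtain ⟨K, hK, h⟩ := hb.rpow_le_rpow_half hp
  have hK0 : (K * 2).toNNReal ≠ 0 := (Real.toNNReal_pos.2 (by positivity)).ne'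
  refine ⟨(K * 2).toNNReal, fun g t ht => iSup₂_le fun r hr => ?_⟩
  have hr' : r ∈ Ioo (0 : ℝ) 1 := ⟨ht.1.trans hr.1, hr.2⟩
  have key : ∀ s ∈ Ioo (r / 2) r, star g r / ENNReal.ofReal (b₁ r ^ p) ≤
      (K * 2).toNNReal * (star g s / ENNReal.ofReal (b₁ s ^ p)) := by
    intro s hs
    have hs' : s ∈ Ioo (0 : ℝ) 1 := ⟨(half_pos hr'.1).trans hs.1, hs.2.trans hr'.2⟩
    have h1 := Real.rpow_pos_of_pos (hb.slow₁.pos s hs') p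
    have h2 := Real.rpow_pos_of_pos (hb.slow₁.pos r hr') p
    have h3 : (r / s) ^ (1 / 2 : ℝ) ≤ 2 := by
      have h4 : 1 ≤ r / s := (one_le_div hs'.1).2 hs.2.le
      calc (r / s) ^ (1 / 2 : ℝ) ≤ (r / s) ^ (1 : ℝ) :=
            Real.rpow_le_rpow_of_exponent_le h4 (by norm_num)
        _ = r / s := Real.rpow_one _
        _ ≤ 2 := by
            rw [div_le_iff₀ hs'.1]
            linarith [hs.1]
    have hbp : (b₁ r ^ p)⁻¹ ≤ K * 2 * (b₁ s ^ p)⁻¹ := by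
      rw [← div_eq_mul_inv, le_div_iff₀ h1, inv_mul_le_iff₀ h2, mul_comm]
      exact (h s hs' r hr' hs.2.le).trans (by gcongr)
    rw [div_eq_mul_inv, div_eq_mul_inv, ← ENNReal.ofReal_inv_of_pos h1,
      ← ENNReal.ofReal_inv_of_pos h2]
    calc star g r * ENNReal.ofReal (b₁ r ^ p)⁻¹
        ≤ star g s * ENNReal.ofReal (K * 2 * (b₁ s ^ p)⁻¹) :=
          mul_le_mul' (antitone_star g hs.2.le) (ENNReal.ofReal_le_ofReal hbp)
      _ = _ := by
          rw [ENNReal.ofReal_mul (by positivity)]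
          change _ = ENNReal.ofReal (K * 2) * _
          ring
  have hK0' : ((K * 2).toNNReal : ℝ≥0∞) ≠ 0 := ENNReal.coe_ne_zero.2 hK0
  rw [mul_comm, ← ENNReal.div_le_iff hK0' ENNReal.coe_ne_top]
  refine le_of_forall_lt fun l hl => ?_
  rw [lt_rearr_iff]
  calc ENNReal.ofReal (t / 2) < ENNReal.ofReal (r / 2) :=
        (ENNReal.ofReal_lt_ofReal_iff (half_pos hr'.1)).2 (by linarith [hr.1])
    _ = volume (Ioo (r / 2) r) := by rw [Real.volume_Ioo, sub_half]
    _ = leb01 (Ioo (r / 2) r) := by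
        rw [Measure.restrict_apply measurableSet_Ioo, inter_eq_left.2]
        exact Ioo_subset_Ioo (half_pos hr'.1).le hr'.2.le
    _ ≤ _ := measure_mono fun s hs => hl.trans_le (by
        rw [ENNReal.div_le_iff hK0' ENNReal.coe_ne_top, mul_comm]
        exact key s hs)

/-- Fubini rewrites the right side with the factor ∫_0^r G, which is at least r G(r); the r cancels
the one in the kernel of S. -/
theorem ClassB.lintegral_div_mul_le_opS (hp : 0 < p) (hb : ClassB p b₁ b₂) {G F : ℝ → ℝ≥0∞}
    (hG : Antitone G) {f : ℝ →ₘ[leb01] ℂ} (hf : (fun t => ‖f t‖ₑ ^ p) =ᵐ[leb01] F) :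
    ∫⁻ r, G r / ENNReal.ofReal (b₁ r ^ p) * F r ∂leb01 ≤ ∫⁻ s, G s * opS p b₁ f s ^ p ∂leb01 := by
  simp only [opS_rpow hp]
  rw [lintegral_mul_lintegral_Ioo hG.measurable.aemeasurable (hb.aemeasurable_kernel f)]
  refine lintegral_mono_ae ?_
  filter_upwards [hf, ae_restrict_mem measurableSet_Ioo] with r hr hr'
  have h1 := Real.rpow_pos_of_pos (hb.slow₁.pos r hr') p
  have h0 : ENNReal.ofReal r ≠ 0 := (ENNReal.ofReal_pos.2 hr'.1).ne'
  have h2 : ENNReal.ofReal (b₁ r ^ p) ≠ 0 := (ENNReal.ofReal_pos.2 h1).ne'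
  rw [← hr]
  calc G r / ENNReal.ofReal (b₁ r ^ p) * ‖f r‖ₑ ^ p
      = ‖f r‖ₑ ^ p / ENNReal.ofReal (r * b₁ r ^ p) * (ENNReal.ofReal r * G r) := by
        rw [ENNReal.ofReal_mul hr'.1.le, div_eq_mul_inv, div_eq_mul_inv,
          ENNReal.mul_inv (Or.inl h0) (Or.inl ENNReal.ofReal_ne_top)]
        calc _ = ((ENNReal.ofReal r)⁻¹ * ENNReal.ofReal r) *
              (G r * (ENNReal.ofReal (b₁ r ^ p))⁻¹ * ‖f r‖ₑ ^ p) := by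
              rw [ENNReal.inv_mul_cancel h0 ENNReal.ofReal_ne_top, one_mul]
          _ = _ := by ring
    _ ≤ _ := mul_le_mul' le_rfl (ofReal_mul_le_setLIntegral hG r)

theorem bounded01_opT (hp : 0 < p) (hb : ClassB p b₁ b₂) (hXp : PConvex p ρX)
    (hYp : PConvex p ρY) (hU : Bounded01 ρX ρY (opU p b₁ b₂)) (hS : Bounded01 ρX ρY (opS p b₁)) :
    Bounded01 (assoc (powNorm p ρY)) (assoc (powNorm p ρX)) (opT p b₁ b₂) := by
  obtain ⟨CU, hCU⟩ := hU
  obtain ⟨CS, hCS⟩ := hS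
  obtain ⟨K, hK⟩ := hb.exists_opT_phi_le hp
  obtain ⟨L, hL⟩ := hb.exists_iSup_le_rearr_half hp
  have hm := hb.mass_pos hp
  set m : ℝ≥0 := (mass p b₁ b₂).toNNReal with hmdef
  have hm0 : m ≠ 0 := (Real.toNNReal_pos.2 hm).ne'
  refine ⟨m⁻¹ * (K * CU ^ p + m * (L * (2 * CS ^ p))), fun g _ => assoc_le fun F hF hF1 => ?_⟩
  change _ ≤ _ * assoc (powNorm p ρY) (star g)
  set M := assoc (powNorm p ρY) (star g)
  set H : ℝ → ℝ≥0∞ := fun r => star g r / ENNReal.ofReal (b₁ r ^ p) with hHdef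
  set D : ℝ → ℝ≥0∞ := fun t => ⨆ r ∈ Ioo t 1, H r
  have hD : Antitone D := fun _ _ hst => biSup_mono fun _ hr => ⟨hst.trans_lt hr.1, hr.2⟩
  have hHm : AEMeasurable H leb01 :=
    (measurable_star g).aemeasurable.div (hb.aemeasurable₁.pow_const p).ennreal_ofReal
  have hHtop : ∀ᵐ t ∂leb01, H t < ∞ := by
    filter_upwards [ae_restrict_mem measurableSet_Ioo] with t ht
    exact ENNReal.div_lt_top (star_lt_top g ht.1).ne
      (ENNReal.ofReal_pos.2 (Real.rpow_pos_of_pos (hb.slow₁.pos t ht) p)).ne'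
  have hFint : ∫⁻ t, F t ∂leb01 < ∞ :=
    IsRIBanachNorm.lintegral_lt_top hXp hF (hF1.trans_lt ENNReal.one_lt_top)
  set F₀ : ℝ → ℝ≥0∞ := rearr leb01 F
  have hF₀m : Measurable F₀ := measurable_rearr _ _
  -- With |f|^p = F almost everywhere, b₁^p cancels between H and the weight, leaving g* (U f)^p.
  have hUpart : ∫⁻ s, H s * (F₀ (phi p b₁ b₂ s) * ENNReal.ofReal (weight p b₁ b₂ s)) ∂leb01 ≤
      (CU ^ p : ℝ≥0) * M := by
    obtain ⟨f, hf⟩ := exists_enorm_rpow_ae_eq hp hF (ae_lt_top' hF hFint.ne)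
    have hfF : (fun t => star f t ^ p) = F₀ := by
      rw [show F₀ = rearr leb01 F from rfl, ← rearr_congr_ae hf]
      exact funext fun t => (rearr_rpow hp _ t).symm
    refine le_trans (lintegral_mono_ae ?_) (hYp.lintegral_star_mul_rpow_le hp hCU
      (aemeasurable_restrict_of_antitoneOn measurableSet_Ioo (hb.antitoneOn_opU hp f))
      ((hXp.spaceNorm_rpow hp hF hf).trans_le hF1) (star g))
    filter_upwards [ae_restrict_mem measurableSet_Ioo] with s hs
    have h1 := Real.rpow_pos_of_pos (hb.slow₁.pos s hs) p
    have h2 := hb.slow₂.pos s hs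
    have hB1 : ENNReal.ofReal (b₁ s ^ p) ≠ 0 := (ENNReal.ofReal_pos.2 h1).ne'
    have e1 : opU p b₁ b₂ f s ^ p = F₀ (phi p b₁ b₂ s) * (ENNReal.ofReal (b₂ s ^ p))⁻¹ := by
      rw [← hfF, ← ENNReal.ofReal_rpow_of_pos h2, ← ENNReal.inv_rpow,
        ← ENNReal.mul_rpow_of_nonneg _ _ hp.le]
      rfl
    have e2 : ENNReal.ofReal (weight p b₁ b₂ s) =
        ENNReal.ofReal (b₁ s ^ p) * (ENNReal.ofReal (b₂ s ^ p))⁻¹ := by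
      rw [← ENNReal.ofReal_inv_of_pos (Real.rpow_pos_of_pos h2 p), ← ENNReal.ofReal_mul h1.le,
        ← Real.inv_rpow h2.le, ← Real.mul_rpow (hb.slow₁.pos s hs).le (inv_pos.2 h2).le]
      rfl
    refine le_of_eq ?_
    rw [e1, e2, hHdef]
    simp only
    rw [div_eq_mul_inv]
    calc _ = ((ENNReal.ofReal (b₁ s ^ p))⁻¹ * ENNReal.ofReal (b₁ s ^ p)) *
          (star g s * (F₀ (phi p b₁ b₂ s) * (ENNReal.ofReal (b₂ s ^ p))⁻¹)) := by ring
      _ = _ := by rw [ENNReal.inv_mul_cancel hB1 ENNReal.ofReal_ne_top, one_mul]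
  -- H need not be monotone, so resonance is used: each F' equimeasurable with F has the same norm,
  -- and its pairing with H is bounded through S.
  have hSpart : ∫⁻ t, rearr leb01 H t * F₀ t ∂leb01 ≤ (CS ^ p : ℝ≥0) * M := by
    refine lintegral_rearr_mul_rearr_le hHm hHtop hF hFint fun F' hF' he => ?_
    have hN : powNorm p ρX F' ≤ 1 :=
      (IsRIQuasiNorm.congr_rearr hXp.toIsRIQuasiNorm hF' hF he).trans_le hF1
    have hF'int : ∫⁻ t, F' t ∂leb01 < ∞ :=
      IsRIBanachNorm.lintegral_lt_top hXp hF' (hN.trans_lt ENNReal.one_lt_top)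
    obtain ⟨f, hf⟩ := exists_enorm_rpow_ae_eq hp hF' (ae_lt_top' hF' hF'int.ne)
    exact (hb.lintegral_div_mul_le_opS hp (antitone_star g) hf).trans
      (hYp.lintegral_star_mul_rpow_le hp hCS (antitone_opS f hp).measurable.aemeasurable
        ((hXp.spaceNorm_rpow hp hF' hf).trans_le hN) (star g))
  -- Move F₀ to t/2 as well, by monotonicity; undoing the dilation costs the factor 2.
  have hDpart : ∫⁻ t, D t * F₀ t ∂leb01 ≤ L * (2 * ((CS ^ p : ℝ≥0) * M)) := by
    calc ∫⁻ t, D t * F₀ t ∂leb01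
        ≤ ∫⁻ t, L * (rearr leb01 H (t / 2) * F₀ (t / 2)) ∂leb01 := by
          refine lintegral_mono_ae ?_
          filter_upwards [ae_restrict_mem measurableSet_Ioo] with t ht
          rw [← mul_assoc]
          exact mul_le_mul' (hL g t ht) (antitone_rearr _ _ (half_le_self ht.1.le))
      _ = L * ∫⁻ t, rearr leb01 H (t / 2) * F₀ (t / 2) ∂leb01 :=
          lintegral_const_mul' _ _ ENNReal.coe_ne_top
      _ ≤ L * (2 * ∫⁻ t, rearr leb01 H t * F₀ t ∂leb01) :=
          mul_le_mul' le_rfl (setLIntegral_comp_half_le (fun t => rearr leb01 H t * F₀ t) 1)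
      _ ≤ _ := mul_le_mul' le_rfl (mul_le_mul' le_rfl hSpart)
  have hmain : m * ∫⁻ t, opT p b₁ b₂ g t * F₀ t ∂leb01 ≤
      K * ((CU ^ p : ℝ≥0) * M) + m * (L * (2 * ((CS ^ p : ℝ≥0) * M))) := by
    have hEm : AEMeasurable (fun s => K * (H s * (F₀ (phi p b₁ b₂ s) *
        ENNReal.ofReal (weight p b₁ b₂ s)))) leb01 :=
      (hHm.mul ((hF₀m.comp_aemeasurable (hb.aemeasurable_phi hp)).mul
        (hb.aemeasurable_weight hp).ennreal_ofReal)).const_mul _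
    calc m * ∫⁻ t, opT p b₁ b₂ g t * F₀ t ∂leb01
        = ∫⁻ s, opT p b₁ b₂ g (phi p b₁ b₂ s) * F₀ (phi p b₁ b₂ s) *
            ENNReal.ofReal (weight p b₁ b₂ s) ∂leb01 :=
          (hb.lintegral_comp_phi hp (F := fun t => opT p b₁ b₂ g t * F₀ t)
            ((antitone_opT g).measurable.mul hF₀m)).symm
      _ ≤ ∫⁻ s, (K * (H s * (F₀ (phi p b₁ b₂ s) * ENNReal.ofReal (weight p b₁ b₂ s))) +
            D (phi p b₁ b₂ s) * F₀ (phi p b₁ b₂ s) * ENNReal.ofReal (weight p b₁ b₂ s))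
            ∂leb01 := by
          refine lintegral_mono_ae ?_
          filter_upwards [ae_restrict_mem measurableSet_Ioo] with s hs
          refine (mul_le_mul' (mul_le_mul' (hK g s hs) le_rfl) le_rfl).trans_eq ?_
          change (K * H s + D (phi p b₁ b₂ s)) * _ * _ = _
          ring
      _ = K * (∫⁻ s, H s * (F₀ (phi p b₁ b₂ s) * ENNReal.ofReal (weight p b₁ b₂ s)) ∂leb01) +
            m * ∫⁻ t, D t * F₀ t ∂leb01 := by
          rw [lintegral_add_left' hEm, lintegral_const_mul' _ _ ENNReal.coe_ne_top,
            hb.lintegral_comp_phi hp (F := fun t => D t * F₀ t) (hD.measurable.mul hF₀m)]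
          rfl
      _ ≤ _ := add_le_add (mul_le_mul' le_rfl hUpart) (mul_le_mul' le_rfl hDpart)
  calc ∫⁻ t, opT p b₁ b₂ g t * F t ∂leb01 ≤ ∫⁻ t, opT p b₁ b₂ g t * F₀ t ∂leb01 := by
        simpa only [mul_comm] using
          lintegral_mul_le_rearr_mul hF
            ((antitone_opT (p := p) (b₁ := b₁) (b₂ := b₂) g).antitoneOn _)
    _ = (m⁻¹ : ℝ≥0) * (m * ∫⁻ t, opT p b₁ b₂ g t * F₀ t ∂leb01) := by
        rw [← mul_assoc, ← ENNReal.coe_mul, inv_mul_cancel₀ hm0, ENNReal.coe_one, one_mul]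
    _ ≤ (m⁻¹ : ℝ≥0) * (K * ((CU ^ p : ℝ≥0) * M) + m * (L * (2 * ((CS ^ p : ℝ≥0) * M)))) :=
        mul_le_mul' le_rfl hmain
    _ = _ := by
        push_cast
        ring

end ConcreteToDual

end Gaussible

end

theorem mainTheorem2 {R S : Type*} [MeasurableSpace R] [MeasurableSpace S]
    (μ : MeasureTheory.Measure R) (ν : MeasureTheory.Measure S)
    [MeasureTheory.IsProbabilityMeasure μ] [MeasureTheory.IsProbabilityMeasure ν]
    (hμ : Gaussible.Nonatomic μ) (hν : Gaussible.Nonatomic ν)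
    (p : ℝ) (hp : 0 < p) (b₁ b₂ : ℝ → ℝ) (hb : Gaussible.ClassB p b₁ b₂)
    (ρX ρY : (ℝ → ℝ≥0∞) → ℝ≥0∞)
    (hX : Gaussible.IsRIQuasiNorm ρX) (hY : Gaussible.IsRIQuasiNorm ρY)
    (hXp : Gaussible.PConvex p ρX) (hYp : Gaussible.PConvex p ρY) :
    List.TFAE [
      ∀ T : MeasureTheory.Lp ℂ (ENNReal.ofReal p) μ → (S →ₘ[ν] ℂ),
        Gaussible.IsGaussible p b₁ b₂ T → Gaussible.BoundedOp p ρX ρY T,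
      ∀ T : MeasureTheory.Lp ℂ (ENNReal.ofReal p) μ → (S →ₘ[ν] ℂ),
        Gaussible.KInequality p b₁ b₂ T → Gaussible.BoundedOp p ρX ρY T,
      Gaussible.Bounded01 ρX ρY (Gaussible.opU p b₁ b₂) ∧
        Gaussible.Bounded01 ρX ρY (Gaussible.opS p b₁),
      Gaussible.Bounded01 (Gaussible.assoc (Gaussible.powNorm p ρY))
        (Gaussible.assoc (Gaussible.powNorm p ρX)) (Gaussible.opT p b₁ b₂)] := by
  tfae_have 1 → 2 := fun h T hT => h T (hT.isGaussible hp hb)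
  tfae_have 2 → 1 := fun h T hT => h T (hT.kInequality hp hb)
  tfae_have 1 → 3 := fun h =>
    ⟨Gaussible.bounded01_opU_of_forall_isGaussible hμ hν hp hb hY hXp h,
      Gaussible.bounded01_opS_of_forall_isGaussible hμ hν hp hb hY hXp h⟩
  tfae_have 3 → 4 := fun h => Gaussible.bounded01_opT hp hb hXp hYp h.1 h.2
  tfae_have 4 → 1 := fun h _ hT => hT.boundedOp_of_opT hp hb hXp hYp h
  tfae_finish
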